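/- Let $\mathsf{M}$ be a Hausdorff, second countable real analytic manifold of dimension $n$ and let $\pi\colon\mathsf{E}\to\mathsf{M}$ be a real analytic vector bundle whose fibres have dimension $k$. Let $\Gamma^\omega(\mathsf{E})$ be the real vector space of real analytic sections of $\mathsf{E}$. Let $c_0(\mathbb{Z}_{\ge0};\mathbb{R}_{>0})$ be the set of sequences $\boldsymbol{a}=(a_j)_{j\ge0}$ of positive real numbers that converge to $0$. *Intrinsic seminorms.* Let $\mathbb{G}_{\mathsf{M}}$ be a Riemannian metric on $\mathsf{M}$, $\mathbb{G}_{\mathsf{E}}$ a fibre metric on $\mathsf{E}$, $\nabla^{\mathsf{M}}$ an affine connection on $\mathsf{M}$ and $\nabla^{\mathsf{E}}$ a linear connection in $\mathsf{E}$, all real analytic. For a section $\xi$ let $\nabla^m\xi$ be its $m$-th iterated covariant derivative, a section of $\bigotimes^m\mathsf{T}^*\mathsf{M}\otimes\mathsf{E}$, formed with the connections induced by $\nabla^{\mathsf{M}}$ and $\nabla^{\mathsf{E}}$; put $D^0\xi=\xi$ and $D^m\xi=(\mathrm{Sym}_m\otimes\mathrm{id})(\nabla^m\xi)$, where $\mathrm{Sym}_m$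 is the average over all permutations of the $m$ factors. With the norms on the fibres of $\bigotimes^j\mathsf{T}^*\mathsf{M}\otimes\mathsf{E}$ induced by $\mathbb{G}_{\mathsf{M}}$ and $\mathbb{G}_{\mathsf{E}}$, set $$\|j_m\xi(x)\|=\Bigl(\sum_{j=0}^m\bigl\|\tfrac1{j!}D^j\xi(x)\bigr\|^2\Bigr)^{1/2},\qquad p^\omega_{K,\boldsymbol a}(\xi)=\sup\{a_0a_1\cdots a_m\,\|j_m\xi(x)\| : x\in K,\ m\in\mathbb{Z}_{\ge0}\}$$ for $K\subset\mathsf{M}$ compact and $\boldsymbol a\in c_0(\mathbb{Z}_{\ge0};\mathbb{R}_{>0})$. *Local seminorms.* A vector bundle chart $\psi$ of $\mathsf{E}$, with induced chart $\phi\colon U\to\phi(U)\subset\mathbb{R}^n$ of $\mathsf{M}$, is a real analytic, fibrewise linear isomorphism $\psi\colon\pi^{-1}(U)\to\phi(U)\times\mathbb{R}^k$ over $\phi$; for a section $\xi$ define $\psi_*\xi\colon\phi(U)\to\mathbb{R}^k$ by $\psi(\xi(\phi^{-1}(\boldsymbol x)))=(\boldsymbol x,\psi_*\xi(\boldsymbol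 x))$. For $K\subset\phi(U)$ compact, $\boldsymbol a\in c_0(\mathbb{Z}_{\ge0};\mathbb{R}_{>0})$ and $\boldsymbol\Phi=(\Phi^1,\dots,\Phi^k)\colon\phi(U)\to\mathbb{R}^k$ real analytic, set $$p'^{\,\omega}_{K,\boldsymbol a}(\boldsymbol\Phi)=\sup\Bigl\{\frac{a_0a_1\cdots a_m}{I!}\,|D^I\Phi^c(\boldsymbol x)| : \boldsymbol x\in K,\ c\in\{1,\dots,k\},\ m\in\mathbb{Z}_{\ge0},\ I\in\mathbb{Z}_{\ge0}^n,\ |I|\le m\Bigr\}.$$ A supremum over the empty set is taken to be $0$. **Theorem.** All $p^\omega_{K,\boldsymbol a}$ and all $p'^{\,\omega}_{K,\boldsymbol a}\circ\psi_*$ are finite and are seminorms on $\Gamma^\omega(\mathsf{E})$, and for every choice of $\mathbb{G}_{\mathsf{M}},\mathbb{G}_{\mathsf{E}},\nabla^{\mathsf{M}},\nabla^{\mathsf{E}}$ as above the following two families of seminorms define the same topology on $\Gamma^\omega(\mathsf{E})$: 1. $p^\omega_{K,\boldsymbol a}$, for $K\subset\mathsf{M}$ compact and $\boldsymbol a\in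 c_0(\mathbb{Z}_{\ge0};\mathbb{R}_{>0})$; 2. $p'^{\,\omega}_{K,\boldsymbol a}\circ\psi_*$, for $\psi$ a vector bundle chart of $\mathsf{E}$ with induced chart $(U,\phi)$, $K\subset\phi(U)$ compact and $\boldsymbol a\in c_0(\mathbb{Z}_{\ge0};\mathbb{R}_{>0})$. Consequently the topology defined by the family 1 does not depend on the choice of the metrics and connections: any two such choices define the same topology. -/

import Mathlib

open Bundle Manifold Set Filter Topology
open scoped ContDiff ENNReal

namespace JetTopology

universe u v w

noncomputable section

/-! ### Induced connections and iterated covariant derivatives -/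

section Connections

variable {n : ℕ} {M : Type u} [TopologicalSpace M] [ChartedSpace (EuclideanSpace ℝ (Fin n)) M]
  [IsManifold (𝓡 n) ω M]

/-- An affine connection on `M`: a covariant derivative on the tangent bundle. -/
abbrev AffineConnection (n : ℕ) (M : Type u) [TopologicalSpace M]
    [ChartedSpace (EuclideanSpace ℝ (Fin n)) M] [IsManifold (𝓡 n) ω M] : Type u :=
  CovariantDerivative (𝓡 n) (EuclideanSpace ℝ (Fin n)) (TangentSpace (𝓡 n) : M → Type)

variable {F : Type w} [NormedAddCommGroup F] [NormedSpace ℝ F]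
  {V : M → Type v} [TopologicalSpace (TotalSpace F V)]
  [∀ x, AddCommGroup (V x)] [∀ x, Module ℝ (V x)] [∀ x, TopologicalSpace (V x)]
  [∀ x, IsTopologicalAddGroup (V x)] [∀ x, ContinuousSMul ℝ (V x)]
  [FiberBundle F V] [VectorBundle ℝ F V]

/-- A connection is real analytic if, over every open set, it maps real analytic sections to real
analytic sections. -/
def IsAnalyticConnection (D : CovariantDerivative (𝓡 n) F V) : Prop :=
  ∀ U : Set M, IsOpen U → ContMDiffCovariantDerivativeOn F ω D.toFun U

/-- For a section `A` of `Hom(TM, V)`, a vector field `Y` and a point `x`, the linear map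
`X ↦ ∇_X (A Y) - A (∇_X Y)` on the tangent space at `x`. -/
def homDerivAux (DM : AffineConnection n M) (D : CovariantDerivative (𝓡 n) F V)
    (A : Π x : M, TangentSpace (𝓡 n) x →L[ℝ] V x) (x : M) (Y : Π x : M, TangentSpace (𝓡 n) x) :
    TangentSpace (𝓡 n) x →L[ℝ] V x :=
  D (fun y ↦ A y (Y y)) x - (A x).comp (DM Y x)

/-- Differentiability at a point of a section of a vector bundle. -/
def DiffSectionAt (n : ℕ) {M : Type u} [TopologicalSpace M]
    [ChartedSpace (EuclideanSpace ℝ (Fin n)) M] (F : Type w) [NormedAddCommGroup F] [NormedSpace ℝ F]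
    {V : M → Type v} [TopologicalSpace (TotalSpace F V)] [∀ x, TopologicalSpace (V x)]
    [FiberBundle F V] (σ : Π x : M, V x) (x : M) : Prop :=
  MDifferentiableAt (𝓡 n) ((𝓡 n).prod 𝓘(ℝ, F)) (fun y ↦ TotalSpace.mk' F y (σ y)) x

theorem diffSectionAt_apply
    {A : Π x : M, TangentSpace (𝓡 n) x →L[ℝ] V x} {Y : Π x : M, TangentSpace (𝓡 n) x} {x : M}
    (hA : DiffSectionAt n (EuclideanSpace ℝ (Fin n) →L[ℝ] F) A x)
    (hY : DiffSectionAt n (EuclideanSpace ℝ (Fin n)) Y x) :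
    DiffSectionAt n F (fun y ↦ A y (Y y)) x :=
  MDifferentiableAt.clm_bundle_apply (F₁ := EuclideanSpace ℝ (Fin n)) (F₂ := F) hA hY

theorem tensorialAt_homDerivAux (DM : AffineConnection n M) (D : CovariantDerivative (𝓡 n) F V)
    {A : Π x : M, TangentSpace (𝓡 n) x →L[ℝ] V x} {x : M}
    (hA : DiffSectionAt n (EuclideanSpace ℝ (Fin n) →L[ℝ] F) A x) :
    TensorialAt (𝓡 n) (EuclideanSpace ℝ (Fin n)) (homDerivAux DM D A x) x where
  smul {f Y} hf hY := by
    have h1 := D.isCovariantDerivativeOnUniv.leibniz (diffSectionAt_apply hA hY) hf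
    have h2 := DM.isCovariantDerivativeOnUniv.leibniz hY hf
    have h3 : (fun y ↦ A y ((f • Y) y)) = f • (fun y ↦ A y (Y y)) := by
      ext y; simp
    simp only [homDerivAux]
    rw [h3, h1, h2]
    ext X
    simp [smul_sub]
  add {Y Y'} hY hY' := by
    have h1 := D.isCovariantDerivativeOnUniv.add (diffSectionAt_apply hA hY)
      (diffSectionAt_apply hA hY')
    have h2 := DM.isCovariantDerivativeOnUniv.add hY hY'
    have h3 : (fun y ↦ A y ((Y + Y') y)) = (fun y ↦ A y (Y y)) + (fun y ↦ A y (Y' y)) := by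
      ext y; simp
    simp only [homDerivAux]
    rw [h3, h1, h2]
    ext X
    simp
    abel

/-- Interchange the two arguments of a bilinear map on a tangent space. -/
def flipTangent {x : M} {W : Type v} [AddCommGroup W] [Module ℝ W] [TopologicalSpace W]
    [IsTopologicalAddGroup W] [ContinuousSMul ℝ W]
    (B : TangentSpace (𝓡 n) x →L[ℝ] TangentSpace (𝓡 n) x →L[ℝ] W) :
    TangentSpace (𝓡 n) x →L[ℝ] TangentSpace (𝓡 n) x →L[ℝ] W :=
  have : T2Space (TangentSpace (𝓡 n) x) := inferInstanceAs (T2Space (EuclideanSpace ℝ (Fin n)))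
  have : FiniteDimensional ℝ (TangentSpace (𝓡 n) x) :=
    inferInstanceAs (FiniteDimensional ℝ (EuclideanSpace ℝ (Fin n)))
  LinearMap.toContinuousLinearMap
    { toFun X := LinearMap.toContinuousLinearMap
        { toFun Y := B Y X
          map_add' := by simp
          map_smul' := by simp }
      map_add' := by intros; ext; simp
      map_smul' := by intros; ext; simp }

@[simp]
theorem flipTangent_apply {x : M} {W : Type v} [AddCommGroup W] [Module ℝ W] [TopologicalSpace W]
    [IsTopologicalAddGroup W] [ContinuousSMul ℝ W]
    (B : TangentSpace (𝓡 n) x →L[ℝ] TangentSpace (𝓡 n) x →L[ℝ] W) (X Y : TangentSpace (𝓡 n) x) :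
    flipTangent B X Y = B Y X := rfl

open scoped Classical in
/-- The covariant derivative of a section `A` of `Hom(TM, V)`, as a function of `X`, then `Y`:
`(∇_X A) Y = ∇_X (A Y) - A (∇_X Y)` (with value `0` where `A` is not differentiable). -/
def homDeriv (DM : AffineConnection n M) (D : CovariantDerivative (𝓡 n) F V)
    (A : Π x : M, TangentSpace (𝓡 n) x →L[ℝ] V x) (x : M) :
    TangentSpace (𝓡 n) x →L[ℝ] TangentSpace (𝓡 n) x →L[ℝ] V x :=
  if hA : DiffSectionAt n (EuclideanSpace ℝ (Fin n) →L[ℝ] F) A x then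
    flipTangent (TensorialAt.mkHom (homDerivAux DM D A x) x (tensorialAt_homDerivAux DM D hA))
  else 0

/-- The defining identity of the induced connection on `Hom(TM, V)`. -/
theorem homDeriv_apply (DM : AffineConnection n M) (D : CovariantDerivative (𝓡 n) F V)
    {A : Π x : M, TangentSpace (𝓡 n) x →L[ℝ] V x} {Y : Π x : M, TangentSpace (𝓡 n) x} {x : M}
    (hA : DiffSectionAt n (EuclideanSpace ℝ (Fin n) →L[ℝ] F) A x)
    (hY : DiffSectionAt n (EuclideanSpace ℝ (Fin n)) Y x) (X : TangentSpace (𝓡 n) x) :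
    homDeriv DM D A x X (Y x) = D (fun y ↦ A y (Y y)) x X - A x (DM Y x X) := by
  rw [homDeriv, dif_pos hA, flipTangent_apply, TensorialAt.mkHom_apply _ hY]
  rfl

theorem homDeriv_ext {x : M} {B B' : TangentSpace (𝓡 n) x →L[ℝ] TangentSpace (𝓡 n) x →L[ℝ] V x}
    (h : ∀ (Y : Π x : M, TangentSpace (𝓡 n) x), DiffSectionAt n (EuclideanSpace ℝ (Fin n)) Y x →
      ∀ X, B X (Y x) = B' X (Y x)) : B = B' := by
  ext X v
  have := h (FiberBundle.extend (EuclideanSpace ℝ (Fin n)) v)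
    (FiberBundle.mdifferentiableAt_extend ..) X
  simpa using this

/-- The connection on `Hom(TM, V) = T*M ⊗ V` induced by connections on `TM` and `V`. -/
def homConnection (DM : AffineConnection n M) (D : CovariantDerivative (𝓡 n) F V) :
    CovariantDerivative (𝓡 n) (EuclideanSpace ℝ (Fin n) →L[ℝ] F)
      (fun x : M ↦ TangentSpace (𝓡 n) x →L[ℝ] V x) where
  toFun := homDeriv DM D
  isCovariantDerivativeOnUniv :=
    { add := by
        intro A A' x hA hA' _
        have hs : DiffSectionAt n (EuclideanSpace ℝ (Fin n) →L[ℝ] F) (A + A') x :=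
          mdifferentiableAt_add_section hA hA'
        refine homDeriv_ext fun Y hY X ↦ ?_
        have h1 := D.isCovariantDerivativeOnUniv.add (diffSectionAt_apply hA hY)
          (diffSectionAt_apply hA' hY)
        have h3 : (fun y ↦ (A + A') y (Y y)) = (fun y ↦ A y (Y y)) + (fun y ↦ A' y (Y y)) := by
          ext y; simp
        simp only [_root_.add_apply]
        rw [homDeriv_apply DM D hs hY, homDeriv_apply DM D hA hY, homDeriv_apply DM D hA' hY, h3,
          h1]
        simp
        abel
      leibniz := by
        intro A g x hA hg _
        have hs : DiffSectionAt n (EuclideanSpace ℝ (Fin n) →L[ℝ] F) (g • A) x :=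
          hg.smul_section hA
        refine homDeriv_ext fun Y hY X ↦ ?_
        have h1 := D.isCovariantDerivativeOnUniv.leibniz (diffSectionAt_apply hA hY) hg
        have h3 : (fun y ↦ (g • A) y (Y y)) = g • (fun y ↦ A y (Y y)) := by
          ext y; simp
        rw [homDeriv_apply DM D hs hY, h3, h1]
        simp only [_root_.add_apply, _root_.smul_apply,
          ContinuousLinearMap.smulRight_apply]
        rw [homDeriv_apply DM D hA hY]
        simp [smul_sub]
        abel }

/-- The iterated covariant derivative `∇^m ξ`, a tensor field with values in `V`:
`∇^{m+1} ξ = ∇^m (∇ ξ)`, where `∇ ξ` is a section of `Hom(TM, V)` and that bundle carries the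
induced connection. -/
def iterCovDeriv (DM : AffineConnection n M) : (m : ℕ) →
    {F : Type w} → [NormedAddCommGroup F] → [NormedSpace ℝ F] →
    {V : M → Type v} → [TopologicalSpace (TotalSpace F V)] →
    [∀ x, AddCommGroup (V x)] → [∀ x, Module ℝ (V x)] → [∀ x, TopologicalSpace (V x)] →
    [∀ x, IsTopologicalAddGroup (V x)] → [∀ x, ContinuousSMul ℝ (V x)] →
    [FiberBundle F V] → [VectorBundle ℝ F V] →
    CovariantDerivative (𝓡 n) F V → (Π x, V x) → (x : M) →
    MultilinearMap ℝ (fun _ : Fin m ↦ TangentSpace (𝓡 n) x) (V x)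
  | 0, _, _, _, _, _, _, _, _, _, _, _, _, _, ξ, x => MultilinearMap.constOfIsEmpty ℝ _ (ξ x)
  | m + 1, _, _, _, _, _, _, _, _, _, _, _, _, D, ξ, x =>
    MultilinearMap.uncurryRight
      ((ContinuousLinearMap.coeLM ℝ).compMultilinearMap
        (iterCovDeriv DM m (homConnection DM D) (D ξ) x))

/-- The symmetrisation of a multilinear map. -/
def symmetrize {T : Type*} {W : Type*} [AddCommGroup T] [Module ℝ T] [AddCommGroup W] [Module ℝ W]
    {m : ℕ} (A : MultilinearMap ℝ (fun _ : Fin m ↦ T) W) :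
    MultilinearMap ℝ (fun _ : Fin m ↦ T) W :=
  ((m.factorial : ℝ)⁻¹) • ∑ σ : Equiv.Perm (Fin m), A.domDomCongr σ

/-- The symmetrised iterated covariant derivative `D^m ξ = Sym_m (∇^m ξ)`. -/
def symCovDeriv (DM : AffineConnection n M) (D : CovariantDerivative (𝓡 n) F V) (m : ℕ)
    (ξ : Π x, V x) (x : M) : MultilinearMap ℝ (fun _ : Fin m ↦ TangentSpace (𝓡 n) x) (V x) :=
  symmetrize (iterCovDeriv DM m D ξ x)

end Connections

/-! ### Metrics, fibre norms on jets and the intrinsic seminorms -/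

section Metrics

variable {n : ℕ} {M : Type u} [TopologicalSpace M] [ChartedSpace (EuclideanSpace ℝ (Fin n)) M]
  [IsManifold (𝓡 n) ω M]

/-- A real analytic Riemannian metric on `M`. -/
abbrev AnalyticRiemannianMetric (n : ℕ) (M : Type u) [TopologicalSpace M]
    [ChartedSpace (EuclideanSpace ℝ (Fin n)) M] [IsManifold (𝓡 n) ω M] : Type u :=
  ContMDiffRiemannianMetric (𝓡 n) ω (EuclideanSpace ℝ (Fin n)) (TangentSpace (𝓡 n) : M → Type)

theorem exists_orthonormalBasis (g : AnalyticRiemannianMetric n M) (x : M) :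
    ∃ b : Module.Basis (Fin n) ℝ (TangentSpace (𝓡 n) x),
      ∀ i j, g.inner x (b i) (b j) = if i = j then 1 else 0 := by
  let c : InnerProductSpace.Core ℝ (TangentSpace (𝓡 n) x) :=
    g.toContinuousRiemannianMetric.toRiemannianMetric.toCore x
  let _ : NormedAddCommGroup (TangentSpace (𝓡 n) x) := c.toNormedAddCommGroup
  let _ : InnerProductSpace ℝ (TangentSpace (𝓡 n) x) := InnerProductSpace.ofCore c.toCore
  have : FiniteDimensional ℝ (TangentSpace (𝓡 n) x) :=
    inferInstanceAs (FiniteDimensional ℝ (EuclideanSpace ℝ (Fin n)))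
  have hd : Module.finrank ℝ (TangentSpace (𝓡 n) x) = n := by
    have : Module.finrank ℝ (EuclideanSpace ℝ (Fin n)) = n := by simp
    exact this
  let b := (stdOrthonormalBasis ℝ (TangentSpace (𝓡 n) x)).reindex (finCongr hd)
  refine ⟨b.toBasis, fun i j ↦ ?_⟩
  have h := orthonormal_iff_ite.1 b.orthonormal i j
  simp only [OrthonormalBasis.coe_toBasis]
  exact h

/-- A basis of the tangent space at `x` that is orthonormal for `g`. -/
def orthonormalBasisAt (g : AnalyticRiemannianMetric n M) (x : M) :
    Module.Basis (Fin n) ℝ (TangentSpace (𝓡 n) x) :=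
  (exists_orthonormalBasis g x).choose

variable {F : Type w} [NormedAddCommGroup F] [NormedSpace ℝ F]
  {V : M → Type v} [TopologicalSpace (TotalSpace F V)]
  [∀ x, AddCommGroup (V x)] [∀ x, Module ℝ (V x)] [∀ x, TopologicalSpace (V x)]
  [∀ x, IsTopologicalAddGroup (V x)] [∀ x, ContinuousSMul ℝ (V x)]
  [FiberBundle F V] [VectorBundle ℝ F V]

/-- The squared norm of `A ∈ T^m(T*_x M) ⊗ V_x` for the inner product induced by the inner products
on `T_x M` and `V_x`: the sum of `|A (e_{i_1}, …, e_{i_m})|²` over an orthonormal basis `e`. -/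
def tensorNormSq (gM : AnalyticRiemannianMetric n M) (gV : ContMDiffRiemannianMetric (𝓡 n) ω F V)
    {m : ℕ} {x : M} (A : MultilinearMap ℝ (fun _ : Fin m ↦ TangentSpace (𝓡 n) x) (V x)) : ℝ :=
  ∑ i : Fin m → Fin n, gV.inner x (A fun r ↦ orthonormalBasisAt gM x (i r))
    (A fun r ↦ orthonormalBasisAt gM x (i r))

variable (n F V) in
/-- A real analytic Riemannian metric on `M`, a real analytic fibre metric on the bundle `V`,
a real analytic affine connection on `M` and a real analytic linear connection in `V`. -/
structure GeometricData where
  /-- The Riemannian metric on the base. -/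
  baseMetric : AnalyticRiemannianMetric n M
  /-- The fibre metric. -/
  fibreMetric : ContMDiffRiemannianMetric (𝓡 n) ω F V
  /-- The affine connection on the base. -/
  baseConnection : AffineConnection n M
  /-- The linear connection in the bundle. -/
  fibreConnection : CovariantDerivative (𝓡 n) F V
  analytic_baseConnection : IsAnalyticConnection baseConnection
  analytic_fibreConnection : IsAnalyticConnection fibreConnection

/-- The norm of the `m`-jet of `ξ` at `x`: the square root of
`∑_{j ≤ m} |D^j ξ (x) / j!|²`. -/
def jetNorm (G : GeometricData n F V) (m : ℕ) (ξ : Π x, V x) (x : M) : ℝ :=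
  √(∑ j ∈ Finset.range (m + 1), tensorNormSq G.baseMetric G.fibreMetric
      (((j.factorial : ℝ)⁻¹) • symCovDeriv G.baseConnection G.fibreConnection j ξ x))

end Metrics

/-- Sequences of positive real numbers that converge to zero. -/
abbrev PosNullSeq : Type := {a : ℕ → ℝ // (∀ j, 0 < a j) ∧ Tendsto a atTop (𝓝 0)}

/-- The product `a_0 a_1 ⋯ a_m`. -/
def PosNullSeq.partialProd (a : PosNullSeq) (m : ℕ) : ℝ := ∏ j ∈ Finset.range (m + 1), a.1 j

/-- The topology with the sets `{η | p_i (η - ξ) < ε}` as a subbasis. -/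
def seminormTopology {ι : Type*} {Γ : Type*} [AddCommGroup Γ] (p : ι → Γ → ℝ≥0∞) :
    TopologicalSpace Γ :=
  TopologicalSpace.generateFrom
    {S | ∃ (i : ι) (ξ : Γ) (ε : ℝ), 0 < ε ∧ S = {η | p i (η - ξ) < ENNReal.ofReal ε}}

/-- For a family of finite seminorms the topology is the usual locally convex one. -/
theorem withSeminorms_seminormTopology {ι : Type*} {Γ : Type*} [AddCommGroup Γ]
    [Module ℝ Γ] (P : SeminormFamily ℝ Γ ι) :
    WithSeminorms (topology := seminormTopology fun i ξ ↦ ENNReal.ofReal (P i ξ)) P := by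
  let t : TopologicalSpace Γ := P.moduleFilterBasis.topology
  have hP : WithSeminorms P := ⟨rfl⟩
  have : IsTopologicalAddGroup Γ := hP.topologicalAddGroup
  have key : ∀ (i : ι) (ξ : Γ) (ε : ℝ), 0 < ε →
      {η | ENNReal.ofReal (P i (η - ξ)) < ENNReal.ofReal ε} = (P i).ball ξ ε := by
    intro i ξ ε hε
    ext η
    simp [Seminorm.mem_ball, ENNReal.ofReal_lt_ofReal_iff hε]
  have heq : (seminormTopology fun i ξ ↦ ENNReal.ofReal (P i ξ)) = t := by
    apply le_antisymm
    · intro U hU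
      rw [hP.isOpen_iff_mem_balls] at hU
      refine (@isOpen_iff_mem_nhds _ (seminormTopology _) _).2 fun x hx ↦ ?_
      obtain ⟨s, r, hr, hsub⟩ := hU x hx
      refine Filter.mem_of_superset ?_ hsub
      rw [Seminorm.ball_finset_sup_eq_iInter _ _ _ hr]
      refine (Filter.biInter_finset_mem s).2 fun i _ ↦ ?_
      refine @IsOpen.mem_nhds _ (seminormTopology _) _ _ ?_ ?_
      · exact TopologicalSpace.isOpen_generateFrom_of_mem ⟨i, x, r, hr, (key i x r hr).symm⟩
      · exact (P i).mem_ball_self hr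
    · refine le_generateFrom ?_
      rintro S ⟨i, ξ, ε, hε, rfl⟩
      rw [key i ξ ε hε]
      have hc : Continuous fun η ↦ P i (η - ξ) :=
        (hP.continuous_seminorm i).comp (continuous_id.sub continuous_const)
      exact isOpen_lt hc continuous_const
  exact @WithSeminorms.mk _ _ _ _ _ _ _ (seminormTopology _) heq

section Seminorms

variable {n k : ℕ} {M : Type u} [TopologicalSpace M] [ChartedSpace (EuclideanSpace ℝ (Fin n)) M]
  [IsManifold (𝓡 n) ω M]
  {V : M → Type v} [TopologicalSpace (TotalSpace (EuclideanSpace ℝ (Fin k)) V)]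
  [∀ x, AddCommGroup (V x)] [∀ x, Module ℝ (V x)] [∀ x, TopologicalSpace (V x)]
  [∀ x, IsTopologicalAddGroup (V x)] [∀ x, ContinuousSMul ℝ (V x)]
  [FiberBundle (EuclideanSpace ℝ (Fin k)) V] [VectorBundle ℝ (EuclideanSpace ℝ (Fin k)) V]

variable (n k V) in
/-- The vector space of real analytic sections. -/
abbrev AnalyticSection : Type (max u v) :=
  ContMDiffSection (𝓡 n) (EuclideanSpace ℝ (Fin k)) ω V

/-- `p_{K,a}(ξ) = sup {a_0 ⋯ a_m ‖j_m ξ (x)‖ | x ∈ K, m ∈ ℕ}`. -/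
def intrinsicSeminorm (G : GeometricData n (EuclideanSpace ℝ (Fin k)) V) (K : Set M)
    (a : PosNullSeq) (ξ : AnalyticSection n k V) : ℝ≥0∞ :=
  ⨆ x ∈ K, ⨆ m : ℕ, ENNReal.ofReal (a.partialProd m * jetNorm G m ξ x)

/-- The `C^ω`-topology defined by metrics and connections. -/
def intrinsicTopology (G : GeometricData n (EuclideanSpace ℝ (Fin k)) V) :
    TopologicalSpace (AnalyticSection n k V) :=
  seminormTopology fun i : {K : Set M // IsCompact K} × PosNullSeq ↦
    intrinsicSeminorm G i.1.1 i.2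

/-- The partial derivative `∂f/∂x_i`. -/
def partialDeriv (i : Fin n) (f : EuclideanSpace ℝ (Fin n) → ℝ) (x : EuclideanSpace ℝ (Fin n)) :
    ℝ :=
  fderiv ℝ f x (EuclideanSpace.single i 1)

/-- `D^I f = ∂_1^{i_1} ⋯ ∂_n^{i_n} f` for a multi-index `I`. -/
def multiDeriv (I : Fin n → ℕ) (f : EuclideanSpace ℝ (Fin n) → ℝ) :
    EuclideanSpace ℝ (Fin n) → ℝ :=
  (List.finRange n).foldr (fun i g ↦ (partialDeriv i)^[I i] g) f

/-- `p'_{K,a}(Φ) = sup {a_0 ⋯ a_m / I! |D^I Φ^c (x)|}`, the supremum over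
`x ∈ K`, `c ∈ {1, …, k}`, `m ∈ ℕ` and multi-indices `I` with `|I| ≤ m`. -/
def localSeminorm (K : Set (EuclideanSpace ℝ (Fin n))) (a : PosNullSeq)
    (Φ : EuclideanSpace ℝ (Fin n) → EuclideanSpace ℝ (Fin k)) : ℝ≥0∞ :=
  ⨆ x ∈ K, ⨆ (c : Fin k) (m : ℕ) (I : Fin n → ℕ) (_ : ∑ i, I i ≤ m),
    ENNReal.ofReal (a.partialProd m / (∏ i, ((I i).factorial : ℝ)) *
      |multiDeriv I (fun y ↦ Φ y c) x|)

variable (n k V) in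
/-- A real analytic vector bundle chart: a real analytic chart `φ` of the base, together with a
fibrewise linear and real analytic trivialisation of the bundle over the domain of `φ`. -/
structure VectorBundleChart where
  /-- The induced chart of the base. -/
  baseChart : OpenPartialHomeomorph M (EuclideanSpace ℝ (Fin n))
  baseChart_mem : baseChart ∈ IsManifold.maximalAtlas (𝓡 n) ω M
  /-- The trivialisation over the domain of the chart. -/
  triv : Trivialization (EuclideanSpace ℝ (Fin k))
    (Bundle.TotalSpace.proj : TotalSpace (EuclideanSpace ℝ (Fin k)) V → M)
  baseSet_eq : triv.baseSet = baseChart.source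
  isLinear : triv.IsLinear ℝ
  analyticOn : ContMDiffOn ((𝓡 n).prod 𝓘(ℝ, EuclideanSpace ℝ (Fin k)))
    ((𝓡 n).prod 𝓘(ℝ, EuclideanSpace ℝ (Fin k))) ω triv triv.source
  analyticOn_symm : ContMDiffOn ((𝓡 n).prod 𝓘(ℝ, EuclideanSpace ℝ (Fin k)))
    ((𝓡 n).prod 𝓘(ℝ, EuclideanSpace ℝ (Fin k))) ω triv.toOpenPartialHomeomorph.symm triv.target

/-- The local representative of a section: `ψ (ξ (φ⁻¹ x)) = (x, ψ_* ξ (x))` for `x` in the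
target of `φ`. -/
def VectorBundleChart.pushforward (ψ : VectorBundleChart n k V) (ξ : AnalyticSection n k V)
    (x : EuclideanSpace ℝ (Fin n)) : EuclideanSpace ℝ (Fin k) :=
  (ψ.triv ⟨ψ.baseChart.symm x, ξ (ψ.baseChart.symm x)⟩).2

variable (n k V) in
/-- A vector bundle chart with a compact subset of the image of the induced chart of the base. -/
abbrev ChartWithCompact : Type (max u v) :=
  Σ ψ : VectorBundleChart n k V,
    {K : Set (EuclideanSpace ℝ (Fin n)) // IsCompact K ∧ K ⊆ ψ.baseChart.target}

variable (n k V) in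
/-- The topology defined by the local seminorms in all vector bundle charts. -/
def localTopology : TopologicalSpace (AnalyticSection n k V) :=
  seminormTopology fun i : ChartWithCompact n k V × PosNullSeq ↦
    fun ξ ↦ localSeminorm i.1.2.1 i.2 (i.1.1.pushforward ξ)

end Seminorms

end

end JetTopology

/-! In a chart and a frame, a section becomes a function `f`. The theorem reduces to two estimates
on a compact set, uniform in the section: partial derivatives of order `m` and the tensors `D^j ξ`,
`j ≤ m`, control each other up to factors `C σ^m m!`. Geometric factors are harmless, because `σ a`
is again a null sequence and its products are `σ^(m+1) a_0 ⋯ a_m`.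

A symmetric tensor is controlled by its diagonal at the cost of `(2e)^m` (polarization). On the
diagonal, `D^m ξ (v, …, v)` is the `m`-th derivative at time 0 of `ξ` along the geodesic with
velocity `v`, carried back by parallel transport. In coordinates this is `(sprayOp Γ A)^[m] f` at
`(y, v)` (`coord_iterCovDeriv_diagonal`). With the inverse transport added to point and velocity as
a third variable, `sprayOp` becomes the derivative along a single analytic vector field,
`sprayField`.

Spray derivatives are bounded by partial derivatives (`exists_norm_iterate_sprayOp_le`) through
Cauchy estimates for the weighted jet norm `jetSum`: half of the radius is distributed over `m`
differentiations, and `m^m ≤ e^m m!`. For the converse (`exists_norm_iteratedFDeriv_le_of_sprayOp`),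
let `e` be the exponential map at `y` and `P` the inverse radial transport, both truncated and with
velocity scaled by `ρ`. The Taylor coefficients of `P (f ∘ e)` at 0 are spray derivatives of `f`.
For small `ρ`, `P` is close to the identity and the derivative of `e` is close to `ρ` times the
identity, so both can be removed by absorbing an error term of relative size `1/2`. Because of the
truncation only finite jets of geodesics enter, and no analytic dependence of the flow on its
initial data is needed.

On a compact set the metrics are comparable with the Euclidean norms, and passing between
multi-indices and Fréchet derivatives costs powers of `n`. A compact subset of the manifold is
covered by finitely many chart pieces. The seminorms are finite since analytic functions satisfy
Cauchy bounds and `a_0 ⋯ a_m σ^m` is bounded. The local family involves no metric or connection,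
which gives the independence. -/

namespace JetTopology

/-! ### Weighted sums of norms of derivatives -/

section JetSum

universe u₁ u₂ u₃ u₄

variable {E : Type u₁} {F : Type u₂} {G : Type u₃} {H : Type u₄}
  [NormedAddCommGroup E] [NormedSpace ℝ E] [NormedAddCommGroup F] [NormedSpace ℝ F]
  [NormedAddCommGroup G] [NormedSpace ℝ G] [NormedAddCommGroup H] [NormedSpace ℝ H]

/-- The norm of the `m`-jet of `f` at `p` with weight `r ^ j / j!` on the derivative of order
`j`. -/
noncomputable def jetSum (r : ℝ) (m : ℕ) (f : E → F) (p : E) : ℝ :=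
  ∑ j ∈ Finset.range (m + 1), ‖iteratedFDeriv ℝ j f p‖ * (r ^ j / j.factorial)

theorem jetSum_nonneg {r : ℝ} (hr : 0 ≤ r) (m : ℕ) (f : E → F) (p : E) : 0 ≤ jetSum r m f p :=
  Finset.sum_nonneg fun _ _ ↦ by positivity

theorem jetSum_mono {r r' : ℝ} (hr : 0 ≤ r) (h : r ≤ r') {m m' : ℕ} (hm : m ≤ m') (f : E → F)
    (p : E) : jetSum r m f p ≤ jetSum r' m' f p := by
  refine (Finset.sum_le_sum fun j _ ↦ ?_).trans
    (Finset.sum_le_sum_of_subset_of_nonneg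
      (Finset.range_mono (Nat.succ_le_succ hm) : Finset.range (m + 1) ⊆ Finset.range (m' + 1))
      fun j _ _ ↦ mul_nonneg (norm_nonneg _)
        (div_nonneg (pow_nonneg (hr.trans h) _) (by positivity)))
  gcongr

theorem norm_le_jetSum {r : ℝ} (hr : 0 ≤ r) (m : ℕ) (f : E → F) (p : E) :
    ‖f p‖ ≤ jetSum r m f p := by
  have : ‖f p‖ = jetSum r 0 f p := by simp [jetSum]
  rw [this]
  exact jetSum_mono hr le_rfl (Nat.zero_le m) f p

theorem norm_iteratedFDeriv_le_jetSum {r : ℝ} (hr : 0 < r) {j m : ℕ} (hj : j ≤ m) (f : E → F)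
    (p : E) : ‖iteratedFDeriv ℝ j f p‖ ≤ j.factorial / r ^ j * jetSum r m f p := by
  have h : ‖iteratedFDeriv ℝ j f p‖ * (r ^ j / j.factorial) ≤ jetSum r m f p :=
    Finset.single_le_sum (f := fun j ↦ ‖iteratedFDeriv ℝ j f p‖ * (r ^ j / j.factorial))
      (fun _ _ ↦ by positivity) (Finset.mem_range.2 (Nat.lt_succ_of_le hj))
  calc ‖iteratedFDeriv ℝ j f p‖
      = j.factorial / r ^ j * (‖iteratedFDeriv ℝ j f p‖ * (r ^ j / j.factorial)) := by
        field_simp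
    _ ≤ _ := by gcongr

theorem jetSum_congr {r : ℝ} {m : ℕ} {f g : E → F} {p : E} (h : f =ᶠ[𝓝 p] g) :
    jetSum r m f p = jetSum r m g p := by
  unfold jetSum
  refine Finset.sum_congr rfl fun j _ ↦ ?_
  rw [(h.iteratedFDeriv ℝ j).eq_of_nhds]

theorem jetSum_add_le {r : ℝ} (hr : 0 ≤ r) (m : ℕ) {f g : E → F} {p : E}
    (hf : ContDiffAt ℝ ω f p) (hg : ContDiffAt ℝ ω g p) :
    jetSum r m (fun x ↦ f x + g x) p ≤ jetSum r m f p + jetSum r m g p := by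
  unfold jetSum
  rw [← Finset.sum_add_distrib]
  refine Finset.sum_le_sum fun j _ ↦ ?_
  rw [← add_mul]
  gcongr
  have : iteratedFDeriv ℝ j (fun x ↦ f x + g x) p
      = iteratedFDeriv ℝ j f p + iteratedFDeriv ℝ j g p :=
    iteratedFDeriv_add_apply (hf.of_le le_top) (hg.of_le le_top)
  rw [this]
  exact norm_add_le _ _

theorem jetSum_const_smul {r : ℝ} (m : ℕ) (c : ℝ) {f : E → F} {p : E}
    (hf : ContDiffAt ℝ ω f p) :
    jetSum r m (fun x ↦ c • f x) p = |c| * jetSum r m f p := by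
  unfold jetSum
  rw [Finset.mul_sum]
  refine Finset.sum_congr rfl fun j _ ↦ ?_
  have : iteratedFDeriv ℝ j (fun x ↦ c • f x) p = c • iteratedFDeriv ℝ j f p :=
    iteratedFDeriv_const_smul_apply (hf.of_le le_top)
  rw [this, norm_smul, Real.norm_eq_abs, mul_assoc]

theorem jetSum_zero_fun (r : ℝ) (m : ℕ) (p : E) : jetSum r m (fun _ : E ↦ (0 : F)) p = 0 := by
  unfold jetSum
  refine Finset.sum_eq_zero fun j _ ↦ ?_
  rw [iteratedFDeriv_fun_zero]
  simp

theorem jetSum_sum_le {ι : Type*} {r : ℝ} (hr : 0 ≤ r) (m : ℕ) (s : Finset ι) {f : ι → E → F}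
    {p : E} (hf : ∀ i ∈ s, ContDiffAt ℝ ω (f i) p) :
    jetSum r m (fun x ↦ ∑ i ∈ s, f i x) p ≤ ∑ i ∈ s, jetSum r m (f i) p := by
  classical
  induction s using Finset.induction_on with
  | empty => simp [jetSum_zero_fun]
  | insert a s ha ih =>
    simp only [Finset.sum_insert ha]
    have h1 := hf a (Finset.mem_insert_self a s)
    have h2 : ∀ i ∈ s, ContDiffAt ℝ ω (f i) p := fun i hi ↦ hf i (Finset.mem_insert_of_mem hi)
    exact (jetSum_add_le hr m h1 (ContDiffAt.sum h2)).trans (by gcongr; exact ih h2)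

theorem jetSum_clm_comp_le {r : ℝ} (hr : 0 ≤ r) (m : ℕ) (A : F →L[ℝ] G) {f : E → F} {p : E}
    (hf : ContDiffAt ℝ ω f p) :
    jetSum r m (fun x ↦ A (f x)) p ≤ ‖A‖ * jetSum r m f p := by
  unfold jetSum
  rw [Finset.mul_sum]
  refine Finset.sum_le_sum fun j _ ↦ ?_
  rw [← mul_assoc]
  gcongr
  exact A.norm_iteratedFDeriv_comp_left hf le_top

theorem exists_isOpen_contDiffOn {f : E → F} {p : E} (hf : ContDiffAt ℝ ω f p) :
    ∃ u, IsOpen u ∧ p ∈ u ∧ ContDiffOn ℝ ω f u := by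
  obtain ⟨u, hu, hp, h⟩ := (contDiffWithinAt_univ.2 hf).contDiffOn' le_rfl (by simp)
  exact ⟨u, hu, hp, by simpa using h⟩

theorem eventually_contDiffAt {f : E → F} {p : E} (hf : ContDiffAt ℝ ω f p) :
    ∀ᶠ x in 𝓝 p, ContDiffAt ℝ ω f x := by
  obtain ⟨u, hu, hp, h⟩ := exists_isOpen_contDiffOn hf
  filter_upwards [hu.mem_nhds hp] with x hx using h.contDiffAt (hu.mem_nhds hx)

theorem norm_iteratedFDeriv_bilinear_le (A : F →L[ℝ] G →L[ℝ] H) {f : E → F} {g : E → G} {p : E}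
    (hf : ContDiffAt ℝ ω f p) (hg : ContDiffAt ℝ ω g p) (j : ℕ) :
    ‖iteratedFDeriv ℝ j (fun x ↦ A (f x) (g x)) p‖ ≤ ‖A‖ * ∑ i ∈ Finset.range (j + 1),
      (j.choose i : ℝ) * ‖iteratedFDeriv ℝ i f p‖ * ‖iteratedFDeriv ℝ (j - i) g p‖ := by
  obtain ⟨u, hu, hpu, hfu⟩ := exists_isOpen_contDiffOn hf
  obtain ⟨v, hv, hpv, hgv⟩ := exists_isOpen_contDiffOn hg
  have ho := hu.inter hv
  have hp : p ∈ u ∩ v := ⟨hpu, hpv⟩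
  have := A.norm_iteratedFDerivWithin_le_of_bilinear (hfu.mono inter_subset_left)
    (hgv.mono inter_subset_right) ho.uniqueDiffOn hp (n := j) le_top
  simpa only [iteratedFDerivWithin_of_isOpen _ ho hp] using this

/-- The weights `r ^ j / j!` absorb the binomial coefficients of the Leibniz rule and turn it into a
Cauchy product. The part of total order at most `m` is contained in the product of the two truncated
sums, and all terms are nonnegative. -/
theorem jetSum_bilinear_le {r : ℝ} (hr : 0 ≤ r) (m : ℕ) (A : F →L[ℝ] G →L[ℝ] H) {f : E → F}
    {g : E → G} {p : E} (hf : ContDiffAt ℝ ω f p) (hg : ContDiffAt ℝ ω g p) :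
    jetSum r m (fun x ↦ A (f x) (g x)) p ≤ ‖A‖ * (jetSum r m f p * jetSum r m g p) := by
  set a : ℕ → ℝ := fun i ↦ ‖iteratedFDeriv ℝ i f p‖ * (r ^ i / i.factorial) with ha
  set b : ℕ → ℝ := fun i ↦ ‖iteratedFDeriv ℝ i g p‖ * (r ^ i / i.factorial) with hb
  have ha0 : ∀ i, 0 ≤ a i := fun i ↦ by positivity
  have hb0 : ∀ i, 0 ≤ b i := fun i ↦ by positivity
  have h1 : jetSum r m (fun x ↦ A (f x) (g x)) p ≤
      ‖A‖ * ∑ j ∈ Finset.range (m + 1), ∑ i ∈ Finset.range (j + 1), a i * b (j - i) := by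
    unfold jetSum
    rw [Finset.mul_sum]
    refine Finset.sum_le_sum fun j _ ↦ ?_
    calc _ ≤ (‖A‖ * ∑ i ∈ Finset.range (j + 1), (j.choose i : ℝ) * ‖iteratedFDeriv ℝ i f p‖ *
            ‖iteratedFDeriv ℝ (j - i) g p‖) * (r ^ j / j.factorial) := by
          gcongr
          exact norm_iteratedFDeriv_bilinear_le A hf hg j
      _ = _ := by
          rw [mul_assoc, Finset.sum_mul]
          congr 1
          refine Finset.sum_congr rfl fun i hi ↦ ?_
          have hij : i ≤ j := Nat.lt_succ_iff.1 (Finset.mem_range.1 hi)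
          have h2 : r ^ j = r ^ i * r ^ (j - i) := by rw [← pow_add, Nat.add_sub_cancel' hij]
          have h3 : (j.choose i : ℝ) * (i.factorial * (j - i).factorial) = j.factorial := by
            rw [← mul_assoc]
            exact_mod_cast Nat.choose_mul_factorial_mul_factorial hij
          simp only [ha, hb]
          rw [h2, ← h3]
          have : (j.choose i : ℝ) ≠ 0 := by exact_mod_cast (Nat.choose_pos hij).ne'
          field_simp
  refine h1.trans ?_
  gcongr
  calc ∑ j ∈ Finset.range (m + 1), ∑ i ∈ Finset.range (j + 1), a i * b (j - i)
      = ∑ x ∈ (Finset.range (m + 1)).sigma fun j ↦ Finset.range (j + 1),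
          a x.2 * b (x.1 - x.2) := by
        rw [Finset.sum_sigma]
    _ = ∑ y ∈ ((Finset.range (m + 1)).sigma fun j ↦ Finset.range (j + 1)).image
          (fun x ↦ (x.2, x.1 - x.2)), a y.1 * b y.2 := by
        rw [Finset.sum_image]
        rintro ⟨j, i⟩ h ⟨j', i'⟩ h' heq
        simp only [Finset.coe_sigma, Set.mem_sigma_iff, Finset.coe_range, Set.mem_Iio] at h h'
        simp only [Prod.mk.injEq] at heq
        obtain rfl := heq.1
        have : j = j' := by omega
        subst this
        rfl
    _ ≤ ∑ y ∈ Finset.range (m + 1) ×ˢ Finset.range (m + 1), a y.1 * b y.2 := by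
        refine Finset.sum_le_sum_of_subset_of_nonneg ?_ fun y _ _ ↦ mul_nonneg (ha0 _) (hb0 _)
        intro y hy
        simp only [Finset.mem_image, Finset.mem_sigma, Finset.mem_range] at hy
        obtain ⟨x, hx, rfl⟩ := hy
        simp only [Finset.mem_product, Finset.mem_range]
        omega
    _ = _ := by
        rw [Finset.sum_product, jetSum, jetSum, Finset.sum_mul_sum]

/-- A Cauchy estimate: one derivative costs an amount `δ` of radius and a factor `1 / δ`. It rests
on `(j + 1) r^j δ ≤ (r + δ)^(j + 1)`, the left side being a single term of the binomial expansion.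
-/
theorem jetSum_fderiv_le {r δ : ℝ} (hr : 0 ≤ r) (hδ : 0 ≤ δ) (m : ℕ) (f : E → F) (p : E) :
    jetSum r m (fderiv ℝ f) p * δ ≤ jetSum (r + δ) (m + 1) f p := by
  have h : ∀ j : ℕ, ((j : ℝ) + 1) * r ^ j * δ ≤ (r + δ) ^ (j + 1) := by
    intro j
    induction j with
    | zero => simpa using hr
    | succ j ih =>
      calc ((j + 1 : ℕ) + 1 : ℝ) * r ^ (j + 1) * δ
          = ((j : ℝ) + 1) * r ^ j * δ * r + r ^ (j + 1) * δ := by push_cast; ring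
        _ ≤ (r + δ) ^ (j + 1) * r + (r + δ) ^ (j + 1) * δ := by
            gcongr
            linarith
        _ = _ := by ring
  unfold jetSum
  rw [Finset.sum_mul, Finset.sum_range_succ' _ (m + 1)]
  refine le_add_of_le_of_nonneg (Finset.sum_le_sum fun j _ ↦ ?_) (by positivity)
  rw [norm_iteratedFDeriv_fderiv, mul_assoc]
  gcongr
  rw [Nat.factorial_succ, div_mul_eq_mul_div, div_le_div_iff₀ (by positivity) (by positivity)]
  push_cast
  calc r ^ j * δ * ((j + 1) * j.factorial) = (((j : ℝ) + 1) * r ^ j * δ) * j.factorial := by ring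
    _ ≤ _ := by gcongr; exact h j

theorem jetSum_le_of_forall {r B σ : ℝ} (hr : 0 ≤ r) (hσ : 0 ≤ σ) (hr' : r * σ ≤ 1 / 2) {m : ℕ}
    {f : E → F} {p : E} (h : ∀ j ≤ m, ‖iteratedFDeriv ℝ j f p‖ ≤ B * σ ^ j * j.factorial) :
    jetSum r m f p ≤ 2 * B := by
  have hB : 0 ≤ B := by simpa using (norm_nonneg _).trans (h 0 (Nat.zero_le m))
  calc jetSum r m f p ≤ ∑ j ∈ Finset.range (m + 1), B * (1 / 2) ^ j := by
        refine Finset.sum_le_sum fun j hj ↦ ?_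
        calc ‖iteratedFDeriv ℝ j f p‖ * (r ^ j / j.factorial)
            ≤ B * σ ^ j * j.factorial * (r ^ j / j.factorial) := by
              gcongr
              exact h j (Nat.lt_succ_iff.1 (Finset.mem_range.1 hj))
          _ = B * (r * σ) ^ j := by rw [mul_pow]; field_simp
          _ ≤ _ := by gcongr
    _ = B * ∑ j ∈ Finset.range (m + 1), (1 / 2 : ℝ) ^ j := by rw [Finset.mul_sum]
    _ ≤ B * 2 := by gcongr; exact sum_geometric_two_le _
    _ = _ := mul_comm _ _

theorem norm_iteratedFDeriv_comp_clm_le (A : E →L[ℝ] G) (hA : ‖A‖ ≤ 1) {f : G → F} {a : G} {p : E}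
    (hf : ContDiffAt ℝ ω f (a + A p)) (j : ℕ) :
    ‖iteratedFDeriv ℝ j (fun x ↦ f (a + A x)) p‖ ≤ ‖iteratedFDeriv ℝ j f (a + A p)‖ := by
  obtain ⟨u, hu, hpu, hfu⟩ := exists_isOpen_contDiffOn hf
  have hu' : IsOpen ((fun z ↦ a + z) ⁻¹' u) := hu.preimage (by fun_prop)
  have hpu' : A p ∈ (fun z ↦ a + z) ⁻¹' u := hpu
  have hf' : ContDiffOn ℝ ω (fun z ↦ f (a + z)) ((fun z ↦ a + z) ⁻¹' u) :=
    hfu.comp (by fun_prop) fun _ h ↦ h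
  have hu'' : IsOpen (A ⁻¹' ((fun z ↦ a + z) ⁻¹' u)) := hu'.preimage A.continuous
  have := A.iteratedFDerivWithin_comp_right hf' hu'.uniqueDiffOn hu''.uniqueDiffOn hpu' (i := j)
    le_top
  rw [iteratedFDerivWithin_of_isOpen _ hu'' hpu', iteratedFDerivWithin_of_isOpen _ hu' hpu',
    iteratedFDeriv_comp_add_left] at this
  change ‖iteratedFDeriv ℝ j ((fun z ↦ f (a + z)) ∘ A) p‖ ≤ _
  rw [this]
  refine (ContinuousMultilinearMap.norm_compContinuousLinearMap_le _ _).trans ?_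
  refine mul_le_of_le_one_right (norm_nonneg _) ?_
  simpa using pow_le_one₀ (norm_nonneg A) hA

theorem jetSum_comp_clm_le {r : ℝ} (hr : 0 ≤ r) (m : ℕ) (A : E →L[ℝ] G) (hA : ‖A‖ ≤ 1)
    {f : G → F} {a : G} {p : E} (hf : ContDiffAt ℝ ω f (a + A p)) :
    jetSum r m (fun x ↦ f (a + A x)) p ≤ jetSum r m f (a + A p) := by
  unfold jetSum
  gcongr
  exact norm_iteratedFDeriv_comp_clm_le A hA hf _

theorem jetSum_clm_le {r : ℝ} (hr : 0 ≤ r) (m : ℕ) (A : E →L[ℝ] F) (p : E) :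
    jetSum r m (fun x ↦ A x) p ≤ ‖A p‖ + ‖A‖ * r := by
  -- Raising the order to `m + 1` makes the terms of order 0 and 1 available for every `m`; all
  -- further terms vanish.
  refine (jetSum_mono hr le_rfl (Nat.le_succ m) _ _).trans ?_
  have h : ∀ j, iteratedFDeriv ℝ (j + 2) (fun x ↦ A x) p = 0 := by
    intro j
    rw [← norm_eq_zero, ← norm_iteratedFDeriv_fderiv, ← norm_iteratedFDeriv_fderiv]
    have : fderiv ℝ (fun x ↦ A x) = fun _ ↦ A := by ext1 x; exact A.fderiv
    rw [this]
    simp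
  unfold jetSum
  rw [Finset.sum_range_succ', Finset.sum_range_succ', Finset.sum_eq_zero]
  · have : fderiv ℝ (fun x ↦ A x) = fun _ ↦ A := by ext1 x; exact A.fderiv
    have h1 : ‖iteratedFDeriv ℝ 1 (fun x ↦ A x) p‖ = ‖A‖ := by
      rw [← zero_add 1, ← norm_iteratedFDeriv_fderiv, this]
      simp
    simp [h1]
    linarith
  · intro j _
    rw [h]
    simp

/-- The power series at `p` is recentred at each nearby `x`. Its new coefficients, times `k!`, bound
the derivatives at `x`, and they are bounded uniformly in `x` by one convergent sum. Halving the
radius then leaves a geometric series of ratio `1/2`. -/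
theorem exists_jetSum_le_of_analyticAt [CompleteSpace F] {f : E → F} {p : E}
    (hf : AnalyticAt ℝ f p) :
    ∃ C : ℝ, ∃ r > (0 : ℝ), ∀ᶠ x in 𝓝 p, ∀ m, jetSum r m f x ≤ C := by
  obtain ⟨P, R, hP⟩ := hf
  obtain ⟨r, hr0, hr⟩ : ∃ r : NNReal, 0 < r ∧ ((r + r : NNReal) : ℝ≥0∞) < R := by
    obtain ⟨s, hs0, hs⟩ := ENNReal.lt_iff_exists_nnreal_btwn.1 hP.r_pos
    refine ⟨s / 2, by simpa using hs0, by simpa using hs⟩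
  have hrad : ((r : ℝ≥0∞) + r) < P.radius := by
    refine lt_of_lt_of_le ?_ hP.r_le
    exact_mod_cast hr
  have hsum := P.changeOriginSeries_summable_aux₁ hrad
  -- `T` is the full double expansion with both the displacement `y` and the new variable of size
  -- `r`; convergence needs `2r` below the radius. It dominates `‖P.changeOrigin y k‖ r^k` for all
  -- `k` and all `‖y‖ ≤ r`.
  set T := ∑' s : (k : ℕ) × (l : ℕ) × { s : Finset (Fin (k + l)) // s.card = l },
    ‖P (s.fst + s.snd.fst)‖₊ * r ^ s.snd.fst * r ^ s.fst with hT
  have key : ∀ y : E, ‖y‖₊ ≤ r → ∀ k, ‖P.changeOrigin y k‖₊ * r ^ k ≤ T := by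
    intro y hy k
    have hyr : (‖y‖₊ : ℝ≥0∞) < P.radius :=
      lt_of_le_of_lt (by exact_mod_cast hy) (lt_of_le_of_lt le_self_add hrad)
    have hrr : (r : ℝ≥0∞) < P.radius := lt_of_le_of_lt le_self_add hrad
    calc ‖P.changeOrigin y k‖₊ * r ^ k
        ≤ (∑' s : (l : ℕ) × { s : Finset (Fin (k + l)) // s.card = l },
            ‖P (k + s.fst)‖₊ * ‖y‖₊ ^ s.fst) * r ^ k := by
          gcongr
          exact P.nnnorm_changeOrigin_le k hyr
      _ ≤ (∑' s : (l : ℕ) × { s : Finset (Fin (k + l)) // s.card = l },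
            ‖P (k + s.fst)‖₊ * r ^ s.fst) * r ^ k := by
          gcongr
          · exact P.changeOriginSeries_summable_aux₂ hyr k
          · exact P.changeOriginSeries_summable_aux₂ hrr k
      _ = ∑' s : (l : ℕ) × { s : Finset (Fin (k + l)) // s.card = l },
            ‖P (k + s.fst)‖₊ * r ^ s.fst * r ^ k := by rw [NNReal.tsum_mul_right]
      _ ≤ T := NNReal.tsum_comp_le_tsum_of_inj hsum
            (i := fun s : (l : ℕ) × { s : Finset (Fin (k + l)) // s.card = l } ↦
              (⟨k, s⟩ : (k : ℕ) × (l : ℕ) × { s : Finset (Fin (k + l)) // s.card = l }))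
            (fun a b hab ↦ by simpa using hab)
  refine ⟨2 * T, r / 2, by positivity, ?_⟩
  filter_upwards [Metric.closedBall_mem_nhds p (NNReal.coe_pos.2 hr0)] with x hx m
  obtain ⟨y, rfl⟩ : ∃ y, x = p + y := ⟨x - p, by abel⟩
  have hy : ‖y‖₊ ≤ r := by
    rw [Metric.mem_closedBall, dist_eq_norm, add_sub_cancel_left] at hx
    exact_mod_cast hx
  have hyR : (‖y‖₊ : ℝ≥0∞) < R :=
    lt_of_le_of_lt (by exact_mod_cast hy.trans le_self_add) hr
  have hQ := hP.changeOrigin hyR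
  have hbd : ∀ k, ‖iteratedFDeriv ℝ k f (p + y)‖ ≤ k.factorial * ‖P.changeOrigin y k‖ := by
    intro k
    refine ContinuousMultilinearMap.opNorm_le_bound (by positivity) fun v ↦ ?_
    rw [hQ.iteratedFDeriv_eq_sum_of_completeSpace]
    refine (norm_sum_le_of_le _ fun σ _ ↦ (P.changeOrigin y k).le_opNorm _).trans ?_
    have : ∀ σ : Equiv.Perm (Fin k), ∏ i, ‖v (σ i)‖ = ∏ i, ‖v i‖ :=
      fun σ ↦ Equiv.prod_comp σ fun i ↦ ‖v i‖
    simp only [this, Finset.sum_const, Finset.card_univ, Fintype.card_perm, Fintype.card_fin,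
      nsmul_eq_mul]
    rw [mul_assoc]
  calc jetSum (r / 2) m f (p + y) ≤ ∑ j ∈ Finset.range (m + 1), (T : ℝ) * (1 / 2) ^ j := by
        refine Finset.sum_le_sum fun j _ ↦ ?_
        have h1 : (‖P.changeOrigin y j‖ * r ^ j : ℝ) ≤ T := by exact_mod_cast key y hy j
        calc ‖iteratedFDeriv ℝ j f (p + y)‖ * ((r / 2 : ℝ) ^ j / j.factorial)
            ≤ j.factorial * ‖P.changeOrigin y j‖ * ((r / 2 : ℝ) ^ j / j.factorial) := by
              gcongr
              exact hbd j
          _ = (‖P.changeOrigin y j‖ * r ^ j) * (1 / 2) ^ j := by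
              rw [div_pow, one_div_pow]
              field_simp
          _ ≤ _ := by gcongr
    _ = T * ∑ j ∈ Finset.range (m + 1), (1 / 2 : ℝ) ^ j := by rw [Finset.mul_sum]
    _ ≤ T * 2 := by gcongr; exact sum_geometric_two_le _
    _ = _ := mul_comm _ _

theorem exists_jetSum_le_of_isCompact [CompleteSpace F] {f : E → F} {K : Set E} (hK : IsCompact K)
    (hf : ∀ x ∈ K, AnalyticAt ℝ f x) :
    ∃ C : ℝ, ∃ r > (0 : ℝ), ∀ x ∈ K, ∀ m, jetSum r m f x ≤ C := by
  refine hK.induction_on (p := fun s ↦ ∃ C : ℝ, ∃ r > (0 : ℝ), ∀ x ∈ s, ∀ m, jetSum r m f x ≤ C)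
    ⟨0, 1, one_pos, by simp⟩ ?_ ?_ ?_
  · rintro s t hst ⟨C, r, hr, h⟩
    exact ⟨C, r, hr, fun x hx ↦ h x (hst hx)⟩
  · rintro s t ⟨C, r, hr, h⟩ ⟨C', r', hr', h'⟩
    refine ⟨max C C', min r r', lt_min hr hr', ?_⟩
    rintro x (hx | hx) m
    · exact (jetSum_mono (le_min hr.le hr'.le) (min_le_left _ _) le_rfl _ _).trans
        ((h x hx m).trans (le_max_left _ _))
    · exact (jetSum_mono (le_min hr.le hr'.le) (min_le_right _ _) le_rfl _ _).trans
        ((h' x hx m).trans (le_max_right _ _))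
  · intro x hx
    obtain ⟨C, r, hr, h⟩ := exists_jetSum_le_of_analyticAt (hf x hx)
    exact ⟨{y | ∀ m, jetSum r m f y ≤ C}, mem_nhdsWithin_of_mem_nhds h, C, r, hr, fun y hy ↦ hy⟩

end JetSum

/-! ### Iterated derivatives along a vector field -/

section LieIteration

universe u₁ u₂ u₃

variable {S : Type u₁} {G : Type u₂} {T : Type u₃}
  [NormedAddCommGroup S] [NormedSpace ℝ S] [NormedAddCommGroup G] [NormedSpace ℝ G]
  [NormedAddCommGroup T] [NormedSpace ℝ T]

/-- The derivative of a function along the vector field `Z`. -/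
noncomputable def lieD (Z : S → S) (H : S → G) (s : S) : G := fderiv ℝ H s (Z s)

theorem contDiffAt_lieD {Z : S → S} {H : S → G} {s : S} (hZ : ContDiffAt ℝ ω Z s)
    (hH : ContDiffAt ℝ ω H s) : ContDiffAt ℝ ω (lieD Z H) s :=
  (hH.fderiv_right (m := ω) le_rfl).clm_apply hZ

theorem contDiffAt_iterate_lieD {Z : S → S} {H : S → G} {s : S} (hZ : ContDiffAt ℝ ω Z s)
    (hH : ContDiffAt ℝ ω H s) (j : ℕ) : ContDiffAt ℝ ω ((lieD Z)^[j] H) s := by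
  induction j with
  | zero => exact hH
  | succ j ih =>
    rw [Function.iterate_succ_apply']
    exact contDiffAt_lieD hZ ih

/-- Each derivative along `Z` is one Fréchet derivative followed by a product with `Z`, so it costs
`δ` of radius and a factor `C / δ`. -/
theorem jetSum_iterate_lieD_le {Z : S → S} {s : S} (hZ : ContDiffAt ℝ ω Z s) {C r₀ δ : ℝ}
    (hC : ∀ m, jetSum r₀ m Z s ≤ C) (hδ : 0 < δ) (j : ℕ) :
    ∀ {r : ℝ}, 0 ≤ r → r + j * δ ≤ r₀ → ∀ (m : ℕ) {H : S → G}, ContDiffAt ℝ ω H s →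
      jetSum r m ((lieD Z)^[j] H) s ≤ (C / δ) ^ j * jetSum (r + j * δ) (m + j) H s := by
  induction j with
  | zero => intro r _ _ m H _; simp
  | succ j ih =>
    intro r hr hr₀ m H hH
    push_cast at hr₀ ⊢
    have hjδ : 0 ≤ (j : ℝ) * δ := by positivity
    have hle : r + j * δ ≤ r₀ := by linarith
    have hr₀' : 0 ≤ r₀ := by linarith
    have hC0 : 0 ≤ C := (jetSum_nonneg hr₀' 0 Z s).trans (hC 0)
    -- The innermost derivative is split off and estimated at the largest radius; the induction
    -- hypothesis, general in `H`, treats the other `j`.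
    rw [Function.iterate_succ_apply]
    refine (ih hr hle m (contDiffAt_lieD hZ hH)).trans ?_
    have h1 : jetSum (r + j * δ) (m + j) (lieD Z H) s ≤
        C / δ * jetSum (r + (j + 1) * δ) (m + (j + 1)) H s := by
      have h2 := jetSum_bilinear_le (r := r + j * δ) (by linarith) (m + j)
        (ContinuousLinearMap.id ℝ (S →L[ℝ] G)) (hH.fderiv_right (m := ω) le_rfl) hZ
      have h3 : ‖ContinuousLinearMap.id ℝ (S →L[ℝ] G)‖ ≤ 1 := ContinuousLinearMap.norm_id_le
      have h4 := jetSum_fderiv_le (r := r + j * δ) (by linarith) hδ.le (m + j) H s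
      have h5 : jetSum (r + j * δ) (m + j) Z s ≤ C :=
        (jetSum_mono (by linarith) hle le_rfl _ _).trans (hC _)
      have h6 : jetSum (r + j * δ) (m + j) (fderiv ℝ H) s ≤
          jetSum (r + (j + 1) * δ) (m + (j + 1)) H s / δ := by
        rw [le_div_iff₀ hδ]
        have e : r + (j + 1) * δ = r + j * δ + δ := by ring
        rw [e]
        exact h4
      have h7 := jetSum_nonneg (r := r + j * δ) (by linarith) (m + j) (fderiv ℝ H) s
      have h8 := jetSum_nonneg (r := r + j * δ) (by linarith) (m + j) Z s
      calc jetSum (r + j * δ) (m + j) (lieD Z H) s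
          ≤ 1 * (jetSum (r + j * δ) (m + j) (fderiv ℝ H) s * jetSum (r + j * δ) (m + j) Z s) :=
            h2.trans (by gcongr)
        _ ≤ 1 * (jetSum (r + (j + 1) * δ) (m + (j + 1)) H s / δ * C) := by
            have h9 := h7.trans h6
            gcongr
        _ = _ := by ring
    calc _ ≤ (C / δ) ^ j * (C / δ * jetSum (r + (j + 1) * δ) (m + (j + 1)) H s) := by gcongr
      _ = _ := by ring

/-- One term of the exponential series at `j` is bounded by its sum `e^j`. -/
theorem pow_self_le_exp_mul_factorial (j : ℕ) :
    (j : ℝ) ^ j ≤ Real.exp 1 ^ j * j.factorial := by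
  have := Real.pow_div_factorial_le_exp (j : ℝ) (by positivity) j
  rw [div_le_iff₀ (by positivity)] at this
  rwa [← Real.exp_nat_mul, mul_one]

/-- Half of the radius is shared equally among the `j` derivatives, `δ = r / (2j)`. The resulting
`j^j` is only `e^j j!`, so the growth stays of analytic type. -/
theorem jetSum_iterate_lieD_le_factorial {Z : S → S} {s : S} (hZ : ContDiffAt ℝ ω Z s) {C r : ℝ}
    (hr : 0 < r) (hC : ∀ m, jetSum r m Z s ≤ C) (j m : ℕ) {H : S → G}
    (hH : ContDiffAt ℝ ω H s) :
    jetSum (r / 2) m ((lieD Z)^[j] H) s ≤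
      (2 * C * Real.exp 1 / r) ^ j * j.factorial * jetSum r (m + j) H s := by
  have hC0 : 0 ≤ C := (jetSum_nonneg hr.le 0 Z s).trans (hC 0)
  rcases Nat.eq_zero_or_pos j with rfl | hj
  · simpa using jetSum_mono (by positivity) (by linarith) le_rfl H s
  have hj' : (0 : ℝ) < j := by exact_mod_cast hj
  have h := jetSum_iterate_lieD_le hZ hC (δ := r / (2 * j)) (by positivity) j (r := r / 2)
    (by positivity) (by field_simp; norm_num) m hH
  have h1 : r / 2 + j * (r / (2 * j)) = r := by field_simp; norm_num
  rw [h1] at h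
  refine h.trans ?_
  have h2 := jetSum_nonneg hr.le (m + j) H s
  gcongr
  calc (C / (r / (2 * j))) ^ j = (2 * C / r) ^ j * (j : ℝ) ^ j := by
        rw [← mul_pow]; congr 1; field_simp
    _ ≤ (2 * C / r) ^ j * (Real.exp 1 ^ j * j.factorial) := by
        gcongr; exact pow_self_le_exp_mul_factorial j
    _ = _ := by rw [← mul_assoc, ← mul_pow]; congr 2; ring

/-! ### Jets of curves -/

/-- This avoids the higher chain rule: the derivative of `Φ ∘ γ` is the fixed map `(p, v) ↦ dΦ_p v`
composed with `(γ, γ')`, whose `m`-jet is read off from the `(m + 1)`-jet of `γ`. The induction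
replaces `T` by `T × T`, hence the quantification over the spaces. -/
theorem iteratedDeriv_comp_congr_of_jet_eq (m : ℕ) :
    ∀ {T : Type u₃} [NormedAddCommGroup T] [NormedSpace ℝ T] {G : Type u₂} [NormedAddCommGroup G]
      [NormedSpace ℝ G] {Φ : T → G} {α β : ℝ → T}, ContDiffAt ℝ ∞ α 0 → ContDiffAt ℝ ∞ β 0 →
      ContDiffAt ℝ ∞ Φ (α 0) → (∀ j ≤ m, iteratedDeriv j α 0 = iteratedDeriv j β 0) →
      iteratedDeriv m (Φ ∘ α) 0 = iteratedDeriv m (Φ ∘ β) 0 := by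
  induction m with
  | zero =>
    intro T _ _ G _ _ Φ α β _ _ _ h
    have := h 0 le_rfl
    simp only [iteratedDeriv_zero] at this ⊢
    simp [this]
  | succ m ih =>
    intro T _ _ G _ _ Φ α β hα hβ hΦ h
    have h0 : α 0 = β 0 := by simpa using h 0 (Nat.zero_le _)
    have hd : ∀ γ : ℝ → T, ContDiffAt ℝ ∞ γ 0 → ContDiffAt ℝ ∞ Φ (γ 0) →
        deriv (Φ ∘ γ) =ᶠ[𝓝 0] (fun p : T × T ↦ fderiv ℝ Φ p.1 p.2) ∘ fun t ↦ (γ t, deriv γ t) := by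
      intro γ hγ hΦγ
      have h1 : ∀ᶠ t in 𝓝 (0 : ℝ), DifferentiableAt ℝ γ t :=
        ((hγ.of_le (m := 1) (by norm_cast)).eventually (by simp)).mono
          fun t ht ↦ ht.differentiableAt one_ne_zero
      have h2 : ∀ᶠ p in 𝓝 (γ 0), DifferentiableAt ℝ Φ p :=
        ((hΦγ.of_le (m := 1) (by norm_cast)).eventually (by simp)).mono
          fun t ht ↦ ht.differentiableAt one_ne_zero
      filter_upwards [h1, hγ.continuousAt.eventually h2] with t ht ht'
      exact fderiv_comp_deriv t ht' ht
    have hsm : ∀ γ : ℝ → T, ContDiffAt ℝ ∞ γ 0 →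
        ContDiffAt ℝ ∞ (fun t ↦ (γ t, deriv γ t)) 0 := by
      intro γ hγ
      refine hγ.prodMk ?_
      have : ContDiffAt ℝ ∞ (fun t ↦ fderiv ℝ γ t 1) 0 :=
        (hγ.fderiv_right (m := ∞) (by norm_cast)).clm_apply contDiffAt_const
      simpa using this
    rw [iteratedDeriv_succ', iteratedDeriv_succ', iteratedDeriv_eq_iteratedFDeriv,
      iteratedDeriv_eq_iteratedFDeriv, ((hd α hα hΦ).iteratedFDeriv ℝ m).eq_of_nhds,
      ((hd β hβ (h0 ▸ hΦ)).iteratedFDeriv ℝ m).eq_of_nhds, ← iteratedDeriv_eq_iteratedFDeriv,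
      ← iteratedDeriv_eq_iteratedFDeriv]
    refine ih (hsm α hα) (hsm β hβ) ?_ ?_
    · have h3 : ContDiffAt ℝ ∞ (fun p : T × T ↦ fderiv ℝ Φ p.1) (α 0, deriv α 0) :=
        (hΦ.fderiv_right (m := ∞) (by norm_cast)).comp (α 0, deriv α 0) contDiffAt_fst
      exact h3.clm_apply contDiffAt_snd
    · have hprod : ∀ γ : ℝ → T, ContDiffAt ℝ ∞ γ 0 → ∀ j,
          iteratedDeriv j (fun t ↦ (γ t, deriv γ t)) 0 =
            (iteratedDeriv j γ 0, iteratedDeriv (j + 1) γ 0) := by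
        intro γ hγ j
        have hle : (j : WithTop ℕ∞) ≤ (∞ : WithTop ℕ∞) := by exact_mod_cast le_top
        have h4 : ContDiffAt ℝ ∞ (deriv γ) 0 := (hsm γ hγ).snd
        rw [iteratedDeriv_eq_iteratedFDeriv, iteratedFDeriv_prodMk hγ h4 hle,
          iteratedDeriv_succ', iteratedDeriv_eq_iteratedFDeriv, iteratedDeriv_eq_iteratedFDeriv]
        rfl
      intro j hj
      rw [hprod α hα, hprod β hβ, h j (by omega), h (j + 1) (by omega)]

theorem iteratedDeriv_taylor_polynomial (N : ℕ) (a : ℕ → T) {j : ℕ} (hj : j < N) :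
    iteratedDeriv j (fun t : ℝ ↦ ∑ i ∈ Finset.range N, (t ^ i / i.factorial) • a i) 0 = a j := by
  induction j generalizing N a with
  | zero =>
    rw [iteratedDeriv_zero, Finset.sum_eq_single 0]
    · simp
    · intro i _ hi
      rw [zero_pow hi, zero_div, zero_smul]
    · intro h
      exact absurd (Finset.mem_range.2 hj) h
  | succ j ih =>
    obtain ⟨N, rfl⟩ : ∃ N', N = N' + 1 := ⟨N - 1, by omega⟩
    have h : deriv (fun t : ℝ ↦ ∑ i ∈ Finset.range (N + 1), (t ^ i / i.factorial) • a i) =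
        fun t : ℝ ↦ ∑ i ∈ Finset.range N, (t ^ i / i.factorial) • a (i + 1) := by
      ext1 t
      have : ∀ i ∈ Finset.range (N + 1), HasDerivAt (fun t : ℝ ↦ (t ^ i / i.factorial) • a i)
          (((i : ℝ) * t ^ (i - 1) / i.factorial) • a i) t := fun i _ ↦
        ((hasDerivAt_pow i t).div_const _).smul_const _
      rw [(HasDerivAt.fun_sum this).deriv, Finset.sum_range_succ']
      simp only [CharP.cast_eq_zero, zero_mul, zero_div, zero_smul, add_zero]
      refine Finset.sum_congr rfl fun i _ ↦ ?_
      congr 1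
      rw [Nat.factorial_succ, Nat.add_sub_cancel]
      push_cast
      have : (i : ℝ) + 1 ≠ 0 := by positivity
      field_simp
    rw [iteratedDeriv_succ', h]
    exact ih N (fun i ↦ a (i + 1)) (by omega)

/-- The existence theorem gives a differentiable curve, and `α' = Z ∘ α` raises its smoothness one
order at a time. Smoothness is enough, since only finite jets of the curve are used. -/
theorem exists_integralCurve [CompleteSpace S] {Z : S → S} {s : S} (hZ : ContDiffAt ℝ ω Z s) :
    ∃ α : ℝ → S, α 0 = s ∧ ContDiffAt ℝ ∞ α 0 ∧
      ∀ᶠ t in 𝓝 0, HasDerivAt α (Z (α t)) t := by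
  obtain ⟨α, h0, ε, hε, hα⟩ :=
    (hZ.of_le le_top : ContDiffAt ℝ 1 Z s)
      |>.exists_forall_mem_closedBall_exists_eq_forall_mem_Ioo_hasDerivAt₀ 0
  have hev : ∀ᶠ t in 𝓝 (0 : ℝ), HasDerivAt α (Z (α t)) t := by
    filter_upwards [Ioo_mem_nhds (show 0 - ε < 0 by linarith) (show 0 < 0 + ε by linarith)]
      with t ht using hα t ht
  refine ⟨α, h0, ?_, hev⟩
  have hcont : ContinuousAt α 0 := hev.self_of_nhds.continuousAt
  have key : ∀ k : ℕ, ContDiffAt ℝ k α 0 := by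
    intro k
    induction k with
    | zero =>
      rw [CharP.cast_eq_zero, contDiffAt_zero]
      refine ⟨_, hev, fun t ht ↦ ?_⟩
      exact (HasDerivAt.continuousAt ht).continuousWithinAt
    | succ k ih =>
      have h1 : ContDiffAt ℝ k (deriv α) 0 := by
        have h2 : ContDiffAt ℝ k (fun t ↦ Z (α t)) 0 :=
          (ContDiffAt.of_le (h0 ▸ hZ) le_top).comp 0 ih
        exact h2.congr_of_eventuallyEq (hev.mono fun t ht ↦ ht.deriv)
      have h3 := contDiffAt_succ_iff_hasFDerivAt (𝕜 := ℝ) (n := k) (f := α) (x := 0)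
      push_cast
      rw [h3]
      refine ⟨fun t ↦ ContinuousLinearMap.toSpanSingleton ℝ (deriv α t),
        ⟨_, hev, fun t ht ↦ ?_⟩, ?_⟩
      · have h4 : HasDerivAt α (Z (α t)) t := ht
        have h5 := h4.hasFDerivAt
        rw [← h4.deriv] at h5
        exact h5
      · exact (ContinuousLinearMap.toSpanSingletonCLE (𝕜 := ℝ) (E := S)).contDiff.contDiffAt.comp 0 h1
  rw [contDiffAt_infty]
  exact key

theorem eventually_iteratedDeriv_comp_integralCurve {Z : S → S} {s : S} (hZ : ContDiffAt ℝ ω Z s)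
    {α : ℝ → S} (h0 : α 0 = s) (hα : ∀ᶠ t in 𝓝 0, HasDerivAt α (Z (α t)) t) {H : S → G}
    (hH : ContDiffAt ℝ ω H s) (j : ℕ) :
    ∀ᶠ t in 𝓝 0, iteratedDeriv j (fun t ↦ H (α t)) t = (lieD Z)^[j] H (α t) := by
  induction j with
  | zero => simp
  | succ j ih =>
    have hcont : ContinuousAt α 0 := hα.self_of_nhds.continuousAt
    have h1 := contDiffAt_iterate_lieD hZ hH j
    have h2 : ∀ᶠ t in 𝓝 0, ContDiffAt ℝ ω ((lieD Z)^[j] H) (α t) :=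
      hcont.eventually (h0 ▸ eventually_contDiffAt h1)
    filter_upwards [ih.eventually_nhds, hα, h2] with t ht hαt h2t
    rw [iteratedDeriv_succ, Filter.EventuallyEq.deriv_eq ht, Function.iterate_succ_apply', lieD]
    have := (h2t.differentiableAt (by simp)).hasFDerivAt.comp_hasDerivAt t hαt
    exact this.deriv

/-- The jet of a function at a point of an integral curve, in terms of derivatives along the vector
field and of the Taylor polynomial of the curve. -/
theorem iteratedDeriv_comp_lieSeries [CompleteSpace S] {Z : S → S} {s : S}
    (hZ : ContDiffAt ℝ ω Z s) {A : S → T} (hA : ContDiffAt ℝ ω A s) {Φ : T → G}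
    (hΦ : ContDiffAt ℝ ω Φ (A s)) {N j : ℕ} (hj : j < N) :
    iteratedDeriv j (fun t : ℝ ↦ Φ (∑ i ∈ Finset.range N,
      (t ^ i / i.factorial) • (lieD Z)^[i] A s)) 0 = (lieD Z)^[j] (fun s ↦ Φ (A s)) s := by
  obtain ⟨α, h0, hαs, hα⟩ := exists_integralCurve hZ
  subst h0
  have h1 := (eventually_iteratedDeriv_comp_integralCurve hZ rfl hα
    (hΦ.comp _ hA) j).self_of_nhds
  change iteratedDeriv j (fun t ↦ Φ (A (α t))) 0 = _ at h1
  change _ = (lieD Z)^[j] (Φ ∘ A) (α 0)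
  rw [← h1]
  -- The polynomial is the Taylor polynomial of `A ∘ α`, whose derivatives at 0 are the iterated
  -- derivatives of `A` along `Z`. Equal jets remain equal after composition with `Φ`.
  refine iteratedDeriv_comp_congr_of_jet_eq (Φ := Φ) j ?_ ?_ ?_ ?_
  · refine ContDiff.contDiffAt (ContDiff.sum fun i _ ↦ ?_)
    exact ((contDiff_id.pow i).div_const _).smul contDiff_const
  · exact (hA.of_le le_top).comp 0 hαs
  · convert hΦ.of_le le_top using 1
    have := iteratedDeriv_taylor_polynomial N (fun i ↦ (lieD Z)^[i] A (α 0)) (j := 0) (by omega)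
    simpa using this
  · intro i hi
    rw [iteratedDeriv_taylor_polynomial N (fun i ↦ (lieD Z)^[i] A (α 0)) (by omega),
      (eventually_iteratedDeriv_comp_integralCurve hZ rfl hα hA i).self_of_nhds]

end LieIteration

/-! ### Polarization -/

section Polarization

/-- Inclusion–exclusion in product form: expand `∏ (1 + ε_i)`, where `ε_i` is 0 on the range of `r`
and `-1` off it. A single index missed by `r` makes the product vanish. -/
theorem sum_powerset_neg_one_pow_of_range_subset {m : ℕ} (r : Fin m → Fin m) :
    ∑ s : Finset (Fin m), (if ∀ k, r k ∈ s then (-1 : ℝ) ^ (Finset.univ \ s).card else 0) =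
      if Function.Surjective r then 1 else 0 := by
  classical
  have h := Finset.prod_add (fun _ : Fin m ↦ (1 : ℝ)) (fun i ↦ if i ∈ Set.range r then 0 else -1)
    Finset.univ
  rw [Finset.powerset_univ] at h
  simp only [Finset.prod_const_one, one_mul] at h
  have h1 : ∀ s : Finset (Fin m),
      (if ∀ k, r k ∈ s then (-1 : ℝ) ^ (Finset.univ \ s).card else 0) =
        ∏ i ∈ Finset.univ \ s, if i ∈ Set.range r then (0 : ℝ) else -1 := by
    intro s
    split_ifs with hs
    · rw [Finset.prod_congr rfl (g := fun _ ↦ (-1 : ℝ)), Finset.prod_const]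
      intro i hi
      rw [if_neg]
      rintro ⟨k, rfl⟩
      simp only [Finset.mem_sdiff, Finset.mem_univ, true_and] at hi
      exact hi (hs k)
    · push Not at hs
      obtain ⟨k, hk⟩ := hs
      refine (Finset.prod_eq_zero (i := r k) (by simpa using hk) ?_).symm
      rw [if_pos ⟨k, rfl⟩]
  rw [Finset.sum_congr rfl fun s _ ↦ h1 s, ← h]
  split_ifs with hr
  · exact Finset.prod_eq_one fun i _ ↦ by
      rw [if_pos (Set.mem_range.2 (hr i))]; simp
  · rw [Function.Surjective] at hr
    push Not at hr
    obtain ⟨i, hi⟩ := hr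
    refine Finset.prod_eq_zero (i := i) (Finset.mem_univ _) ?_
    rw [if_neg]
    · simp
    · rintro ⟨k, hk⟩
      exact hi k hk

/-- The polarization identity for symmetric multilinear maps. -/
theorem factorial_smul_eq_sum_diagonal {E F : Type*} [AddCommGroup E] [Module ℝ E] [AddCommGroup F]
    [Module ℝ F] {m : ℕ} (A : MultilinearMap ℝ (fun _ : Fin m ↦ E) F)
    (hA : ∀ (σ : Equiv.Perm (Fin m)) (v : Fin m → E), A (v ∘ σ) = A v) (w : Fin m → E) :
    (m.factorial : ℝ) • A w = ∑ s : Finset (Fin m),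
      (-1 : ℝ) ^ (Finset.univ \ s).card • A fun _ ↦ ∑ i ∈ s, w i := by
  classical
  have h1 : ∀ s : Finset (Fin m), (-1 : ℝ) ^ (Finset.univ \ s).card • (A fun _ ↦ ∑ i ∈ s, w i) =
      ∑ r : Fin m → Fin m,
        (if ∀ k, r k ∈ s then (-1 : ℝ) ^ (Finset.univ \ s).card else 0) • A (w ∘ r) := by
    intro s
    rw [A.map_sum_finset (fun _ j ↦ w j) (fun _ ↦ s), Finset.smul_sum]
    refine Finset.sum_subset_zero_on_sdiff (Finset.subset_univ _) ?_ ?_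
    · intro r hr
      simp only [Finset.mem_sdiff, Finset.mem_univ, true_and, Fintype.mem_piFinset] at hr
      rw [if_neg hr, zero_smul]
    · intro r hr
      rw [Fintype.mem_piFinset] at hr
      rw [if_pos hr]
      rfl
  -- After the interchange, the sum over `s` annihilates every `r` that is not surjective. The
  -- surjective self-maps of `Fin m` are the permutations, on which `A` takes the value `A w`.
  rw [Finset.sum_congr rfl fun s _ ↦ h1 s, Finset.sum_comm]
  simp only [← Finset.sum_smul, sum_powerset_neg_one_pow_of_range_subset]
  have h2 : ∑ σ : Equiv.Perm (Fin m), A (w ∘ σ) = (m.factorial : ℝ) • A w := by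
    simp only [hA]
    rw [Finset.sum_const, Finset.card_univ, Fintype.card_perm, Fintype.card_fin, Nat.cast_smul_eq_nsmul]
  rw [← h2]
  refine Finset.sum_of_injOn (fun σ : Equiv.Perm (Fin m) ↦ (σ : Fin m → Fin m))
    (fun σ _ τ _ h ↦ Equiv.coe_fn_injective h) (fun _ _ ↦ Finset.mem_coe.2 (Finset.mem_univ _)) ?_ ?_
  · intro r _ hr
    rw [if_neg, zero_smul]
    intro hs
    exact hr ⟨Equiv.ofBijective r (Finite.injective_iff_surjective.2 hs |>.bijective_of_finite),
      Finset.mem_coe.2 (Finset.mem_univ _), rfl⟩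
  · intro σ _
    rw [if_pos σ.surjective, one_smul]

/-- Polarization has `2^m` terms, each evaluated at a vector of norm at most `m c`. Dividing by `m!`
leaves `2^m (m c)^m / m! ≤ (2 e c)^m`. -/
theorem norm_apply_le_of_diagonal {E F : Type*} [NormedAddCommGroup E] [NormedSpace ℝ E]
    [NormedAddCommGroup F] [NormedSpace ℝ F] {m : ℕ} (A : MultilinearMap ℝ (fun _ : Fin m ↦ E) F)
    (hA : ∀ (σ : Equiv.Perm (Fin m)) (v : Fin m → E), A (v ∘ σ) = A v) {B c : ℝ} (hc : 0 ≤ c)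
    (hB : ∀ v, ‖v‖ ≤ 1 → ‖A fun _ ↦ v‖ ≤ B) {w : Fin m → E} (hw : ∀ i, ‖w i‖ ≤ c) :
    ‖A w‖ ≤ B * (2 * Real.exp 1 * c) ^ m := by
  have hB0 : 0 ≤ B := (norm_nonneg _).trans (hB 0 (by simp))
  have hB' : ∀ v, ‖A fun _ ↦ v‖ ≤ B * ‖v‖ ^ m := by
    intro v
    rcases eq_or_ne v 0 with rfl | hv
    · rcases Nat.eq_zero_or_pos m with rfl | hm
      · simpa using hB 0 (by simp)
      · rw [A.map_coord_zero (⟨0, hm⟩ : Fin m) rfl]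
        simp only [norm_zero]
        positivity
    · have h1 : (fun _ : Fin m ↦ v) = fun _ ↦ ‖v‖ • (‖v‖⁻¹ • v) := by
        ext1 i
        rw [smul_inv_smul₀ (norm_ne_zero_iff.2 hv)]
      rw [h1, A.map_smul_univ (fun _ ↦ ‖v‖), norm_smul]
      have h2 := hB (‖v‖⁻¹ • v) (by rw [norm_smul, norm_inv, norm_norm,
        inv_mul_cancel₀ (norm_ne_zero_iff.2 hv)])
      simp only [Finset.prod_const, Finset.card_univ, Fintype.card_fin, norm_pow, norm_norm]
      rw [mul_comm]
      gcongr
  have h := factorial_smul_eq_sum_diagonal A hA w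
  have h3 : (m.factorial : ℝ) * ‖A w‖ ≤ ∑ s : Finset (Fin m), B * (m * c) ^ m := by
    have : ‖(m.factorial : ℝ) • A w‖ = (m.factorial : ℝ) * ‖A w‖ := by
      rw [norm_smul]; simp
    rw [← this, h]
    refine norm_sum_le_of_le _ fun s _ ↦ ?_
    rw [norm_smul]
    simp only [norm_pow, norm_neg, norm_one, one_pow, one_mul]
    refine (hB' _).trans ?_
    gcongr
    calc ‖∑ i ∈ s, w i‖ ≤ ∑ i ∈ s, c := norm_sum_le_of_le _ fun i _ ↦ hw i
      _ ≤ ∑ i : Fin m, c := Finset.sum_le_sum_of_subset_of_nonneg (Finset.subset_univ _)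
          fun _ _ _ ↦ hc
      _ = m * c := by simp
  have h4 : ∑ s : Finset (Fin m), B * (m * c) ^ m = 2 ^ m * B * c ^ m * (m : ℝ) ^ m := by
    rw [Finset.sum_const, Finset.card_univ, Fintype.card_finset, Fintype.card_fin, nsmul_eq_mul,
      mul_pow]
    push_cast
    ring
  have h5 : (m.factorial : ℝ) * ‖A w‖ ≤ m.factorial * (B * (2 * Real.exp 1 * c) ^ m) := by
    rw [h4] at h3
    refine h3.trans ?_
    calc 2 ^ m * B * c ^ m * (m : ℝ) ^ m
        ≤ 2 ^ m * B * c ^ m * (Real.exp 1 ^ m * m.factorial) := by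
          gcongr
          exact pow_self_le_exp_mul_factorial m
      _ = _ := by rw [mul_pow, mul_pow]; ring
  exact le_of_mul_le_mul_left h5 (by positivity)

theorem opNorm_le_of_diagonal {E F : Type*} [NormedAddCommGroup E] [NormedSpace ℝ E]
    [NormedAddCommGroup F] [NormedSpace ℝ F] {m : ℕ} (A : E [×m]→L[ℝ] F)
    (hA : ∀ (σ : Equiv.Perm (Fin m)) (v : Fin m → E), A (v ∘ σ) = A v) {B : ℝ}
    (hB : ∀ v, ‖v‖ ≤ 1 → ‖A fun _ ↦ v‖ ≤ B) : ‖A‖ ≤ B * (2 * Real.exp 1) ^ m := by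
  have hB0 : 0 ≤ B := (norm_nonneg _).trans (hB 0 (by simp))
  refine A.opNorm_le_bound (by positivity) fun w ↦ ?_
  by_cases hw : ∀ i, w i ≠ 0
  · have h1 : w = fun i ↦ ‖w i‖ • (‖w i‖⁻¹ • w i) := by
      ext1 i
      rw [smul_inv_smul₀ (norm_ne_zero_iff.2 (hw i))]
    have h2 := norm_apply_le_of_diagonal A.toMultilinearMap hA zero_le_one hB
      (w := fun i ↦ ‖w i‖⁻¹ • w i) (fun i ↦ by
        rw [norm_smul, norm_inv, norm_norm, inv_mul_cancel₀ (norm_ne_zero_iff.2 (hw i))])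
    rw [mul_one] at h2
    have h3 : ‖A w‖ = (∏ i, ‖w i‖) * ‖A fun i ↦ ‖w i‖⁻¹ • w i‖ := by
      conv_lhs => rw [h1]
      rw [A.map_smul_univ (fun i ↦ ‖w i‖), norm_smul, Real.norm_eq_abs,
        abs_of_nonneg (Finset.prod_nonneg fun i _ ↦ norm_nonneg _)]
    rw [h3, mul_comm]
    gcongr
    exact h2
  · push Not at hw
    obtain ⟨i, hi⟩ := hw
    rw [A.map_coord_zero i hi, norm_zero]
    positivity

end Polarization

/-! ### The geodesic spray with values in a bundle, in local coordinates -/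

section Spray

universe u

variable {E F : Type u} [NormedAddCommGroup E] [NormedSpace ℝ E] [NormedAddCommGroup F]
  [NormedSpace ℝ F]

/-- In coordinates, the operator that takes a homogeneous polynomial `H` in the velocity with values
in a bundle to the derivative of `H` along the geodesic spray. -/
noncomputable def sprayOp (Γ : E → E →L[ℝ] E →L[ℝ] E) (A : E → E →L[ℝ] F →L[ℝ] F)
    (H : E × E → F) (p : E × E) : F :=
  fderiv ℝ H p (p.2, -(Γ p.1 p.2 p.2)) + A p.1 p.2 (H p)

/-- The vector field of geodesics together with parallel transport. -/
noncomputable def sprayField (Γ : E → E →L[ℝ] E →L[ℝ] E) (A : E → E →L[ℝ] F →L[ℝ] F)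
    (s : E × E × (F →L[ℝ] F)) : E × E × (F →L[ℝ] F) :=
  (s.2.1, -(Γ s.1 s.2.1 s.2.1), s.2.2 ∘L A s.1 s.2.1)

variable {Γ : E → E →L[ℝ] E →L[ℝ] E} {A : E → E →L[ℝ] F →L[ℝ] F}

theorem contDiffAt_sprayOp {H : E × E → F} {p : E × E} (hΓ : ContDiffAt ℝ ω Γ p.1)
    (hA : ContDiffAt ℝ ω A p.1) (hH : ContDiffAt ℝ ω H p) : ContDiffAt ℝ ω (sprayOp Γ A H) p := by
  have h1 : ContDiffAt ℝ ω (fun p : E × E ↦ Γ p.1) p := hΓ.comp p contDiffAt_fst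
  have h2 : ContDiffAt ℝ ω (fun p : E × E ↦ A p.1) p := hA.comp p contDiffAt_fst
  have h3 := hH.fderiv_right (m := ω) le_rfl
  exact (h3.clm_apply (contDiffAt_snd.prodMk
    ((h1.clm_apply contDiffAt_snd).clm_apply contDiffAt_snd).neg)).add
    ((h2.clm_apply contDiffAt_snd).clm_apply hH)

theorem contDiffAt_iterate_sprayOp {H : E × E → F} {p : E × E} (hΓ : ContDiffAt ℝ ω Γ p.1)
    (hA : ContDiffAt ℝ ω A p.1) (hH : ContDiffAt ℝ ω H p) (j : ℕ) :
    ContDiffAt ℝ ω ((sprayOp Γ A)^[j] H) p := by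
  induction j with
  | zero => exact hH
  | succ j ih =>
    rw [Function.iterate_succ_apply']
    exact contDiffAt_sprayOp hΓ hA ih

theorem contDiffAt_sprayField {s : E × E × (F →L[ℝ] F)} (hΓ : ContDiffAt ℝ ω Γ s.1)
    (hA : ContDiffAt ℝ ω A s.1) : ContDiffAt ℝ ω (sprayField Γ A) s := by
  have h1 : ContDiffAt ℝ ω (fun s : E × E × (F →L[ℝ] F) ↦ Γ s.1) s := hΓ.comp s contDiffAt_fst
  have h2 : ContDiffAt ℝ ω (fun s : E × E × (F →L[ℝ] F) ↦ A s.1) s := hA.comp s contDiffAt_fst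
  have h3 : ContDiffAt ℝ ω (fun s : E × E × (F →L[ℝ] F) ↦ s.2.1) s := contDiffAt_snd.fst
  have h4 : ContDiffAt ℝ ω (fun s : E × E × (F →L[ℝ] F) ↦ s.2.2) s := contDiffAt_snd.snd
  exact h3.prodMk (((h1.clm_apply h3).clm_apply h3).neg.prodMk (h4.clm_comp (h2.clm_apply h3)))

/-- The transport component satisfies `P' = P ∘ A(v)`, which supplies exactly the zeroth-order term
of `sprayOp`. An operator with a matrix potential thus becomes a plain derivative along a vector
field, to which the Cauchy estimates apply. -/
theorem lieD_sprayField_apply {H : E × E → F} {s : E × E × (F →L[ℝ] F)}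
    (hH : DifferentiableAt ℝ H (s.1, s.2.1)) :
    lieD (sprayField Γ A) (fun s ↦ s.2.2 (H (s.1, s.2.1))) s =
      s.2.2 (sprayOp Γ A H (s.1, s.2.1)) := by
  have h1 : HasFDerivAt (fun s : E × E × (F →L[ℝ] F) ↦ s.2.2)
      ((ContinuousLinearMap.snd ℝ E (F →L[ℝ] F)) ∘L (ContinuousLinearMap.snd ℝ E _)) s :=
    ((ContinuousLinearMap.snd ℝ E (F →L[ℝ] F)) ∘L (ContinuousLinearMap.snd ℝ E _)).hasFDerivAt
  have h2 : HasFDerivAt (fun s : E × E × (F →L[ℝ] F) ↦ (s.1, s.2.1))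
      ((ContinuousLinearMap.fst ℝ E _).prod
        ((ContinuousLinearMap.fst ℝ E (F →L[ℝ] F)) ∘L (ContinuousLinearMap.snd ℝ E _))) s :=
    ((ContinuousLinearMap.fst ℝ E _).prod
        ((ContinuousLinearMap.fst ℝ E (F →L[ℝ] F)) ∘L
          (ContinuousLinearMap.snd ℝ E _))).hasFDerivAt
  have h3 : HasFDerivAt (fun s : E × E × (F →L[ℝ] F) ↦ s.2.2 (H (s.1, s.2.1))) _ s :=
    h1.clm_apply (hH.hasFDerivAt.comp s h2)
  rw [lieD, h3.fderiv]
  simp [sprayField, sprayOp]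

theorem iterate_lieD_sprayField_apply {Ω : Set E} (hΩ : IsOpen Ω)
    (hΓ : ∀ y ∈ Ω, ContDiffAt ℝ ω Γ y) (hA : ∀ y ∈ Ω, ContDiffAt ℝ ω A y) {H : E × E → F}
    (hH : ∀ p : E × E, p.1 ∈ Ω → ContDiffAt ℝ ω H p) (j : ℕ) {s : E × E × (F →L[ℝ] F)}
    (hs : s.1 ∈ Ω) :
    (lieD (sprayField Γ A))^[j] (fun s ↦ s.2.2 (H (s.1, s.2.1))) s =
      s.2.2 ((sprayOp Γ A)^[j] H (s.1, s.2.1)) := by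
  have hW : IsOpen {s : E × E × (F →L[ℝ] F) | s.1 ∈ Ω} := hΩ.preimage continuous_fst
  have : EqOn ((lieD (sprayField Γ A))^[j] fun s ↦ s.2.2 (H (s.1, s.2.1)))
      (fun s ↦ s.2.2 ((sprayOp Γ A)^[j] H (s.1, s.2.1))) {s | s.1 ∈ Ω} := by
    induction j with
    | zero => intro s _; rfl
    | succ j ih =>
      intro s hs
      have hs' : s.1 ∈ Ω := hs
      rw [Function.iterate_succ_apply', lieD,
        (ih.eventuallyEq_of_mem (hW.mem_nhds hs)).fderiv_eq]
      have := lieD_sprayField_apply (Γ := Γ) (A := A) (H := (sprayOp Γ A)^[j] H) (s := s)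
        ((contDiffAt_iterate_sprayOp (hΓ _ hs') (hA _ hs') (hH _ hs') j).differentiableAt (by simp))
      rw [lieD] at this
      rw [this, Function.iterate_succ_apply']
  exact this hs

/-- A function on the state space of `sprayField` that is homogeneous in the velocity. -/
def VelocityHomogeneous {G : Type*} [NormedAddCommGroup G] [NormedSpace ℝ G] (Ω : Set E) (j : ℕ)
    (H : E × E × (F →L[ℝ] F) → G) : Prop :=
  ∀ s : E × E × (F →L[ℝ] F), s.1 ∈ Ω → ∀ t : ℝ, H (s.1, t • s.2.1, s.2.2) = t ^ j • H s

/-- Scaling the velocity by `t` is a linear map `N` with `Z (N s) = t • N (Z s)`, because the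
acceleration is quadratic in the velocity while the other components are linear in it. Hence each
derivative raises the degree by one. -/
theorem VelocityHomogeneous.lieD {G : Type*} [NormedAddCommGroup G] [NormedSpace ℝ G] {Ω : Set E}
    (hΩ : IsOpen Ω) {j : ℕ} {H : E × E × (F →L[ℝ] F) → G} (h : VelocityHomogeneous Ω j H)
    (hH : ∀ s : E × E × (F →L[ℝ] F), s.1 ∈ Ω → DifferentiableAt ℝ H s) :
    VelocityHomogeneous Ω (j + 1) (lieD (sprayField Γ A) H) := by
  intro s hs t
  have hW : IsOpen {s : E × E × (F →L[ℝ] F) | s.1 ∈ Ω} := hΩ.preimage continuous_fst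
  let N : E × E × (F →L[ℝ] F) →L[ℝ] E × E × (F →L[ℝ] F) :=
    (ContinuousLinearMap.id ℝ E).prodMap
      ((t • ContinuousLinearMap.id ℝ E).prodMap (ContinuousLinearMap.id ℝ (F →L[ℝ] F)))
  have hN : ∀ s, N s = (s.1, t • s.2.1, s.2.2) := fun s ↦ rfl
  have h1 : HasFDerivAt (H ∘ N) ((fderiv ℝ H (N s)) ∘L N) s :=
    (hH (N s) hs).hasFDerivAt.comp s N.hasFDerivAt
  have h2 : HasFDerivAt (H ∘ N) (t ^ j • fderiv ℝ H s) s := by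
    refine ((hH s hs).hasFDerivAt.const_smul (t ^ j)).congr_of_eventuallyEq ?_
    filter_upwards [hW.mem_nhds hs] with s' hs'
    exact h s' hs' t
  have h3 : sprayField Γ A (N s) = t • N (sprayField Γ A s) := by
    simp [hN, sprayField, smul_smul]
  have h4 := congrArg (fun L ↦ L (sprayField Γ A s)) (h1.unique h2)
  simp only [ContinuousLinearMap.comp_apply, smul_apply] at h4
  rw [← hN, JetTopology.lieD, h3, map_smul, h4, smul_smul, pow_succ']
  rfl

theorem VelocityHomogeneous.iterate_lieD {G : Type*} [NormedAddCommGroup G] [NormedSpace ℝ G]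
    {Ω : Set E} (hΩ : IsOpen Ω) (hΓ : ∀ y ∈ Ω, ContDiffAt ℝ ω Γ y)
    (hA : ∀ y ∈ Ω, ContDiffAt ℝ ω A y) {H : E × E × (F →L[ℝ] F) → G}
    (h : VelocityHomogeneous Ω 0 H)
    (hH : ∀ s : E × E × (F →L[ℝ] F), s.1 ∈ Ω → ContDiffAt ℝ ω H s) (j : ℕ) :
    VelocityHomogeneous Ω j ((JetTopology.lieD (sprayField Γ A))^[j] H) := by
  induction j with
  | zero => exact h
  | succ j ih =>
    rw [Function.iterate_succ_apply']
    exact ih.lieD hΩ fun s hs ↦ (contDiffAt_iterate_lieD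
      (contDiffAt_sprayField (hΓ _ hs) (hA _ hs)) (hH s hs) j).differentiableAt (by simp)

/-- The derivatives along the spray are bounded by the partial derivatives of the same and lower
orders. -/
theorem exists_norm_iterate_sprayOp_le [CompleteSpace E] [FiniteDimensional ℝ E] [CompleteSpace F]
    {Ω K : Set E} (hΩ : IsOpen Ω) (hK : IsCompact K) (hKΩ : K ⊆ Ω)
    (hΓ : ∀ y ∈ Ω, ContDiffAt ℝ ω Γ y) (hA : ∀ y ∈ Ω, ContDiffAt ℝ ω A y) :
    ∃ C σ : ℝ, 0 ≤ C ∧ 0 ≤ σ ∧ ∀ y ∈ K, ∀ f : E → F, (∀ y ∈ Ω, ContDiffAt ℝ ω f y) → ∀ (m : ℕ) (B : ℝ),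
      (∀ j ≤ m, ‖iteratedFDeriv ℝ j f y‖ ≤ B * j.factorial) → ∀ v : E, ‖v‖ ≤ 1 →
      ‖(sprayOp Γ A)^[m] (fun p ↦ f p.1) (y, v)‖ ≤ C * σ ^ m * m.factorial * B := by
  set Z := sprayField Γ A with hZdef
  have hZ : ∀ s : E × E × (F →L[ℝ] F), s.1 ∈ Ω → ContDiffAt ℝ ω Z s := fun s hs ↦
    contDiffAt_sprayField (hΓ _ hs) (hA _ hs)
  have hK' : IsCompact (K ×ˢ (Metric.closedBall (0 : E) 1 ×ˢ {ContinuousLinearMap.id ℝ F})) :=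
    hK.prod ((isCompact_closedBall 0 1).prod isCompact_singleton)
  obtain ⟨C₀, r₀, hr₀, hC₀⟩ := exists_jetSum_le_of_isCompact hK' (f := Z)
    fun s hs ↦ (hZ s (hKΩ hs.1)).analyticAt
  -- With `r ≤ 1 / 2`, derivatives of `f` bounded by `B j!` give a geometric series, hence a jet of
  -- size at most `2 B`.
  set r := min r₀ (1 / 2) with hr
  have hr0 : 0 < r := lt_min hr₀ (by norm_num)
  set C₁ := max C₀ 0
  -- The 4 is `2 · 2`: the jet of the transport component is at most `1 + r ≤ 2`, that of `f` at
  -- most `2 B`.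
  refine ⟨4, 2 * C₁ * Real.exp 1 / r, by norm_num, by positivity, ?_⟩
  intro y hy f hf m B hB v hv
  have hB0 : 0 ≤ B := by simpa using (norm_nonneg _).trans (hB 0 (Nat.zero_le m))
  -- Starting with the identity as transport makes the derivative of `P f` along the field equal to
  -- the spray derivative of `f` itself.
  set s : E × E × (F →L[ℝ] F) := (y, v, ContinuousLinearMap.id ℝ F) with hs
  have hsΩ : s.1 ∈ Ω := hKΩ hy
  have hsK : s ∈ K ×ˢ (Metric.closedBall (0 : E) 1 ×ˢ {ContinuousLinearMap.id ℝ F}) :=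
    ⟨hy, by simpa using hv, rfl⟩
  have hC : ∀ m, jetSum r m Z s ≤ C₁ := fun m ↦
    (jetSum_mono hr0.le (min_le_left _ _) le_rfl _ _).trans ((hC₀ s hsK m).trans (le_max_left _ _))
  have hfst : ContDiffAt ℝ ω (fun s : E × E × (F →L[ℝ] F) ↦ f s.1) s :=
    (hf y (hKΩ hy)).comp s contDiffAt_fst
  have hsnd : ContDiffAt ℝ ω (fun s : E × E × (F →L[ℝ] F) ↦ s.2.2) s := contDiffAt_snd.snd
  have h1 := jetSum_iterate_lieD_le_factorial (hZ s hsΩ) hr0 hC m 0 (hsnd.clm_apply hfst)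
  have h2 := iterate_lieD_sprayField_apply hΩ hΓ hA (H := fun p ↦ f p.1)
    (fun p hp ↦ (hf _ hp).comp p contDiffAt_fst) m hsΩ
  have h3 : ‖(sprayOp Γ A)^[m] (fun p ↦ f p.1) (y, v)‖ ≤
      jetSum (r / 2) 0 ((lieD Z)^[m] fun s ↦ s.2.2 (f s.1)) s := by
    refine le_trans (le_of_eq ?_) (norm_le_jetSum (by positivity) 0 _ s)
    rw [h2]
    rfl
  have h4 : jetSum r (0 + m) (fun s : E × E × (F →L[ℝ] F) ↦ s.2.2 (f s.1)) s ≤ 4 * B := by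
    have h5 := jetSum_bilinear_le hr0.le (0 + m) (ContinuousLinearMap.id ℝ (F →L[ℝ] F)) hsnd hfst
    have h6 : ‖ContinuousLinearMap.id ℝ (F →L[ℝ] F)‖ ≤ 1 := ContinuousLinearMap.norm_id_le
    have h7 : jetSum r (0 + m) (fun s : E × E × (F →L[ℝ] F) ↦ s.2.2) s ≤ 2 := by
      have h8 := jetSum_clm_le hr0.le (0 + m)
        ((ContinuousLinearMap.snd ℝ E (F →L[ℝ] F)) ∘L (ContinuousLinearMap.snd ℝ E _)) s
      have h9 : ‖(ContinuousLinearMap.snd ℝ E (F →L[ℝ] F)) ∘L (ContinuousLinearMap.snd ℝ E _)‖ ≤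
          1 := (ContinuousLinearMap.opNorm_comp_le _ _).trans
            (mul_le_one₀ (ContinuousLinearMap.norm_snd_le ..) (norm_nonneg _)
              (ContinuousLinearMap.norm_snd_le ..))
      refine h8.trans ?_
      have h10 : ‖((ContinuousLinearMap.snd ℝ E (F →L[ℝ] F)) ∘L
          (ContinuousLinearMap.snd ℝ E _)) s‖ ≤ 1 := ContinuousLinearMap.norm_id_le
      have h11 : r ≤ 1 / 2 := min_le_right _ _
      nlinarith [norm_nonneg ((ContinuousLinearMap.snd ℝ E (F →L[ℝ] F)) ∘L
        (ContinuousLinearMap.snd ℝ E (E × (F →L[ℝ] F))))]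
    have h12 : jetSum r (0 + m) (fun s : E × E × (F →L[ℝ] F) ↦ f s.1) s ≤ 2 * B := by
      have h13 := jetSum_comp_clm_le hr0.le (0 + m) (ContinuousLinearMap.fst ℝ E
        (E × (F →L[ℝ] F))) (ContinuousLinearMap.norm_fst_le ..) (f := f) (a := 0) (p := s)
        (by simpa using hf y (hKΩ hy))
      simp only [zero_add, ContinuousLinearMap.coe_fst'] at h13
      rw [zero_add]
      refine h13.trans (jetSum_le_of_forall hr0.le zero_le_one ?_ ?_)
      · rw [mul_one]; exact min_le_right _ _
      · simpa using hB
    have h14 := jetSum_nonneg hr0.le (0 + m) (fun s : E × E × (F →L[ℝ] F) ↦ f s.1) s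
    have h15 := jetSum_nonneg hr0.le (0 + m) (fun s : E × E × (F →L[ℝ] F) ↦ s.2.2) s
    calc _ ≤ _ := h5
      _ ≤ 1 * (2 * (2 * B)) := by gcongr
      _ = _ := by ring
  calc _ ≤ _ := h3
    _ ≤ _ := h1
    _ ≤ (2 * C₁ * Real.exp 1 / r) ^ m * m.factorial * (4 * B) := by gcongr
    _ = _ := by ring

end Spray

/-! ### Recovering partial derivatives from derivatives along the spray -/

section Inverse

universe u

variable {E : Type u} [NormedAddCommGroup E] [NormedSpace ℝ E]

/-- If `e` is a local change of coordinates whose derivative is close to a multiple of the identity,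
the derivatives of `f` are bounded by those of `f ∘ e`. -/
theorem norm_iteratedFDeriv_le_jetSum_comp {e : E → E} {R : E → E →L[ℝ] E} {ρ r δ : ℝ}
    (he : ContDiffAt ℝ ω e 0) (hR : ContDiffAt ℝ ω R 0) (hρ : 0 < ρ) (hδ : 0 < δ)
    (hde : ∀ᶠ w in 𝓝 0, fderiv ℝ e w = ρ • (ContinuousLinearMap.id ℝ E + R w))
    (hRr : ∀ m, jetSum r m R 0 ≤ 1 / 2) (i : ℕ) (hi : i * δ ≤ r) :
    ∀ {F : Type u} [NormedAddCommGroup F] [NormedSpace ℝ F] {f : E → F}, ContDiffAt ℝ ω f (e 0) →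
      ‖iteratedFDeriv ℝ i f (e 0)‖ ≤ (2 / (ρ * δ)) ^ i * jetSum (i * δ) i (fun w ↦ f (e w)) 0 := by
  induction i with
  | zero => intro F _ _ f hf; simp [jetSum]
  | succ i ih =>
    intro F _ _ f hf
    push_cast at hi
    have hiδ : 0 ≤ (i : ℝ) * δ := by positivity
    have hi' : i * δ ≤ r := by linarith
    have hf' : ContDiffAt ℝ ω (fderiv ℝ f) (e 0) := hf.fderiv_right (m := ω) le_rfl
    -- The induction hypothesis is applied to the derivative of `f`, whose values lie in `E →L[ℝ]
    -- F`; this is why the target space is quantified.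
    rw [← norm_iteratedFDeriv_fderiv]
    refine (ih hi' hf').trans ?_
    have hfe : ContDiffAt ℝ ω (fun w ↦ f (e w)) 0 := hf.comp 0 he
    have hk : ContDiffAt ℝ ω (fun w ↦ fderiv ℝ f (e w)) 0 := hf'.comp 0 he
    -- The chain rule solved for `Df ∘ e`: it equals `ρ⁻¹ D(f ∘ e)` minus `(Df ∘ e) R`. The jet of
    -- `R` is at most `1/2`, so the last term is absorbed on the left and `Df ∘ e` is bounded by
    -- `2/ρ` times `D(f ∘ e)`.
    have h1 : (fun w ↦ fderiv ℝ f (e w)) =ᶠ[𝓝 0] fun w ↦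
        ρ⁻¹ • fderiv ℝ (fun w ↦ f (e w)) w + (-1 : ℝ) • (fderiv ℝ f (e w) ∘L R w) := by
      filter_upwards [hde, eventually_contDiffAt he,
        he.continuousAt.eventually (eventually_contDiffAt hf)] with w hw hew hfw
      have h2 : fderiv ℝ (fun w ↦ f (e w)) w = fderiv ℝ f (e w) ∘L fderiv ℝ e w :=
        ((hfw.differentiableAt (by simp)).hasFDerivAt.comp w
          (hew.differentiableAt (by simp)).hasFDerivAt).fderiv
      rw [h2, hw]
      ext v
      simp [hρ.ne']
    have hDf : ContDiffAt ℝ ω (fderiv ℝ fun w ↦ f (e w)) 0 := hfe.fderiv_right (m := ω) le_rfl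
    have hkR : ContDiffAt ℝ ω (fun w ↦ fderiv ℝ f (e w) ∘L R w) 0 := hk.clm_comp hR
    have h3 : jetSum (i * δ) i (fun w ↦ fderiv ℝ f (e w) ∘L R w) 0 ≤
        1 / 2 * jetSum (i * δ) i (fun w ↦ fderiv ℝ f (e w)) 0 := by
      have h4 := jetSum_bilinear_le hiδ i (ContinuousLinearMap.compL ℝ E E F) hk hR
      have h5 := ContinuousLinearMap.norm_compL_le ℝ E E F
      have h6 : jetSum (i * δ) i R 0 ≤ 1 / 2 := (jetSum_mono hiδ hi' le_rfl _ _).trans (hRr i)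
      have h7 := jetSum_nonneg hiδ i (fun w ↦ fderiv ℝ f (e w)) 0
      have h8 := jetSum_nonneg hiδ i R 0
      calc _ ≤ _ := h4
        _ ≤ 1 * (jetSum (i * δ) i (fun w ↦ fderiv ℝ f (e w)) 0 * (1 / 2)) := by gcongr
        _ = _ := by ring
    have h9 : jetSum (i * δ) i (fun w ↦ fderiv ℝ f (e w)) 0 ≤
        2 / ρ * jetSum (i * δ) i (fderiv ℝ fun w ↦ f (e w)) 0 := by
      have h10 := jetSum_add_le hiδ i (hDf.const_smul ρ⁻¹) (hkR.const_smul (-1 : ℝ))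
      have h11 := jetSum_const_smul (r := i * δ) i ρ⁻¹ hDf
      have h12 := jetSum_const_smul (r := i * δ) i (-1 : ℝ) hkR
      rw [abs_of_pos (inv_pos.2 hρ)] at h11
      rw [abs_neg, abs_one, one_mul] at h12
      have h13 : jetSum (i * δ) i (fun w ↦ fderiv ℝ f (e w)) 0 ≤
          ρ⁻¹ * jetSum (i * δ) i (fderiv ℝ fun w ↦ f (e w)) 0 +
            1 / 2 * jetSum (i * δ) i (fun w ↦ fderiv ℝ f (e w)) 0 := by
        conv_lhs => rw [jetSum_congr h1]
        exact h10.trans (add_le_add h11.le (h12.le.trans h3))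
      have h14 : 2 / ρ = 2 * ρ⁻¹ := div_eq_mul_inv _ _
      rw [h14]
      linarith
    have h15 := jetSum_fderiv_le hiδ hδ.le i (fun w ↦ f (e w)) 0
    have h16 : (i : ℝ) * δ + δ = ((i + 1 : ℕ) : ℝ) * δ := by push_cast; ring
    rw [h16] at h15
    calc (2 / (ρ * δ)) ^ i * jetSum (i * δ) i (fun w ↦ fderiv ℝ f (e w)) 0
        ≤ (2 / (ρ * δ)) ^ i * (2 / ρ *
            (jetSum ((i + 1 : ℕ) * δ) (i + 1) (fun w ↦ f (e w)) 0 / δ)) := by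
          gcongr
          refine h9.trans ?_
          gcongr
          rwa [le_div_iff₀ hδ]
      _ = _ := by
          rw [pow_succ]
          field_simp

variable {F : Type u} [NormedAddCommGroup F] [NormedSpace ℝ F]
  {Γ : E → E →L[ℝ] E →L[ℝ] E} {A : E → E →L[ℝ] F →L[ℝ] F}

variable (E F) in
/-- The projection of the state space of `sprayField` that forgets the velocity. -/
noncomputable def forgetVelocity : E × E × (F →L[ℝ] F) →L[ℝ] (F →L[ℝ] F) × E :=
  ((ContinuousLinearMap.snd ℝ E (F →L[ℝ] F)) ∘L (ContinuousLinearMap.snd ℝ E _)).prod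
    (ContinuousLinearMap.fst ℝ E _)

/-- The inclusion of the velocities in the state space of `sprayField`, over a fixed point and with
the identity as transport. -/
noncomputable def velocityState (F : Type u) [NormedAddCommGroup F] [NormedSpace ℝ F] (y w : E) :
    E × E × (F →L[ℝ] F) :=
  (y, w, ContinuousLinearMap.id ℝ F)

variable (E F) in
/-- The linear part of `velocityState`. -/
noncomputable def velocityIncl : E →L[ℝ] E × E × (F →L[ℝ] F) :=
  (0 : E →L[ℝ] E).prod ((ContinuousLinearMap.id ℝ E).prod 0)

theorem velocityState_eq (y w : E) :
    velocityState F y w = velocityState F y 0 + velocityIncl E F w := by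
  simp [velocityState, velocityIncl]

theorem norm_velocityIncl_le : ‖velocityIncl E F‖ ≤ 1 :=
  ContinuousLinearMap.opNorm_le_bound _ zero_le_one fun w ↦ by
    simp [velocityIncl, Prod.norm_def]

/-- The exponential map at `y`, together with the inverse of parallel transport along radial
geodesics, truncated at order `N` and with the velocity scaled by `ρ`. -/
noncomputable def expSeries (Γ : E → E →L[ℝ] E →L[ℝ] E) (A : E → E →L[ℝ] F →L[ℝ] F) (y : E)
    (ρ : ℝ) (N : ℕ) (w : E) : (F →L[ℝ] F) × E :=
  ∑ i ∈ Finset.range N, (ρ ^ i / i.factorial) •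
    (lieD (sprayField Γ A))^[i] (forgetVelocity E F) (velocityState F y w)

theorem contDiffAt_iterate_forgetVelocity {Ω : Set E} (hΓ : ∀ y ∈ Ω, ContDiffAt ℝ ω Γ y)
    (hA : ∀ y ∈ Ω, ContDiffAt ℝ ω A y) (i : ℕ) {s : E × E × (F →L[ℝ] F)} (hs : s.1 ∈ Ω) :
    ContDiffAt ℝ ω ((lieD (sprayField Γ A))^[i] (forgetVelocity E F)) s :=
  contDiffAt_iterate_lieD (contDiffAt_sprayField (hΓ _ hs) (hA _ hs))
    (forgetVelocity E F).contDiff.contDiffAt i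

theorem contDiff_velocityState (y : E) : ContDiff ℝ ω (velocityState F y) :=
  contDiff_const.prodMk (contDiff_id.prodMk contDiff_const)

theorem contDiff_iterate_velocityState {Ω : Set E} (hΓ : ∀ y ∈ Ω, ContDiffAt ℝ ω Γ y)
    (hA : ∀ y ∈ Ω, ContDiffAt ℝ ω A y) {y : E} (hy : y ∈ Ω) (i : ℕ) : ContDiff ℝ ω fun w ↦
      (lieD (sprayField Γ A))^[i] (forgetVelocity E F) (velocityState F y w) :=
  contDiff_iff_contDiffAt.2 fun w ↦ (contDiffAt_iterate_forgetVelocity hΓ hA i (by exact hy)).comp w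
    (contDiff_velocityState y).contDiffAt

theorem contDiff_expSeries {Ω : Set E} (hΓ : ∀ y ∈ Ω, ContDiffAt ℝ ω Γ y)
    (hA : ∀ y ∈ Ω, ContDiffAt ℝ ω A y) {y : E} (hy : y ∈ Ω) (ρ : ℝ) (N : ℕ) :
    ContDiff ℝ ω (expSeries Γ A y ρ N) :=
  ContDiff.sum fun i _ ↦ (contDiff_iterate_velocityState hΓ hA hy i).const_smul _

theorem iterate_forgetVelocity_smul {Ω : Set E} (hΩ : IsOpen Ω)
    (hΓ : ∀ y ∈ Ω, ContDiffAt ℝ ω Γ y) (hA : ∀ y ∈ Ω, ContDiffAt ℝ ω A y) {y : E} (hy : y ∈ Ω)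
    (i : ℕ) (t : ℝ) (w : E) :
    (lieD (sprayField Γ A))^[i] (forgetVelocity E F) (velocityState F y (t • w)) =
      t ^ i • (lieD (sprayField Γ A))^[i] (forgetVelocity E F) (velocityState F y w) := by
  have h0 : VelocityHomogeneous Ω 0 (forgetVelocity E F) := fun s _ t ↦ by
    rw [pow_zero, one_smul]; rfl
  exact h0.iterate_lieD hΩ hΓ hA (fun s _ ↦ (forgetVelocity E F).contDiff.contDiffAt) i
    (velocityState F y w) hy t

/-- By homogeneity, the factor `t` on a ray moves out of the velocity and becomes the time variable.
Along a ray the truncated exponential is therefore a Taylor polynomial in time, for the flow with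
initial velocity `ρ w`. -/
theorem expSeries_smul {Ω : Set E} (hΩ : IsOpen Ω)
    (hΓ : ∀ y ∈ Ω, ContDiffAt ℝ ω Γ y) (hA : ∀ y ∈ Ω, ContDiffAt ℝ ω A y) {y : E} (hy : y ∈ Ω)
    (ρ : ℝ) (N : ℕ) (t : ℝ) (w : E) :
    expSeries Γ A y ρ N (t • w) = ∑ i ∈ Finset.range N, (t ^ i / i.factorial) •
      (lieD (sprayField Γ A))^[i] (forgetVelocity E F) (velocityState F y (ρ • w)) := by
  refine Finset.sum_congr rfl fun i _ ↦ ?_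
  rw [iterate_forgetVelocity_smul hΩ hΓ hA hy, iterate_forgetVelocity_smul hΩ hΓ hA hy, smul_smul,
    smul_smul]
  congr 1
  ring

theorem iteratedFDeriv_diagonal_eq_iteratedDeriv {G : Type*} [NormedAddCommGroup G]
    [NormedSpace ℝ G] {g : E → G} (hg : ContDiffAt ℝ ω g 0) (j : ℕ) (w : E) :
    iteratedFDeriv ℝ j g 0 (fun _ ↦ w) = iteratedDeriv j (fun t : ℝ ↦ g (t • w)) 0 := by
  obtain ⟨u, hu, hpu, hgu⟩ := exists_isOpen_contDiffOn hg
  set L := ContinuousLinearMap.toSpanSingleton ℝ w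
  have hu' : IsOpen (L ⁻¹' u) := hu.preimage L.continuous
  have h0 : (0 : ℝ) ∈ L ⁻¹' u := by simpa using hpu
  have h0' : L 0 ∈ u := h0
  have := L.iteratedFDerivWithin_comp_right hgu hu.uniqueDiffOn hu'.uniqueDiffOn h0' (i := j) le_top
  rw [iteratedFDerivWithin_of_isOpen _ hu' h0, iteratedFDerivWithin_of_isOpen _ hu h0'] at this
  rw [iteratedDeriv_eq_iteratedFDeriv]
  change _ = iteratedFDeriv ℝ j (g ∘ L) 0 fun _ ↦ 1
  rw [this]
  simp [L]

/-- On the ray `t w` the series has the same jet below order `N` as the projected integral curve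
from `(y, ρ w, id)`. So the diagonal derivatives of `P (f ∘ e)` are derivatives along the field,
that is, spray derivatives of `f`. -/
theorem iteratedFDeriv_expSeries_diagonal [CompleteSpace E] [CompleteSpace F] {Ω : Set E}
    (hΩ : IsOpen Ω) (hΓ : ∀ y ∈ Ω, ContDiffAt ℝ ω Γ y) (hA : ∀ y ∈ Ω, ContDiffAt ℝ ω A y) {y : E}
    (hy : y ∈ Ω) (ρ : ℝ) {N j : ℕ} (hj : j < N) {f : E → F} (hf : ∀ y ∈ Ω, ContDiffAt ℝ ω f y)
    (hg : ContDiffAt ℝ ω (fun w ↦ (expSeries Γ A y ρ N w).1 (f (expSeries Γ A y ρ N w).2)) 0)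
    (w : E) :
    iteratedFDeriv ℝ j (fun w ↦ (expSeries Γ A y ρ N w).1 (f (expSeries Γ A y ρ N w).2)) 0
      (fun _ ↦ w) = (sprayOp Γ A)^[j] (fun p ↦ f p.1) (y, ρ • w) := by
  rw [iteratedFDeriv_diagonal_eq_iteratedDeriv hg]
  simp only [expSeries_smul hΩ hΓ hA hy]
  have hΦ : ContDiffAt ℝ ω (fun p : (F →L[ℝ] F) × E ↦ p.1 (f p.2))
      (forgetVelocity E F (velocityState F y (ρ • w))) :=
    contDiffAt_fst.clm_apply (ContDiffAt.comp (g := f) _ (hf _ hy) contDiffAt_snd)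
  have h1 := iteratedDeriv_comp_lieSeries (Z := sprayField Γ A) (s := velocityState F y (ρ • w))
    (contDiffAt_sprayField (hΓ _ hy) (hA _ hy)) (forgetVelocity E F).contDiff.contDiffAt hΦ hj
  rw [h1]
  exact iterate_lieD_sprayField_apply hΩ hΓ hA (H := fun p ↦ f p.1)
    (fun p hp ↦ (hf _ hp).comp p contDiffAt_fst) j (s := velocityState F y (ρ • w)) hy

/-- The `i!` produced by iterated derivatives along the field cancels the one in the series, leaving
a geometric term whose ratio is proportional to `ρ`. Dependence on `w` costs nothing, as the
inclusion of velocities has norm at most one. -/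
theorem jetSum_expSeries_term_le [CompleteSpace E] [CompleteSpace F] {Ω : Set E}
    (hΓ : ∀ y ∈ Ω, ContDiffAt ℝ ω Γ y) (hA : ∀ y ∈ Ω, ContDiffAt ℝ ω A y) {y : E}
    (hy : y ∈ Ω) {ρ r C D : ℝ} (hρ : 0 ≤ ρ) (hr : 0 < r)
    (hC : ∀ m, jetSum r m (sprayField Γ A) (velocityState F y 0) ≤ C)
    (hD : ∀ m, jetSum r m (forgetVelocity E F) (velocityState F y 0) ≤ D) (i M : ℕ) :
    jetSum (r / 2) M (fun w ↦ (ρ ^ i / i.factorial) •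
      (lieD (sprayField Γ A))^[i] (forgetVelocity E F) (velocityState F y w)) 0 ≤
      (ρ * (2 * C * Real.exp 1 / r)) ^ i * D := by
  have hC0 : 0 ≤ C := (jetSum_nonneg hr.le 0 _ _).trans (hC 0)
  rw [jetSum_const_smul _ _ (contDiff_iterate_velocityState hΓ hA hy i).contDiffAt,
    abs_of_nonneg (by positivity)]
  have h1 : jetSum (r / 2) M (fun w ↦
      (lieD (sprayField Γ A))^[i] (forgetVelocity E F) (velocityState F y w)) 0 ≤
      jetSum (r / 2) M ((lieD (sprayField Γ A))^[i] (forgetVelocity E F))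
        (velocityState F y 0) := by
    have := jetSum_comp_clm_le (r := r / 2) (by positivity) M (velocityIncl E F)
      norm_velocityIncl_le (f := (lieD (sprayField Γ A))^[i] (forgetVelocity E F))
      (a := velocityState F y 0) (p := 0)
      (contDiffAt_iterate_forgetVelocity hΓ hA i (by simpa [velocityState] using hy))
    simp only [map_zero, add_zero] at this
    simpa only [← velocityState_eq] using this
  have h2 := jetSum_iterate_lieD_le_factorial (contDiffAt_sprayField (hΓ y hy) (hA y hy)) hr hC i M
    (s := velocityState F y 0) (forgetVelocity E F).contDiff.contDiffAt
  calc _ ≤ ρ ^ i / i.factorial * ((2 * C * Real.exp 1 / r) ^ i * i.factorial * D) := by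
        gcongr
        exact (h1.trans h2).trans (by gcongr; exact hD _)
    _ = _ := by rw [mul_pow]; field_simp

theorem sum_geometric_shift_le {q D : ℝ} (hq : 0 ≤ q) (hq' : q ≤ 1 / 2) (hD : 0 ≤ D) (k N : ℕ) :
    ∑ i ∈ Finset.range N, q ^ (i + k) * D ≤ 2 * q ^ k * D := by
  calc ∑ i ∈ Finset.range N, q ^ (i + k) * D
      ≤ ∑ i ∈ Finset.range N, (1 / 2) ^ i * (q ^ k * D) := by
        refine Finset.sum_le_sum fun i _ ↦ ?_
        rw [pow_add, mul_assoc]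
        gcongr
    _ = (∑ i ∈ Finset.range N, (1 / 2 : ℝ) ^ i) * (q ^ k * D) := by rw [Finset.sum_mul]
    _ ≤ 2 * (q ^ k * D) := by gcongr; exact sum_geometric_two_le _
    _ = _ := by ring

/-- Used with `k = 1` for the distance of the transport from the identity, and with `k = 2` for the
distance of the exponential map from its affine part. -/
theorem jetSum_expSeries_tail_le [CompleteSpace E] [CompleteSpace F] {Ω : Set E}
    (hΓ : ∀ y ∈ Ω, ContDiffAt ℝ ω Γ y) (hA : ∀ y ∈ Ω, ContDiffAt ℝ ω A y) {y : E}
    (hy : y ∈ Ω) {ρ r C D : ℝ} (hρ : 0 ≤ ρ) (hr : 0 < r)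
    (hC : ∀ m, jetSum r m (sprayField Γ A) (velocityState F y 0) ≤ C)
    (hD : ∀ m, jetSum r m (forgetVelocity E F) (velocityState F y 0) ≤ D)
    (hq : ρ * (2 * C * Real.exp 1 / r) ≤ 1 / 2) (k N M : ℕ) :
    jetSum (r / 2) M (fun w ↦ ∑ i ∈ Finset.range N, (ρ ^ (i + k) / (i + k).factorial) •
      (lieD (sprayField Γ A))^[i + k] (forgetVelocity E F) (velocityState F y w)) 0 ≤
      2 * (ρ * (2 * C * Real.exp 1 / r)) ^ k * D := by
  have hC0 : 0 ≤ C := (jetSum_nonneg hr.le 0 _ _).trans (hC 0)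
  have hD0 : 0 ≤ D := (jetSum_nonneg hr.le 0 _ _).trans (hD 0)
  refine (jetSum_sum_le (by positivity) M _ fun i _ ↦
    ((contDiff_iterate_velocityState hΓ hA hy (i + k)).const_smul _).contDiffAt).trans ?_
  refine le_trans (Finset.sum_le_sum fun i _ ↦ ?_)
    (sum_geometric_shift_le (by positivity) hq hD0 k N)
  exact jetSum_expSeries_term_le hΓ hA hy hρ hr hC hD (i + k) M

end Inverse

/-! ### Quantitative inversion of the truncated exponential map -/

section InverseBound

universe u

variable {E F : Type u} [NormedAddCommGroup E] [NormedSpace ℝ E] [NormedAddCommGroup F]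
  [NormedSpace ℝ F] {Γ : E → E →L[ℝ] E →L[ℝ] E} {A : E → E →L[ℝ] F →L[ℝ] F}

theorem expSeries_eq_add_tail_one (y : E) (ρ : ℝ) (N : ℕ) (w : E) :
    expSeries Γ A y ρ (N + 1) w = (∑ i ∈ Finset.range N, (ρ ^ (i + 1) / (i + 1).factorial) •
      (lieD (sprayField Γ A))^[i + 1] (forgetVelocity E F) (velocityState F y w)) +
      (ContinuousLinearMap.id ℝ F, y) := by
  rw [expSeries, Finset.sum_range_succ']
  simp [forgetVelocity, velocityState]

theorem lieD_forgetVelocity (y w : E) :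
    lieD (sprayField Γ A) (forgetVelocity E F) (velocityState F y w) = (A y w, w) := by
  rw [lieD, ContinuousLinearMap.fderiv]
  simp [forgetVelocity, velocityState, sprayField]

theorem expSeries_eq_add_tail_two (y : E) (ρ : ℝ) (N : ℕ) (w : E) :
    expSeries Γ A y ρ (N + 2) w = (∑ i ∈ Finset.range N, (ρ ^ (i + 2) / (i + 2).factorial) •
      (lieD (sprayField Γ A))^[i + 2] (forgetVelocity E F) (velocityState F y w)) +
      ρ • (A y w, w) + (ContinuousLinearMap.id ℝ F, y) := by
  rw [expSeries_eq_add_tail_one, Finset.sum_range_succ']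
  simp [lieD_forgetVelocity]

/-- Quantitative form of the inversion: if the truncated exponential series is close enough to its
linear part, the partial derivatives of `f` are bounded by the derivatives along the spray. -/
theorem norm_iteratedFDeriv_le_of_sprayOp [CompleteSpace E] [CompleteSpace F] {Ω : Set E}
    (hΩ : IsOpen Ω) (hΓ : ∀ y ∈ Ω, ContDiffAt ℝ ω Γ y) (hA : ∀ y ∈ Ω, ContDiffAt ℝ ω A y) {y : E}
    (hy : y ∈ Ω) {ρ r C D τ : ℝ} (hρ : 0 < ρ) (hρ1 : ρ ≤ 1) (hr : 0 < r) (hτ : 0 < τ)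
    (hτr : τ ≤ r / 4) (hτe : τ * (2 * Real.exp 1) ≤ 1 / 2)
    (hC : ∀ m, jetSum r m (sprayField Γ A) (velocityState F y 0) ≤ C)
    (hD : ∀ m, jetSum r m (forgetVelocity E F) (velocityState F y 0) ≤ D)
    (hq : ρ * (2 * C * Real.exp 1 / r) ≤ 1 / 2)
    (hq1 : 2 * (ρ * (2 * C * Real.exp 1 / r)) * D ≤ 1 / 2)
    (hq2 : ρ⁻¹ * (2 * (ρ * (2 * C * Real.exp 1 / r)) ^ 2 * D / (r / 4)) ≤ 1 / 2)
    {f : E → F} (hf : ∀ y ∈ Ω, ContDiffAt ℝ ω f y) {m : ℕ} {B : ℝ}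
    (hB : ∀ j ≤ m, ∀ v : E, ‖v‖ ≤ 1 →
      ‖(sprayOp Γ A)^[j] (fun p ↦ f p.1) (y, v)‖ ≤ B * j.factorial) :
    ‖iteratedFDeriv ℝ m f y‖ ≤ 4 * (2 * Real.exp 1 / (ρ * τ)) ^ m * m.factorial * B := by
  have hC0 : 0 ≤ C := (jetSum_nonneg hr.le 0 _ _).trans (hC 0)
  have hD0 : 0 ≤ D := (jetSum_nonneg hr.le 0 _ _).trans (hD 0)
  have hB0 : 0 ≤ B := by simpa using (norm_nonneg _).trans (hB 0 (Nat.zero_le m) 0 (by simp))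
  have hτ2 : τ ≤ r / 2 := by linarith
  -- With `m + 2` terms every order `j ≤ m` is represented exactly, and the terms of order 0 and 1
  -- can be split off for all `m`.
  set V := expSeries Γ A y ρ (m + 2) with hV
  have hVs : ContDiff ℝ ω V := contDiff_expSeries hΓ hA hy ρ _
  have hVP : ContDiffAt ℝ ω (fun w ↦ (V w).1) 0 := hVs.fst.contDiffAt
  have hVe : ContDiffAt ℝ ω (fun w ↦ (V w).2) 0 := hVs.snd.contDiffAt
  have hsm : ∀ i, ContDiff ℝ ω fun w ↦
      (lieD (sprayField Γ A))^[i] (forgetVelocity E F) (velocityState F y w) :=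
    contDiff_iterate_velocityState hΓ hA hy
  -- All terms of positive order vanish at zero velocity by homogeneity.
  have hV0 : V 0 = (ContinuousLinearMap.id ℝ F, y) := by
    rw [hV, expSeries_eq_add_tail_one, Finset.sum_eq_zero, zero_add]
    intro i _
    have := iterate_forgetVelocity_smul (F := F) hΩ hΓ hA hy (i + 1) 0 0
    rw [zero_smul, zero_pow (Nat.succ_ne_zero i), zero_smul] at this
    rw [this, smul_zero]
  have he0 : (V 0).2 = y := by rw [hV0]
  have hfy : ContDiffAt ℝ ω f ((V 0).2) := he0 ▸ hf y hy
  have hh : ContDiffAt ℝ ω (fun w ↦ f (V w).2) 0 := ContDiffAt.comp (g := f) 0 hfy hVe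
  have hg : ContDiffAt ℝ ω (fun w ↦ (V w).1 (f (V w).2)) 0 := hVP.clm_apply hh
  -- the jet of `g`
  have hgm : jetSum τ m (fun w ↦ (V w).1 (f (V w).2)) 0 ≤ 2 * B := by
    -- Only diagonal values are known; polarization costs `(2e)^j`, and `τ` was chosen with `2 e τ ≤
    -- 1/2` to compensate.
    refine jetSum_le_of_forall hτ.le (by positivity) hτe fun j hj ↦ ?_
    have h1 : ∀ v : E, ‖v‖ ≤ 1 → ‖iteratedFDeriv ℝ j (fun w ↦ (V w).1 (f (V w).2)) 0 fun _ ↦ v‖ ≤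
        B * j.factorial := by
      intro v hv
      rw [iteratedFDeriv_expSeries_diagonal hΩ hΓ hA hy ρ (by omega) hf hg]
      refine hB j hj _ ?_
      rw [norm_smul, Real.norm_of_nonneg hρ.le]
      exact mul_le_one₀ hρ1 (norm_nonneg _) hv
    refine (opNorm_le_of_diagonal _ (fun σ v ↦ hg.iteratedFDeriv_comp_perm v σ) h1).trans ?_
    exact le_of_eq (by ring)
  -- the jet of `h`
  have hW := jetSum_expSeries_tail_le hΓ hA hy hρ.le hr hC hD hq 1 (m + 1)
  set W : E → (F →L[ℝ] F) × E := fun w ↦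
    ∑ i ∈ Finset.range (m + 1), (ρ ^ (i + 1) / (i + 1).factorial) •
      (lieD (sprayField Γ A))^[i + 1] (forgetVelocity E F) (velocityState F y w) with hWdef
  have hWs : ContDiff ℝ ω W := ContDiff.sum fun i _ ↦ (hsm (i + 1)).const_smul _
  have hP : ∀ w, (V w).1 = (W w).1 + ContinuousLinearMap.id ℝ F := fun w ↦ by
    rw [hV, expSeries_eq_add_tail_one]
    rfl
  have hW1 : jetSum τ m (fun w ↦ (W w).1) 0 ≤ 1 / 2 := by
    have h1 := jetSum_clm_comp_le (r := r / 2) (by positivity) m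
      (ContinuousLinearMap.fst ℝ (F →L[ℝ] F) E) hWs.contDiffAt (p := 0)
    have h2 := jetSum_nonneg (r := r / 2) (by positivity) m W 0
    have h3 : ‖ContinuousLinearMap.fst ℝ (F →L[ℝ] F) E‖ ≤ 1 := ContinuousLinearMap.norm_fst_le ..
    calc jetSum τ m (fun w ↦ (W w).1) 0 ≤ jetSum (r / 2) m (fun w ↦ (W w).1) 0 :=
          jetSum_mono hτ.le hτ2 le_rfl _ _
      _ ≤ _ := h1
      _ ≤ 1 * (2 * (ρ * (2 * C * Real.exp 1 / r)) ^ 1 * D) := by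
          gcongr
          exact hW m
      _ ≤ 1 / 2 := by rwa [pow_one, one_mul]
  -- Undoing the transport `P = id + W₁`: from `f ∘ e = P (f ∘ e) - W₁ (f ∘ e)` and jet of `W₁` at
  -- most `1/2`, the last term is absorbed and the bound `2 B` doubles.
  have hhm : jetSum τ m (fun w ↦ f (V w).2) 0 ≤ 4 * B := by
    have hWh : ContDiffAt ℝ ω (fun w ↦ (W w).1 (f (V w).2)) 0 :=
      hWs.fst.contDiffAt.clm_apply hh
    have h1 : (fun w ↦ f (V w).2) = fun w ↦
        (V w).1 (f (V w).2) + (-1 : ℝ) • (W w).1 (f (V w).2) := by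
      ext1 w
      rw [hP]
      simp
    have h2 := jetSum_add_le hτ.le m hg (hWh.const_smul (-1 : ℝ))
    have h3 := jetSum_const_smul (r := τ) m (-1 : ℝ) hWh
    rw [abs_neg, abs_one, one_mul] at h3
    have h4 := jetSum_bilinear_le hτ.le m (ContinuousLinearMap.id ℝ (F →L[ℝ] F))
      hWs.fst.contDiffAt hh
    have h5 : ‖ContinuousLinearMap.id ℝ (F →L[ℝ] F)‖ ≤ 1 := ContinuousLinearMap.norm_id_le
    have h6 := jetSum_nonneg hτ.le m (fun w ↦ f (V w).2) 0
    have h7 := jetSum_nonneg hτ.le m (fun w ↦ (W w).1) 0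
    have h8 : jetSum τ m (fun w ↦ (W w).1 (f (V w).2)) 0 ≤
        1 / 2 * jetSum τ m (fun w ↦ f (V w).2) 0 := by
      calc _ ≤ _ := h4
        _ ≤ 1 * (1 / 2 * jetSum τ m (fun w ↦ f (V w).2) 0) := by gcongr
        _ = _ := one_mul _
    have h9 : jetSum τ m (fun w ↦ f (V w).2) 0 ≤
        2 * B + 1 / 2 * jetSum τ m (fun w ↦ f (V w).2) 0 := by
      conv_lhs => rw [h1]
      exact h2.trans (add_le_add hgm (h3.le.trans h8))
    linarith
  -- Order zero is separated because the radius step below is `τ / m`.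
  rcases Nat.eq_zero_or_pos m with rfl | hm
  · have := (norm_le_jetSum hτ.le 0 (fun w ↦ f (V w).2) 0).trans hhm
    simpa [he0] using this
  -- the derivative of the change of coordinates
  have hT := jetSum_expSeries_tail_le hΓ hA hy hρ.le hr hC hD hq 2 m
  set T : E → (F →L[ℝ] F) × E := fun w ↦
    ∑ i ∈ Finset.range m, (ρ ^ (i + 2) / (i + 2).factorial) •
      (lieD (sprayField Γ A))^[i + 2] (forgetVelocity E F) (velocityState F y w) with hTdef
  have hTs : ContDiff ℝ ω T := ContDiff.sum fun i _ ↦ (hsm (i + 2)).const_smul _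
  have he : ∀ w, (V w).2 = (T w).2 + ρ • w + y := fun w ↦ by
    rw [hV, expSeries_eq_add_tail_two]
    rfl
  have hT2 : ContDiff ℝ ω fun w ↦ (T w).2 := hTs.snd
  -- Since `e(w) = y + ρ w + T₂(w)`, the relative error of its derivative is `ρ⁻¹ D T₂`. The tail
  -- `T₂` is of order `ρ²`, so this is of order `ρ` and still small.
  set R : E → E →L[ℝ] E := fun w ↦ ρ⁻¹ • fderiv ℝ (fun w ↦ (T w).2) w with hR
  have hDT : ContDiffAt ℝ ω (fderiv ℝ fun w ↦ (T w).2) 0 :=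
    hT2.contDiffAt.fderiv_right (m := ω) le_rfl
  have hRs : ContDiffAt ℝ ω R 0 := hDT.const_smul _
  have hde : ∀ᶠ w in 𝓝 (0 : E), fderiv ℝ (fun w ↦ (V w).2) w =
      ρ • (ContinuousLinearMap.id ℝ E + R w) := by
    refine Eventually.of_forall fun w ↦ ?_
    have h1 : HasFDerivAt (fun w ↦ (V w).2)
        (fderiv ℝ (fun w ↦ (T w).2) w + ρ • ContinuousLinearMap.id ℝ E) w := by
      simp only [he]
      exact (((hT2.differentiable (by simp)) w).hasFDerivAt.add
        ((hasFDerivAt_id w).const_smul ρ)).add_const y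
    rw [h1.fderiv, hR, smul_add, smul_inv_smul₀ hρ.ne', add_comm]
  have hRτ : ∀ M, jetSum τ M R 0 ≤ 1 / 2 := by
    intro M
    rw [hR, jetSum_const_smul M _ hDT, abs_of_pos (inv_pos.2 hρ)]
    refine le_trans ?_ hq2
    gcongr
    rw [le_div_iff₀ (by positivity)]
    have h1 := jetSum_fderiv_le (r := r / 4) (δ := r / 4) (by positivity) (by positivity) M
      (fun w ↦ (T w).2) 0
    have h2 := jetSum_clm_comp_le (r := r / 2) (by positivity) (M + 1)
      (ContinuousLinearMap.snd ℝ (F →L[ℝ] F) E) hTs.contDiffAt (p := 0)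
    have h3 : ‖ContinuousLinearMap.snd ℝ (F →L[ℝ] F) E‖ ≤ 1 := ContinuousLinearMap.norm_snd_le ..
    have h4 := jetSum_nonneg (r := r / 2) (by positivity) (M + 1) T 0
    have h5 : r / 4 + r / 4 = r / 2 := by ring
    rw [h5] at h1
    calc jetSum τ M (fderiv ℝ fun w ↦ (T w).2) 0 * (r / 4)
        ≤ jetSum (r / 4) M (fderiv ℝ fun w ↦ (T w).2) 0 * (r / 4) := by
          gcongr
          exact jetSum_mono hτ.le hτr le_rfl _ _
      _ ≤ _ := h1
      _ ≤ _ := h2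
      _ ≤ 1 * (2 * (ρ * (2 * C * Real.exp 1 / r)) ^ 2 * D) := by
          gcongr
          exact hT (M + 1)
      _ = _ := one_mul _
  have hm' : (0 : ℝ) < m := by exact_mod_cast hm
  -- The radius `τ` is consumed in `m` equal steps; the resulting `m^m` is again at most `e^m m!`.
  have hmain := norm_iteratedFDeriv_le_jetSum_comp (e := fun w ↦ (V w).2) hVe hRs hρ
    (δ := τ / m) (by positivity) hde hRτ m (by rw [mul_div_cancel₀ _ hm'.ne']) hfy
  rw [he0, mul_div_cancel₀ _ hm'.ne'] at hmain
  calc ‖iteratedFDeriv ℝ m f y‖ ≤ _ := hmain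
    _ ≤ (2 / (ρ * (τ / m))) ^ m * (4 * B) := by gcongr
    _ = (2 / (ρ * τ)) ^ m * (m : ℝ) ^ m * (4 * B) := by
        rw [← mul_pow]
        congr 2
        field_simp
    _ ≤ (2 / (ρ * τ)) ^ m * (Real.exp 1 ^ m * m.factorial) * (4 * B) := by
        gcongr
        exact pow_self_le_exp_mul_factorial m
    _ = _ := by
        rw [show 2 * Real.exp 1 / (ρ * τ) = 2 / (ρ * τ) * Real.exp 1 by ring, mul_pow]
        ring

theorem contDiff_velocityState_base : ContDiff ℝ ω fun y : E ↦ velocityState F y 0 :=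
  contDiff_id.prodMk contDiff_const

/-- The partial derivatives are bounded by the derivatives along the spray of the same and lower
orders. -/
theorem exists_norm_iteratedFDeriv_le_of_sprayOp [CompleteSpace E] [CompleteSpace F]
    {Ω K : Set E} (hΩ : IsOpen Ω) (hK : IsCompact K) (hKΩ : K ⊆ Ω)
    (hΓ : ∀ y ∈ Ω, ContDiffAt ℝ ω Γ y) (hA : ∀ y ∈ Ω, ContDiffAt ℝ ω A y) :
    ∃ C σ : ℝ, 0 ≤ C ∧ 0 ≤ σ ∧ ∀ y ∈ K, ∀ f : E → F, (∀ y ∈ Ω, ContDiffAt ℝ ω f y) →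
      ∀ (m : ℕ) (B : ℝ), (∀ j ≤ m, ∀ v : E, ‖v‖ ≤ 1 →
        ‖(sprayOp Γ A)^[j] (fun p ↦ f p.1) (y, v)‖ ≤ B * j.factorial) →
      ‖iteratedFDeriv ℝ m f y‖ ≤ C * σ ^ m * m.factorial * B := by
  have hK' : IsCompact ((fun y : E ↦ velocityState F y 0) '' K) :=
    hK.image (contDiff_velocityState_base.continuous)
  obtain ⟨C₀, r₀, hr₀, hC₀⟩ := exists_jetSum_le_of_isCompact hK' (f := sprayField Γ A) <| by
    rintro _ ⟨y, hy, rfl⟩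
    exact (contDiffAt_sprayField (hΓ y (hKΩ hy)) (hA y (hKΩ hy))).analyticAt
  obtain ⟨D₀, r₁, hr₁, hD₀⟩ := exists_jetSum_le_of_isCompact hK' (f := forgetVelocity E F) <| by
    rintro _ ⟨y, hy, rfl⟩
    exact (forgetVelocity E F).contDiff.contDiffAt.analyticAt
  set r := min r₀ r₁
  have hr : 0 < r := lt_min hr₀ hr₁
  set C := max C₀ 0
  set D := max D₀ 0
  set q := 2 * C * Real.exp 1 / r with hq
  have hC0 : 0 ≤ C := le_max_right _ _
  have hD0 : 0 ≤ D := le_max_right _ _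
  have hq0 : 0 ≤ q := by positivity
  -- The three smallness conditions on `ρ` all become linear in `ρ` (in the last, `ρ⁻¹ ρ² = ρ`),
  -- with coefficients the three summands of `c`. Hence `ρ c ≤ 1/2` implies them all.
  set c := q + 2 * q * D + 2 * q ^ 2 * D / (r / 4) with hc
  have hc0 : 0 ≤ c := by positivity
  set ρ := 1 / (2 * (1 + c)) with hρdef
  have hρ : 0 < ρ := by positivity
  have hρc : ρ * c ≤ 1 / 2 := by
    rw [hρdef, div_mul_eq_mul_div, div_le_div_iff₀ (by positivity) (by norm_num)]
    linarith
  have hρ1 : ρ ≤ 1 := by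
    rw [hρdef, div_le_one (by positivity)]
    linarith
  set τ := min (r / 4) (1 / (4 * Real.exp 1))
  have hτ : 0 < τ := lt_min (by positivity) (by positivity)
  have ht1 : 0 ≤ 2 * q * D := by positivity
  have ht2 : 0 ≤ 2 * q ^ 2 * D / (r / 4) := by positivity
  refine ⟨4, 2 * Real.exp 1 / (ρ * τ), by norm_num, by positivity, ?_⟩
  intro y hy f hf m B hB
  refine norm_iteratedFDeriv_le_of_sprayOp hΩ hΓ hA (hKΩ hy) hρ hρ1 hr hτ (min_le_left _ _) ?_
    (C := C) (D := D) ?_ ?_ ?_ ?_ ?_ hf hB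
  · calc τ * (2 * Real.exp 1) ≤ 1 / (4 * Real.exp 1) * (2 * Real.exp 1) := by
          gcongr
          exact min_le_right _ _
      _ = 1 / 2 := by field_simp; norm_num
  · intro m
    exact (jetSum_mono hr.le (min_le_left _ _) le_rfl _ _).trans
      ((hC₀ _ ⟨y, hy, rfl⟩ m).trans (le_max_left _ _))
  · intro m
    exact (jetSum_mono hr.le (min_le_right _ _) le_rfl _ _).trans
      ((hD₀ _ ⟨y, hy, rfl⟩ m).trans (le_max_left _ _))
  · refine le_trans ?_ hρc
    gcongr
    linarith
  · refine le_trans ?_ hρc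
    calc 2 * (ρ * q) * D = ρ * (2 * q * D) := by ring
      _ ≤ ρ * c := by gcongr; linarith
  · refine le_trans ?_ hρc
    calc ρ⁻¹ * (2 * (ρ * q) ^ 2 * D / (r / 4)) = ρ * (2 * q ^ 2 * D / (r / 4)) := by
          field_simp
      _ ≤ ρ * c := by gcongr; linarith

end InverseBound

universe u v w

/-! ### Regularity of operator-valued maps and of maps read in a chart -/

section
variable {E : Type*} [NormedAddCommGroup E] [NormedSpace ℝ E] [FiniteDimensional ℝ E]
  {F : Type*} [NormedAddCommGroup F] [NormedSpace ℝ F]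

/-- The map `f ↦ (v ↦ v_i • f)`, where `v_i` are the coordinates of `v` in a basis of `E`. -/
noncomputable def coordSmulRight (i : Fin (Module.finrank ℝ E)) : F →L[ℝ] E →L[ℝ] F :=
  ContinuousLinearMap.smulRightL ℝ E F
    (LinearMap.toContinuousLinearMap ((Module.finBasis ℝ E).coord i))

theorem clm_eq_sum (A : E →L[ℝ] F) : A = ∑ i, coordSmulRight i (A (Module.finBasis ℝ E i)) := by
  ext v
  conv_lhs => rw [← (Module.finBasis ℝ E).sum_repr v, map_sum]
  simp [coordSmulRight]

/-- Since `E` is finite dimensional, an operator is a finite combination of its values on a basis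
with constant coefficients. -/
theorem contDiffAt_clm_iff {D : Type*} [NormedAddCommGroup D] [NormedSpace ℝ D]
    {f : D → E →L[ℝ] F} {x : D} {k : WithTop ℕ∞} :
    ContDiffAt ℝ k f x ↔ ∀ v, ContDiffAt ℝ k (fun y ↦ f y v) x := by
  refine ⟨fun h v ↦ h.clm_apply contDiffAt_const, fun h ↦ ?_⟩
  have : f = fun y ↦ ∑ i, coordSmulRight i (f y (Module.finBasis ℝ E i)) :=
    funext fun y ↦ clm_eq_sum (f y)
  rw [this]
  exact ContDiffAt.sum fun i _ ↦
    (coordSmulRight (F := F) i).contDiff.contDiffAt.comp x (h _)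

theorem differentiableAt_clm_iff {D : Type*} [NormedAddCommGroup D] [NormedSpace ℝ D]
    {f : D → E →L[ℝ] F} {x : D} :
    DifferentiableAt ℝ f x ↔ ∀ v, DifferentiableAt ℝ (fun y ↦ f y v) x := by
  refine ⟨fun h v ↦ h.clm_apply (differentiableAt_const _), fun h ↦ ?_⟩
  have : f = fun y ↦ ∑ i, coordSmulRight i (f y (Module.finBasis ℝ E i)) :=
    funext fun y ↦ clm_eq_sum (f y)
  rw [this]
  exact DifferentiableAt.fun_sum fun i _ ↦
    (coordSmulRight (F := F) i).differentiableAt.comp x (h _)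

variable {n : ℕ} {M : Type u} [TopologicalSpace M] [ChartedSpace (EuclideanSpace ℝ (Fin n)) M]

theorem contMDiffAt_clm_of_forall {f : M → E →L[ℝ] F} {x : M} {k : WithTop ℕ∞}
    (h : ∀ v, ContMDiffAt (𝓡 n) 𝓘(ℝ, F) k (fun y ↦ f y v) x) :
    ContMDiffAt (𝓡 n) 𝓘(ℝ, E →L[ℝ] F) k f x := by
  have : f = fun y ↦ ∑ i, coordSmulRight i (f y (Module.finBasis ℝ E i)) :=
    funext fun y ↦ clm_eq_sum (f y)
  rw [this]
  exact contMDiffAt_finsetSum fun i _ ↦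
    (coordSmulRight i).contDiff.contMDiff.contMDiffAt.comp x (h _)

theorem mdifferentiableAt_clm_of_forall {f : M → E →L[ℝ] F} {x : M}
    (h : ∀ v, MDifferentiableAt (𝓡 n) 𝓘(ℝ, F) (fun y ↦ f y v) x) :
    MDifferentiableAt (𝓡 n) 𝓘(ℝ, E →L[ℝ] F) f x := by
  have : f = fun y ↦ ∑ i, coordSmulRight i (f y (Module.finBasis ℝ E i)) :=
    funext fun y ↦ clm_eq_sum (f y)
  rw [this]
  have key : ∀ s : Finset (Fin (Module.finrank ℝ E)), MDifferentiableAt (𝓡 n) 𝓘(ℝ, E →L[ℝ] F)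
      (fun y ↦ ∑ i ∈ s, coordSmulRight i (f y (Module.finBasis ℝ E i))) x := by
    intro s
    induction s using Finset.cons_induction with
    | empty => simpa using mdifferentiableAt_const
    | cons i s hi ih =>
      simp only [Finset.sum_cons]
      exact ((coordSmulRight (F := F) i).mdifferentiableAt.comp x (h _)).add ih
  exact key _

variable {φ : OpenPartialHomeomorph M (EuclideanSpace ℝ (Fin n))}

theorem contMDiffAt_iff_of_chart (hφ : φ ∈ IsManifold.maximalAtlas (𝓡 n) ω M) {g : M → F} {x : M}
    (hx : x ∈ φ.source) :
    ContMDiffAt (𝓡 n) 𝓘(ℝ, F) ω g x ↔ ContDiffAt ℝ ω (fun y ↦ g (φ.symm y)) (φ x) := by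
  have h1 := contMDiffAt_of_mem_maximalAtlas hφ hx
  have h2 := contMDiffAt_symm_of_mem_maximalAtlas hφ (φ.map_source hx)
  refine ⟨fun h ↦ ?_, fun h ↦ ?_⟩
  · rw [← contMDiffAt_iff_contDiffAt]
    rw [← φ.left_inv hx] at h
    exact h.comp _ h2
  · have h3 := ContMDiffAt.comp x h.contMDiffAt h1
    refine h3.congr_of_eventuallyEq ?_
    filter_upwards [φ.open_source.mem_nhds hx] with z hz
    simp [φ.left_inv hz]

theorem mdifferentiableAt_iff_of_chart (hφ : φ ∈ IsManifold.maximalAtlas (𝓡 n) ω M) {g : M → F}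
    {x : M} (hx : x ∈ φ.source) :
    MDifferentiableAt (𝓡 n) 𝓘(ℝ, F) g x ↔ DifferentiableAt ℝ (fun y ↦ g (φ.symm y)) (φ x) := by
  have h1 := (contMDiffAt_of_mem_maximalAtlas hφ hx).mdifferentiableAt (by simp)
  have h2 := (contMDiffAt_symm_of_mem_maximalAtlas hφ (φ.map_source hx)).mdifferentiableAt (by simp)
  refine ⟨fun h ↦ ?_, fun h ↦ ?_⟩
  · rw [← mdifferentiableAt_iff_differentiableAt]
    rw [← φ.left_inv hx] at h
    exact h.comp _ h2
  · have h3 := MDifferentiableAt.comp x h.mdifferentiableAt h1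
    refine h3.congr_of_eventuallyEq ?_
    filter_upwards [φ.open_source.mem_nhds hx] with z hz
    simp [φ.left_inv hz]

end

/-! ### Analytic frames over a chart domain -/

section
variable {n : ℕ} {M : Type u} [TopologicalSpace M] [ChartedSpace (EuclideanSpace ℝ (Fin n)) M]
  (F : Type w) [NormedAddCommGroup F] [NormedSpace ℝ F]
  (V : M → Type v) [TopologicalSpace (TotalSpace F V)]
  [∀ x, AddCommGroup (V x)] [∀ x, Module ℝ (V x)] [∀ x, TopologicalSpace (V x)]
  [FiberBundle F V]

/-- An analytic frame of a vector bundle over the domain of a chart `φ`: linear isomorphisms of the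
fibres with `F` for which a section is differentiable or analytic at a point if and only if its
representative in the chart is. -/
structure ChartFrame (φ : OpenPartialHomeomorph M (EuclideanSpace ℝ (Fin n))) where
  /-- The coordinates of a vector. -/
  coord : ∀ x, V x →L[ℝ] F
  /-- The vector with given coordinates. -/
  frame : ∀ x, F →L[ℝ] V x
  coord_frame : ∀ x ∈ φ.source, ∀ v, coord x (frame x v) = v
  frame_coord : ∀ x ∈ φ.source, ∀ v, frame x (coord x v) = v
  diff_iff : ∀ x ∈ φ.source, ∀ σ : Π x, V x, DiffSectionAt n F σ x ↔
    DifferentiableAt ℝ (fun y ↦ coord (φ.symm y) (σ (φ.symm y))) (φ x)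
  analytic_iff : ∀ x ∈ φ.source, ∀ σ : Π x, V x,
    ContMDiffAt (𝓡 n) ((𝓡 n).prod 𝓘(ℝ, F)) ω (fun y ↦ TotalSpace.mk' F y (σ y)) x ↔
    ContDiffAt ℝ ω (fun y ↦ coord (φ.symm y) (σ (φ.symm y))) (φ x)

variable {F V}
/-- The representative of a section in a chart and a frame. -/
def ChartFrame.rep {φ : OpenPartialHomeomorph M (EuclideanSpace ℝ (Fin n))} (e : ChartFrame F V φ)
    (σ : Π x, V x) (y : EuclideanSpace ℝ (Fin n)) : F :=
  e.coord (φ.symm y) (σ (φ.symm y))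

theorem ChartFrame.rep_chart {φ : OpenPartialHomeomorph M (EuclideanSpace ℝ (Fin n))}
    (e : ChartFrame F V φ) (σ : Π x, V x) {x : M} (hx : x ∈ φ.source) :
    e.rep σ (φ x) = e.coord x (σ x) := by
  rw [ChartFrame.rep, φ.left_inv hx]

theorem ChartFrame.rep_frame {φ : OpenPartialHomeomorph M (EuclideanSpace ℝ (Fin n))}
    (e : ChartFrame F V φ) (f : M → F) {y : EuclideanSpace ℝ (Fin n)} (hy : y ∈ φ.target) :
    e.rep (fun x ↦ e.frame x (f x)) y = f (φ.symm y) :=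
  e.coord_frame _ (φ.map_target hy) _

theorem ChartFrame.rep_frame_const_eventuallyEq
    {φ : OpenPartialHomeomorph M (EuclideanSpace ℝ (Fin n))}
    (e : ChartFrame F V φ) (b : F) {x : M} (hx : x ∈ φ.source) :
    e.rep (fun x ↦ e.frame x b) =ᶠ[𝓝 (φ x)] fun _ ↦ b := by
  filter_upwards [φ.open_target.mem_nhds (φ.map_source hx)] with y hy
  exact e.rep_frame (fun _ ↦ b) hy

theorem ChartFrame.analytic_frame {φ : OpenPartialHomeomorph M (EuclideanSpace ℝ (Fin n))}
    (e : ChartFrame F V φ) (b : F) {x : M} (hx : x ∈ φ.source) :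
    ContMDiffAt (𝓡 n) ((𝓡 n).prod 𝓘(ℝ, F)) ω (fun y ↦ TotalSpace.mk' F y (e.frame y b)) x :=
  (e.analytic_iff x hx _).2
    (contDiffAt_const.congr_of_eventuallyEq (e.rep_frame_const_eventuallyEq b hx))

theorem ChartFrame.diff_frame {φ : OpenPartialHomeomorph M (EuclideanSpace ℝ (Fin n))}
    (e : ChartFrame F V φ) (b : F) {x : M} (hx : x ∈ φ.source) :
    DiffSectionAt n F (fun y ↦ e.frame y b) x :=
  (e.analytic_frame b hx).mdifferentiableAt (by simp)

variable [IsManifold (𝓡 n) ω M] {φ : OpenPartialHomeomorph M (EuclideanSpace ℝ (Fin n))}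

theorem mdifferentiableAt_vectorField_iff
    {W : Π x : EuclideanSpace ℝ (Fin n), TangentSpace (𝓡 n) x} {x : EuclideanSpace ℝ (Fin n)} :
    MDifferentiableAt (𝓡 n) ((𝓡 n).prod (𝓡 n))
      (fun y ↦ TotalSpace.mk' (EuclideanSpace ℝ (Fin n)) (E := (TangentSpace (𝓡 n))) y (W y)) x ↔
    DifferentiableAt ℝ (fun y ↦ (W y : EuclideanSpace ℝ (Fin n))) x := by
  rw [mdifferentiableAt_section]
  have : (fun y ↦ ((trivializationAt (EuclideanSpace ℝ (Fin n)) (TangentSpace (𝓡 n)) x)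
      ⟨y, W y⟩).2) = fun y ↦ (W y : EuclideanSpace ℝ (Fin n)) := by
    ext y
    rw [trivializationAt_model_space_apply]
  rw [this]
  exact mdifferentiableAt_iff_differentiableAt

open VectorField in
/-- The coordinate frame of the tangent bundle. -/
noncomputable def tangentFrame (hφ : φ ∈ IsManifold.maximalAtlas (𝓡 n) ω M) :
    ChartFrame (EuclideanSpace ℝ (Fin n)) (TangentSpace (𝓡 n) : M → Type) φ :=
  have : IsManifold (𝓡 n) 1 M := inferInstance
  have : IsManifold (𝓡 n) 2 M := IsManifold.of_le (n := ω) le_top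
  have hd : φ.MDifferentiable (𝓡 n) (𝓡 n) :=
    ⟨(contMDiffOn_of_mem_maximalAtlas hφ).mdifferentiableOn (by simp),
      (contMDiffOn_symm_of_mem_maximalAtlas hφ).mdifferentiableOn (by simp)⟩
  have h1 : ∀ x ∈ φ.source, (mfderiv (𝓡 n) (𝓡 n) φ x).IsInvertible := fun x hx ↦
    ⟨hd.mfderiv hx, rfl⟩
  have h2 : ∀ y ∈ φ.target, (mfderiv (𝓡 n) (𝓡 n) φ.symm y).IsInvertible := fun x hx ↦
    ⟨hd.symm.mfderiv hx, rfl⟩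
  have h3 : ∀ y ∈ φ.target, (mfderiv (𝓡 n) (𝓡 n) φ.symm y).inverse =
    mfderiv (𝓡 n) (𝓡 n) φ (φ.symm y) := fun y hy ↦
      ContinuousLinearMap.inverse_eq
        (by have := hd.symm_comp_deriv (φ.map_target hy); rwa [φ.right_inv hy] at this)
        (hd.comp_symm_deriv hy)
  have h4 : ∀ x ∈ φ.source, (mfderiv (𝓡 n) (𝓡 n) φ x).inverse =
    mfderiv (𝓡 n) (𝓡 n) φ.symm (φ x) := fun x hx ↦
      ContinuousLinearMap.inverse_eq
        (by have := hd.comp_symm_deriv (φ.map_source hx); rwa [φ.left_inv hx] at this)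
        (hd.symm_comp_deriv hx)
  -- Near `φ x` the coordinate representative is the pullback of the vector field by `φ.symm`, and
  -- pulling back again by `φ` recovers the field. Both directions of the two equivalences thus
  -- follow from the regularity of pullbacks.
  have h5 : ∀ σ : Π x : M, TangentSpace (𝓡 n) x, ∀ x ∈ φ.source,
      mpullback (𝓡 n) (𝓡 n) φ.symm σ =ᶠ[𝓝 (φ x)]
        fun y ↦ mfderiv (𝓡 n) (𝓡 n) φ (φ.symm y) (σ (φ.symm y)) := fun σ x hx ↦ by
    filter_upwards [φ.open_target.mem_nhds (φ.map_source hx)] with y hy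
    exact DFunLike.congr_fun (h3 y hy) (σ (φ.symm y))
  have h6 : ∀ σ : Π x : M, TangentSpace (𝓡 n) x, ∀ x ∈ φ.source,
      ∀ᶠ z in 𝓝 x, σ z = mpullback (𝓡 n) (𝓡 n) φ
        (fun y ↦ mfderiv (𝓡 n) (𝓡 n) φ (φ.symm y) (σ (φ.symm y))) z := fun σ x hx ↦ by
    filter_upwards [φ.open_source.mem_nhds hx] with z hz
    -- The vectors `σ (φ.symm (φ z))` and `σ z` lie in different fibres, so the comparison is made
    -- in the model space.
    have h7 : ∀ z', z' = z → (mfderiv (𝓡 n) (𝓡 n) φ z' (σ z') : EuclideanSpace ℝ (Fin n)) =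
      mfderiv (𝓡 n) (𝓡 n) φ z (σ z) := by rintro _ rfl; rfl
    refine Eq.trans ?_ (congrArg (mfderiv (𝓡 n) (𝓡 n) φ z).inverse (h7 (φ.symm (φ z)) (φ.left_inv hz))).symm
    rw [h4 z hz]
    exact (DFunLike.congr_fun (hd.symm_comp_deriv hz) (σ z)).symm
  { coord x := mfderiv (𝓡 n) (𝓡 n) φ x
    frame x := mfderiv (𝓡 n) (𝓡 n) φ.symm (φ x)
    coord_frame x hx v := by
      have := hd.comp_symm_deriv (φ.map_source hx)
      rw [φ.left_inv hx] at this
      exact DFunLike.congr_fun this v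
    frame_coord x hx v := DFunLike.congr_fun (hd.symm_comp_deriv hx) v
    diff_iff x hx σ := by
      refine ⟨fun h ↦ ?_, fun h ↦ ?_⟩
      · have h' := h
        rw [DiffSectionAt, ← φ.left_inv hx] at h'
        have h7 := MDifferentiableAt.mpullback_vectorField h'
          (contMDiffAt_symm_of_mem_maximalAtlas hφ (φ.map_source hx)) (h2 _ (φ.map_source hx))
          le_top
        exact (mdifferentiableAt_vectorField_iff.1 h7).congr_of_eventuallyEq (h5 σ x hx).symm
      · have h8 := mdifferentiableAt_vectorField_iff.2 h
        have h7 := MDifferentiableAt.mpullback_vectorField h8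
          (contMDiffAt_of_mem_maximalAtlas hφ hx) (h1 _ hx) le_top
        refine h7.congr_of_eventuallyEq ?_
        filter_upwards [h6 σ x hx] with y hy
        exact congrArg (TotalSpace.mk' _ y) hy
    analytic_iff x hx σ := by
      refine ⟨fun h ↦ ?_, fun h ↦ ?_⟩
      · rw [← φ.left_inv hx] at h
        have h7 := ContMDiffAt.mpullback_vectorField_preimage h
          (contMDiffAt_symm_of_mem_maximalAtlas hφ (φ.map_source hx)) (h2 _ (φ.map_source hx))
          le_top
        rw [contMDiffAt_vectorSpace_iff_contDiffAt] at h7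
        exact h7.congr_of_eventuallyEq (h5 σ x hx).symm
      · have h8 := contMDiffAt_vectorSpace_iff_contDiffAt.2 h
        have h7 := ContMDiffAt.mpullback_vectorField_preimage h8
          (contMDiffAt_of_mem_maximalAtlas hφ hx) (h1 _ hx) le_top
        refine h7.congr_of_eventuallyEq ?_
        filter_upwards [h6 σ x hx] with y hy
        exact congrArg (TotalSpace.mk' _ y) hy }
end

section
variable {n : ℕ} {M : Type u} [TopologicalSpace M] [ChartedSpace (EuclideanSpace ℝ (Fin n)) M]
  [IsManifold (𝓡 n) ω M]
  {F : Type w} [NormedAddCommGroup F] [NormedSpace ℝ F]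
  {V : M → Type v} [TopologicalSpace (TotalSpace F V)]
  [∀ x, AddCommGroup (V x)] [∀ x, Module ℝ (V x)] [∀ x, TopologicalSpace (V x)]
  [∀ x, IsTopologicalAddGroup (V x)] [∀ x, ContinuousSMul ℝ (V x)]
  [FiberBundle F V] [VectorBundle ℝ F V]
  {φ : OpenPartialHomeomorph M (EuclideanSpace ℝ (Fin n))}

/-- The frame of `Hom(TM, V)` induced by a frame of `V`. -/
noncomputable def homFrame (hφ : φ ∈ IsManifold.maximalAtlas (𝓡 n) ω M) (e : ChartFrame F V φ) :
    ChartFrame (EuclideanSpace ℝ (Fin n) →L[ℝ] F) (fun x : M ↦ TangentSpace (𝓡 n) x →L[ℝ] V x) φ :=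
  let t := tangentFrame hφ
  have h0 : ∀ x ∈ φ.source, ∀ᶠ y in 𝓝 (φ x), φ.symm y ∈ φ.source := fun x hx ↦ by
    filter_upwards [φ.open_target.mem_nhds (φ.map_source hx)] with y hy using φ.map_target hy
  have h1 : ∀ x : M, ∀ v, (fun z ↦ ((trivializationAt (EuclideanSpace ℝ (Fin n)) (TangentSpace (𝓡 n))
      x) ⟨z, (trivializationAt (EuclideanSpace ℝ (Fin n)) (TangentSpace (𝓡 n)) x).symmL ℝ z v⟩).2)
      =ᶠ[𝓝 x] fun _ ↦ v := fun x v ↦ by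
    filter_upwards [(trivializationAt (EuclideanSpace ℝ (Fin n)) (TangentSpace (𝓡 n))
      x).open_baseSet.mem_nhds (FiberBundle.mem_baseSet_trivializationAt' x)] with z hz
    rw [Trivialization.symmL_apply _ hz, Trivialization.apply_mk_symm _ hz]
  have h2 : ∀ (A : Π x : M, TangentSpace (𝓡 n) x →L[ℝ] V x) (x : M) (v),
      (fun z ↦ ContinuousLinearMap.inCoordinates (EuclideanSpace ℝ (Fin n)) (TangentSpace (𝓡 n))
        F V x z x z (A z) v) =ᶠ[𝓝 x] fun z ↦ ((trivializationAt F V x) ⟨z, A z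
        ((trivializationAt (EuclideanSpace ℝ (Fin n)) (TangentSpace (𝓡 n)) x).symmL ℝ z v)⟩).2 :=
    fun A x v ↦ by
    filter_upwards [(trivializationAt F V x).open_baseSet.mem_nhds
      (FiberBundle.mem_baseSet_trivializationAt' x)] with z hz
    simp [ContinuousLinearMap.inCoordinates, Trivialization.continuousLinearMapAt_apply,
      Trivialization.coe_linearMapAt_of_mem _ hz]
  have h3 : ∀ (A : Π x : M, TangentSpace (𝓡 n) x →L[ℝ] V x) (Y : Π x : M, TangentSpace (𝓡 n) x),
      ∀ x ∈ φ.source, e.rep (fun z ↦ A z (Y z)) =ᶠ[𝓝 (φ x)] fun y ↦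
        (e.coord (φ.symm y) ∘L A (φ.symm y) ∘L t.frame (φ.symm y)) (t.rep Y y) := fun A Y x hx ↦ by
    filter_upwards [h0 x hx] with y hy
    simp [ChartFrame.rep, t.frame_coord _ hy]
  { coord x := (ContinuousLinearMap.postcomp (EuclideanSpace ℝ (Fin n)) (e.coord x)).comp
      (ContinuousLinearMap.precomp (V x) (t.frame x))
    frame x := (ContinuousLinearMap.postcomp (TangentSpace (𝓡 n) x) (e.frame x)).comp
      (ContinuousLinearMap.precomp F (t.coord x))
    coord_frame x hx B := by
      ext1 v
      simp [e.coord_frame x hx, t.coord_frame x hx]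
    frame_coord x hx B := by
      ext v
      simp [e.frame_coord x hx, t.frame_coord x hx]
    diff_iff x hx A := by
      -- Forwards, `A` is applied to the coordinate frame fields. Backwards, `A` is tested in the
      -- preferred trivializations on fields `Y` that are constant there; in frame coordinates `A Y`
      -- is the product of the representatives of `A` and `Y`.
      refine ⟨fun h ↦ differentiableAt_clm_iff.2 fun v ↦ ?_, fun h ↦
        (mdifferentiableAt_hom_bundle _).2 ⟨mdifferentiableAt_id,
          mdifferentiableAt_clm_of_forall fun v ↦ ?_⟩⟩
      · exact (e.diff_iff x hx _).1 (diffSectionAt_apply h (t.diff_frame v hx))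
      · let Y z := (trivializationAt (EuclideanSpace ℝ (Fin n)) (TangentSpace (𝓡 n)) x).symmL ℝ z v
        have hY : DiffSectionAt n (EuclideanSpace ℝ (Fin n)) Y x :=
          (mdifferentiableAt_section _ _).2 (mdifferentiableAt_const.congr_of_eventuallyEq (h1 x v))
        refine MDifferentiableAt.congr_of_eventuallyEq ?_ (h2 A x v)
        refine (mdifferentiableAt_section _ _).1 ((e.diff_iff x hx _).2 ?_)
        exact (DifferentiableAt.clm_apply h ((t.diff_iff x hx Y).1 hY)).congr_of_eventuallyEq
          (h3 A Y x hx)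
    analytic_iff x hx A := by
      refine ⟨fun h ↦ contDiffAt_clm_iff.2 fun v ↦ ?_, fun h ↦
        (contMDiffAt_hom_bundle _).2 ⟨contMDiffAt_id,
          contMDiffAt_clm_of_forall fun v ↦ ?_⟩⟩
      · exact (e.analytic_iff x hx _).1 (ContMDiffAt.clm_bundle_apply
          (F₁ := EuclideanSpace ℝ (Fin n)) (F₂ := F) h (t.analytic_frame v hx))
      · let Y z := (trivializationAt (EuclideanSpace ℝ (Fin n)) (TangentSpace (𝓡 n)) x).symmL ℝ z v
        have hY : ContMDiffAt (𝓡 n) ((𝓡 n).prod (𝓡 n)) ω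
            (fun z ↦ TotalSpace.mk' (EuclideanSpace ℝ (Fin n)) z (Y z)) x :=
          (contMDiffAt_section _).2 (contMDiffAt_const.congr_of_eventuallyEq (h1 x v))
        refine ContMDiffAt.congr_of_eventuallyEq ?_ (h2 A x v)
        refine (contMDiffAt_section _).1 ((e.analytic_iff x hx _).2 ?_)
        exact (ContDiffAt.clm_apply h ((t.analytic_iff x hx Y).1 hY)).congr_of_eventuallyEq
          (h3 A Y x hx) }

theorem rep_homFrame (hφ : φ ∈ IsManifold.maximalAtlas (𝓡 n) ω M) (e : ChartFrame F V φ)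
    (A : Π x : M, TangentSpace (𝓡 n) x →L[ℝ] V x) (y v : EuclideanSpace ℝ (Fin n)) :
    (homFrame hφ e).rep A y v =
      e.coord (φ.symm y) (A (φ.symm y) ((tangentFrame hφ).frame (φ.symm y) v)) := rfl

theorem coord_homFrame (hφ : φ ∈ IsManifold.maximalAtlas (𝓡 n) ω M) (e : ChartFrame F V φ)
    {x : M} (A : TangentSpace (𝓡 n) x →L[ℝ] V x) (v : EuclideanSpace ℝ (Fin n)) :
    (homFrame hφ e).coord x A v = e.coord x (A ((tangentFrame hφ).frame x v)) := rfl
end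

section
variable {n k : ℕ} {M : Type u} [TopologicalSpace M] [ChartedSpace (EuclideanSpace ℝ (Fin n)) M]
  [IsManifold (𝓡 n) ω M]
  {V : M → Type v} [TopologicalSpace (TotalSpace (EuclideanSpace ℝ (Fin k)) V)]
  [∀ x, AddCommGroup (V x)] [∀ x, Module ℝ (V x)] [∀ x, TopologicalSpace (V x)]
  [∀ x, IsTopologicalAddGroup (V x)] [∀ x, ContinuousSMul ℝ (V x)]
  [FiberBundle (EuclideanSpace ℝ (Fin k)) V] [VectorBundle ℝ (EuclideanSpace ℝ (Fin k)) V]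

/-- The frame defined by a vector bundle chart. -/
noncomputable def VectorBundleChart.chartFrame (ψ : VectorBundleChart n k V) :
    ChartFrame (EuclideanSpace ℝ (Fin k)) V ψ.baseChart :=
  have : ψ.triv.IsLinear ℝ := ψ.isLinear
  have h0 : ∀ x ∈ ψ.baseChart.source, x ∈ ψ.triv.baseSet := fun x hx ↦ ψ.baseSet_eq ▸ hx
  have h1 : ∀ x ∈ ψ.baseChart.source, ∀ v : V x, ψ.triv.continuousLinearMapAt ℝ x v =
      (ψ.triv ⟨x, v⟩).2 := fun x hx v ↦ by
    rw [Trivialization.continuousLinearMapAt_apply, Trivialization.coe_linearMapAt_of_mem _ (h0 x hx)]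
  have h2 : ∀ x ∈ ψ.baseChart.source, ∀ σ : Π x, V x,
      (fun z ↦ TotalSpace.mk' (EuclideanSpace ℝ (Fin k)) z (σ z)) =ᶠ[𝓝 x] fun z ↦
        ψ.triv.toOpenPartialHomeomorph.symm (z, ψ.triv.continuousLinearMapAt ℝ z (σ z)) :=
    fun x hx σ ↦ by
    filter_upwards [ψ.baseChart.open_source.mem_nhds hx] with z hz
    rw [h1 z hz]
    have : TotalSpace.mk' (EuclideanSpace ℝ (Fin k)) z (σ z) ∈ ψ.triv.source :=
      ψ.triv.mem_source.2 (h0 z hz)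
    exact (ψ.triv.symm_apply_mk_proj this).symm
  have h3 : ∀ x ∈ ψ.baseChart.source, ∀ σ : Π x, V x,
      (fun z ↦ ψ.triv.continuousLinearMapAt ℝ z (σ z)) =ᶠ[𝓝 x] fun z ↦ (ψ.triv ⟨z, σ z⟩).2 :=
    fun x hx σ ↦ by
    filter_upwards [ψ.baseChart.open_source.mem_nhds hx] with z hz
    rw [h1 z hz]
  { coord x := ψ.triv.continuousLinearMapAt ℝ x
    frame x := ψ.triv.symmL ℝ x
    coord_frame x hx v := Trivialization.continuousLinearMapAt_symmL _ (h0 x hx) v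
    frame_coord x hx v := Trivialization.symmL_continuousLinearMapAt _ (h0 x hx) v
    diff_iff x hx σ := by
      rw [← mdifferentiableAt_iff_of_chart (g := fun z ↦ ψ.triv.continuousLinearMapAt ℝ z (σ z))
        ψ.baseChart_mem hx]
      refine ⟨fun h ↦ ?_, fun h ↦ ?_⟩
      · have h4 := (ψ.analyticOn.contMDiffAt (ψ.triv.open_source.mem_nhds
          (x := TotalSpace.mk' (EuclideanSpace ℝ (Fin k)) x (σ x))
          (ψ.triv.mem_source.2 (h0 x hx)))).mdifferentiableAt (by simp)
        exact ((MDifferentiableAt.comp x h4 h).snd).congr_of_eventuallyEq (h3 x hx σ)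
      · have h4 := (ψ.analyticOn_symm.contMDiffAt (ψ.triv.open_target.mem_nhds
          (x := (x, ψ.triv.continuousLinearMapAt ℝ x (σ x)))
          (ψ.triv.mem_target.2 (h0 x hx)))).mdifferentiableAt (by simp)
        exact (MDifferentiableAt.comp x h4 (mdifferentiableAt_id.prodMk h)).congr_of_eventuallyEq
          (h2 x hx σ)
    analytic_iff x hx σ := by
      rw [← contMDiffAt_iff_of_chart (g := fun z ↦ ψ.triv.continuousLinearMapAt ℝ z (σ z))
        ψ.baseChart_mem hx]
      refine ⟨fun h ↦ ?_, fun h ↦ ?_⟩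
      · have h4 := (ψ.analyticOn.contMDiffAt (ψ.triv.open_source.mem_nhds
          (x := TotalSpace.mk' (EuclideanSpace ℝ (Fin k)) x (σ x))
          (ψ.triv.mem_source.2 (h0 x hx))))
        exact ((ContMDiffAt.comp x h4 h).snd).congr_of_eventuallyEq (h3 x hx σ)
      · have h4 := (ψ.analyticOn_symm.contMDiffAt (ψ.triv.open_target.mem_nhds
          (x := (x, ψ.triv.continuousLinearMapAt ℝ x (σ x)))
          (ψ.triv.mem_target.2 (h0 x hx))))
        exact (ContMDiffAt.comp x h4 (contMDiffAt_id.prodMk h)).congr_of_eventuallyEq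
          (h2 x hx σ) }

theorem VectorBundleChart.pushforward_eq_rep (ψ : VectorBundleChart n k V)
    (ξ : AnalyticSection n k V) {y : EuclideanSpace ℝ (Fin n)} (hy : y ∈ ψ.baseChart.target) :
    ψ.pushforward ξ y = ψ.chartFrame.rep ξ y := by
  have : ψ.triv.IsLinear ℝ := ψ.isLinear
  have h : ψ.baseChart.symm y ∈ ψ.triv.baseSet := ψ.baseSet_eq ▸ ψ.baseChart.map_target hy
  change _ = ψ.triv.continuousLinearMapAt ℝ _ _
  rw [Trivialization.continuousLinearMapAt_apply, Trivialization.coe_linearMapAt_of_mem _ h]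
  rfl
end

/-! ### Connection forms -/

section
variable {n : ℕ} {M : Type u} [TopologicalSpace M] [ChartedSpace (EuclideanSpace ℝ (Fin n)) M]
  [IsManifold (𝓡 n) ω M]
  {F : Type w} [NormedAddCommGroup F] [NormedSpace ℝ F]
  {V : M → Type v} [TopologicalSpace (TotalSpace F V)]
  [∀ x, AddCommGroup (V x)] [∀ x, Module ℝ (V x)] [∀ x, TopologicalSpace (V x)]
  [∀ x, IsTopologicalAddGroup (V x)] [∀ x, ContinuousSMul ℝ (V x)]
  [FiberBundle F V] [VectorBundle ℝ F V]
  {φ : OpenPartialHomeomorph M (EuclideanSpace ℝ (Fin n))}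

/-- `A` is the connection form of `D` in the frame `e`: it is analytic, and the representative
of `∇_v ξ` is `∂_v f + A(v) f`, where `f` is the representative of `ξ`. -/
structure IsConnectionForm (hφ : φ ∈ IsManifold.maximalAtlas (𝓡 n) ω M) (e : ChartFrame F V φ)
    (D : CovariantDerivative (𝓡 n) F V)
    (A : EuclideanSpace ℝ (Fin n) → EuclideanSpace ℝ (Fin n) →L[ℝ] F →L[ℝ] F) : Prop where
  analytic : ∀ y ∈ φ.target, ContDiffAt ℝ ω A y
  coord_apply : ∀ ξ : Π x, V x, ∀ x ∈ φ.source, DiffSectionAt n F ξ x → ∀ v,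
    e.coord x (D ξ x ((tangentFrame hφ).frame x v)) =
      fderiv ℝ (e.rep ξ) (φ x) v + A (φ x) v (e.rep ξ (φ x))

theorem covariantDerivative_sum (D : CovariantDerivative (𝓡 n) F V) {ι : Type*} (s : Finset ι)
    {τ : ι → Π x, V x} {x : M} (h : ∀ i ∈ s, DiffSectionAt n F (τ i) x) :
    DiffSectionAt n F (∑ i ∈ s, τ i) x ∧ D (∑ i ∈ s, τ i) x = ∑ i ∈ s, D (τ i) x := by
  induction s using Finset.cons_induction with
  | empty =>
    simp only [Finset.sum_empty]
    exact ⟨mdifferentiableAt_zeroSection .., D.isCovariantDerivativeOnUniv.zero⟩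
  | cons i s hi ih =>
    obtain ⟨h1, h2⟩ := ih fun j hj ↦ h j (Finset.mem_cons_of_mem hj)
    have h3 := h i (Finset.mem_cons_self i s)
    simp only [Finset.sum_cons]
    refine ⟨mdifferentiableAt_add_section h3 h1, ?_⟩
    rw [D.isCovariantDerivativeOnUniv.add h3 h1, h2]

theorem mvfderiv_frame (hφ : φ ∈ IsManifold.maximalAtlas (𝓡 n) ω M) {g : M → ℝ} {x : M}
    (hx : x ∈ φ.source) (hg : MDifferentiableAt (𝓡 n) 𝓘(ℝ, ℝ) g x) (v : EuclideanSpace ℝ (Fin n)) :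
    mvfderiv (𝓡 n) g x ((tangentFrame hφ).frame x v) =
      fderiv ℝ (fun y ↦ g (φ.symm y)) (φ x) v := by
  have h2 := (contMDiffAt_symm_of_mem_maximalAtlas hφ (φ.map_source hx)).mdifferentiableAt
    (by simp)
  rw [← φ.left_inv hx] at hg
  have h3 := mfderiv_comp (φ x) hg h2
  have h4 := DFunLike.congr_fun h3 v
  rw [mfderiv_eq_fderiv] at h4
  have h5 : ∀ z, z = x → (mfderiv (𝓡 n) 𝓘(ℝ, ℝ) g z : EuclideanSpace ℝ (Fin n) → ℝ) =
    mfderiv (𝓡 n) 𝓘(ℝ, ℝ) g x := by rintro _ rfl; rfl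
  exact (h4.trans (congrFun (h5 (φ.symm (φ x)) (φ.left_inv hx)) _)).symm

variable [FiniteDimensional ℝ F]

/-- Writing `ξ = ∑ g_i τ_i` in the frame fields, the Leibniz rule gives `∇_v ξ = ∑ dg_i(v) τ_i + g_i
∇_v τ_i`. The first part is the derivative of the representative; the second defines `A(v) u = ∑ u_i
∇_v τ_i`, which is analytic because the connection preserves analyticity. -/
theorem exists_isConnectionForm (hφ : φ ∈ IsManifold.maximalAtlas (𝓡 n) ω M)
    (e : ChartFrame F V φ) {D : CovariantDerivative (𝓡 n) F V} (hD : IsAnalyticConnection D) :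
    ∃ A, IsConnectionForm hφ e D A := by
  let b := Module.finBasis ℝ F
  let τ (i) (x : M) : V x := e.frame x (b i)
  refine ⟨fun y ↦ ∑ i, (coordSmulRight (E := F) (F := F) i) ∘L
    ((homFrame hφ e).rep (D (τ i)) y), fun y hy ↦ ?_, fun ξ x hx hξ v ↦ ?_⟩
  · refine ContDiffAt.sum fun i _ ↦ ?_
    -- The extra derivative demanded of the argument is free, since `ω + 1` is `ω`.
    have h1 : ContMDiffOn (𝓡 n) ((𝓡 n).prod 𝓘(ℝ, F)) (ω + 1)
        (fun x ↦ TotalSpace.mk' F x (τ i x)) φ.source := fun x hx ↦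
      (e.analytic_frame (b i) hx).contMDiffWithinAt
    have h2 := (hD φ.source φ.open_source).contMDiff h1
    have h3 := h2.contMDiffAt (φ.open_source.mem_nhds (φ.map_target hy))
    have h4 := ((homFrame hφ e).analytic_iff _ (φ.map_target hy) _).1 h3
    rw [φ.right_inv hy] at h4
    exact contDiffAt_const.clm_comp h4
  · let g (i) (x : M) : ℝ := b.coord i (e.coord x (ξ x))
    let L (i) : F →L[ℝ] ℝ := LinearMap.toContinuousLinearMap (b.coord i)
    have hr : DifferentiableAt ℝ (e.rep ξ) (φ x) := (e.diff_iff x hx ξ).1 hξ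
    have hg : ∀ i, MDifferentiableAt (𝓡 n) 𝓘(ℝ, ℝ) (g i) x := fun i ↦
      (mdifferentiableAt_iff_of_chart hφ hx).2 ((L i).differentiableAt.comp (φ x) hr)
    have hgτ : ∀ i, DiffSectionAt n F (g i • τ i) x := fun i ↦
      (hg i).smul_section (e.diff_frame (b i) hx)
    -- The expansion in the frame holds only over the chart domain; a connection is local, so this
    -- suffices.
    have hsum : ∀ᶠ z in 𝓝 x, ξ z = (∑ i, g i • τ i) z := by
      filter_upwards [φ.open_source.mem_nhds hx] with z hz
      rw [Finset.sum_apply]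
      conv_lhs => rw [← e.frame_coord z hz (ξ z), ← b.sum_repr (e.coord z (ξ z)), map_sum]
      simp [g, τ]
    obtain ⟨h1, h2⟩ := covariantDerivative_sum D Finset.univ fun i _ ↦ hgτ i
    have h3 : D ξ x = D (∑ i, g i • τ i) x :=
      D.isCovariantDerivativeOnUniv.congr_of_eventuallyEq hξ h1 univ_mem hsum
    have h4 : ∀ i, D (g i • τ i) x = g i x • D (τ i) x + (mvfderiv (𝓡 n) (g i) x).smulRight (τ i x) :=
      fun i ↦ D.isCovariantDerivativeOnUniv.leibniz (e.diff_frame (b i) hx) (hg i)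
    rw [h3, h2]
    simp only [h4]
    have h5 : ∀ i, mvfderiv (𝓡 n) (g i) x ((tangentFrame hφ).frame x v) =
        L i (fderiv ℝ (e.rep ξ) (φ x) v) := fun i ↦ by
      rw [mvfderiv_frame hφ hx (hg i)]
      exact DFunLike.congr_fun (((L i).hasFDerivAt.comp (φ x) hr.hasFDerivAt).fderiv) v
    have h6 : ∀ i, (homFrame hφ e).rep (D (τ i)) (φ x) v =
        e.coord x (D (τ i) x ((tangentFrame hφ).frame x v)) := fun i ↦ by
      rw [(homFrame hφ e).rep_chart _ hx, coord_homFrame]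
    have h7 : fderiv ℝ (e.rep ξ) (φ x) v = ∑ i, L i (fderiv ℝ (e.rep ξ) (φ x) v) • b i :=
      (b.sum_repr _).symm
    have h8 : ∀ i (u w : F), coordSmulRight (E := F) i w u = b.coord i u • w := fun i u w ↦ rfl
    conv_rhs => rw [h7]
    simp only [_root_.sum_apply, map_sum, ContinuousLinearMap.coe_comp,
      Function.comp_apply, h6, h8, e.rep_chart ξ hx]
    rw [← Finset.sum_add_distrib]
    refine Finset.sum_congr rfl fun i _ ↦ ?_
    simp only [_root_.add_apply, _root_.smul_apply, ContinuousLinearMap.smulRight_apply, h5, map_add,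
      map_smul, τ, e.coord_frame x hx]
    rw [add_comm]
end

/-! ### The induced connection on Hom in coordinates -/

section
variable {E F : Type} [NormedAddCommGroup E] [NormedSpace ℝ E]
  [NormedAddCommGroup F] [NormedSpace ℝ F]

/-- The connection form on `Hom(E, F)` induced by connection forms on `E` and `F`. -/
noncomputable def homForm (Γ : E → E →L[ℝ] E →L[ℝ] E) (A : E → E →L[ℝ] F →L[ℝ] F) (y : E) :
    E →L[ℝ] (E →L[ℝ] F) →L[ℝ] (E →L[ℝ] F) :=
  (ContinuousLinearMap.compL ℝ E F F) ∘L A y - (ContinuousLinearMap.compL ℝ E E F).flip ∘L Γ y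

theorem homForm_apply (Γ : E → E →L[ℝ] E →L[ℝ] E) (A : E → E →L[ℝ] F →L[ℝ] F) (y v w : E)
    (B : E →L[ℝ] F) : homForm Γ A y v B w = A y v (B w) - B (Γ y v w) := rfl

set_option maxSynthPendingDepth 3 in
theorem contDiffAt_homForm {Γ : E → E →L[ℝ] E →L[ℝ] E} {A : E → E →L[ℝ] F →L[ℝ] F} {y : E}
    (hΓ : ContDiffAt ℝ ω Γ y) (hA : ContDiffAt ℝ ω A y) : ContDiffAt ℝ ω (homForm Γ A) y :=
  (contDiffAt_const.clm_comp hA).sub (contDiffAt_const.clm_comp hΓ)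

/-- Differentiating the velocity argument of `B(y, v) v` along the spray contributes `-B (Γ(v, v))`,
which is the `Γ`-term of the induced form. So contraction with the velocity intertwines the
operators for `Hom(E, F)` and for `F`. -/
theorem sprayOp_apply_velocity (Γ : E → E →L[ℝ] E →L[ℝ] E) (A : E → E →L[ℝ] F →L[ℝ] F)
    {B : E × E → E →L[ℝ] F} {p : E × E} (hB : DifferentiableAt ℝ B p) :
    sprayOp Γ A (fun p ↦ B p p.2) p = sprayOp Γ (homForm Γ A) B p p.2 := by
  have h := (hB.hasFDerivAt.clm_apply hasFDerivAt_snd).fderiv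
  rw [sprayOp, h, sprayOp]
  simp [homForm_apply]
  abel

theorem iterate_sprayOp_apply_velocity {Ω : Set E} (hΩ : IsOpen Ω)
    {Γ : E → E →L[ℝ] E →L[ℝ] E} {A : E → E →L[ℝ] F →L[ℝ] F}
    (hΓ : ∀ y ∈ Ω, ContDiffAt ℝ ω Γ y) (hA : ∀ y ∈ Ω, ContDiffAt ℝ ω A y)
    {B : E × E → E →L[ℝ] F} (hB : ∀ p : E × E, p.1 ∈ Ω → ContDiffAt ℝ ω B p)
    {H : E × E → F} (hH : ∀ p : E × E, p.1 ∈ Ω → H p = B p p.2) (m : ℕ) {p : E × E}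
    (hp : p.1 ∈ Ω) :
    (sprayOp Γ A)^[m] H p = (sprayOp Γ (homForm Γ A))^[m] B p p.2 := by
  induction m generalizing p with
  | zero => exact hH p hp
  | succ m ih =>
    have h1 : (sprayOp Γ A)^[m] H =ᶠ[𝓝 p]
        fun p ↦ (sprayOp Γ (homForm Γ A))^[m] B p p.2 := by
      filter_upwards [(hΩ.preimage continuous_fst).mem_nhds hp] with q hq using ih hq
    rw [Function.iterate_succ_apply', Function.iterate_succ_apply', ← sprayOp_apply_velocity]
    · rw [sprayOp, h1.fderiv_eq, h1.eq_of_nhds]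
      rfl
    · exact (contDiffAt_iterate_sprayOp (hΓ _ hp) (contDiffAt_homForm (hΓ _ hp) (hA _ hp))
        (hB p hp) m).differentiableAt (by simp)

end

/-! ### Iterated covariant derivatives on the diagonal -/

section
variable {n : ℕ} {M : Type u} [TopologicalSpace M] [ChartedSpace (EuclideanSpace ℝ (Fin n)) M]
  [IsManifold (𝓡 n) ω M]
  {φ : OpenPartialHomeomorph M (EuclideanSpace ℝ (Fin n))}

theorem IsConnectionForm.analytic_rep {F : Type w} [NormedAddCommGroup F] [NormedSpace ℝ F]
    {V : M → Type v} [TopologicalSpace (TotalSpace F V)]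
    [∀ x, AddCommGroup (V x)] [∀ x, Module ℝ (V x)] [∀ x, TopologicalSpace (V x)]
    [∀ x, IsTopologicalAddGroup (V x)] [∀ x, ContinuousSMul ℝ (V x)]
    [FiberBundle F V] [VectorBundle ℝ F V]
    {hφ : φ ∈ IsManifold.maximalAtlas (𝓡 n) ω M} {e : ChartFrame F V φ}
    {D : CovariantDerivative (𝓡 n) F V}
    {A : EuclideanSpace ℝ (Fin n) → EuclideanSpace ℝ (Fin n) →L[ℝ] F →L[ℝ] F}
    (hA : IsConnectionForm hφ e D A) {ξ : Π x, V x}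
    (hξ : ∀ y ∈ φ.target, ContDiffAt ℝ ω (e.rep ξ) y) :
    (∀ y ∈ φ.target, ∀ v, (homFrame hφ e).rep (D ξ) y v =
      fderiv ℝ (e.rep ξ) y v + A y v (e.rep ξ y)) ∧
    ∀ y ∈ φ.target, ContDiffAt ℝ ω ((homFrame hφ e).rep (D ξ)) y := by
  have h1 : ∀ y ∈ φ.target, ∀ v, (homFrame hφ e).rep (D ξ) y v =
      fderiv ℝ (e.rep ξ) y v + A y v (e.rep ξ y) := fun y hy v ↦ by
    have hx := φ.map_target hy
    have h2 := hA.coord_apply ξ _ hx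
      ((e.diff_iff _ hx ξ).2 (by
        have := (hξ y hy).differentiableAt (by simp)
        rwa [← φ.right_inv hy] at this)) v
    rw [rep_homFrame, h2, φ.right_inv hy]
  refine ⟨h1, fun y hy ↦ ?_⟩
  refine contDiffAt_clm_iff.2 fun v ↦ ?_
  have h2 : (fun y ↦ (homFrame hφ e).rep (D ξ) y v) =ᶠ[𝓝 y]
      fun y ↦ fderiv ℝ (e.rep ξ) y v + A y v (e.rep ξ y) := by
    filter_upwards [φ.open_target.mem_nhds hy] with z hz using h1 z hz v
  refine ContDiffAt.congr_of_eventuallyEq ?_ h2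
  exact (((hξ y hy).fderiv_right (m := ω) le_rfl).clm_apply contDiffAt_const).add
    (((hA.analytic y hy).clm_apply contDiffAt_const).clm_apply (hξ y hy))

/-- The identity `(∇_v B) w = ∇_v (B w) - B (∇_v w)` is evaluated on a frame field with constant
coordinates `w`, for which `∇_v w` reduces to `Γ(v, w)`. -/
theorem IsConnectionForm.hom {F : Type} [NormedAddCommGroup F] [NormedSpace ℝ F]
    {V : M → Type v} [TopologicalSpace (TotalSpace F V)]
    [∀ x, AddCommGroup (V x)] [∀ x, Module ℝ (V x)] [∀ x, TopologicalSpace (V x)]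
    [∀ x, IsTopologicalAddGroup (V x)] [∀ x, ContinuousSMul ℝ (V x)]
    [FiberBundle F V] [VectorBundle ℝ F V]
    {hφ : φ ∈ IsManifold.maximalAtlas (𝓡 n) ω M} {e : ChartFrame F V φ}
    {DM : AffineConnection n M} {D : CovariantDerivative (𝓡 n) F V}
    {Γ : EuclideanSpace ℝ (Fin n) → EuclideanSpace ℝ (Fin n) →L[ℝ] EuclideanSpace ℝ (Fin n) →L[ℝ]
      EuclideanSpace ℝ (Fin n)}
    {A : EuclideanSpace ℝ (Fin n) → EuclideanSpace ℝ (Fin n) →L[ℝ] F →L[ℝ] F}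
    (hΓ : IsConnectionForm hφ (tangentFrame hφ) DM Γ) (hA : IsConnectionForm hφ e D A) :
    IsConnectionForm hφ (homFrame hφ e) (homConnection DM D) (homForm Γ A) where
  analytic y hy := contDiffAt_homForm (hΓ.analytic y hy) (hA.analytic y hy)
  coord_apply B x hx hB v := by
    let t := tangentFrame hφ
    ext1 w
    have hY : DiffSectionAt n (EuclideanSpace ℝ (Fin n)) (fun z ↦ t.frame z w) x :=
      t.diff_frame w hx
    have hBr : DifferentiableAt ℝ ((homFrame hφ e).rep B) (φ x) :=
      ((homFrame hφ e).diff_iff x hx B).1 hB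
    have h1 : homConnection DM D B x (t.frame x v) (t.frame x w) =
        D (fun z ↦ B z (t.frame z w)) x (t.frame x v) -
          B x (DM (fun z ↦ t.frame z w) x (t.frame x v)) :=
      homDeriv_apply DM D hB hY (t.frame x v)
    have h2 := hA.coord_apply _ x hx (diffSectionAt_apply hB hY) v
    have h3 := hΓ.coord_apply _ x hx hY v
    have h4 : e.rep (fun z ↦ B z (t.frame z w)) = fun y ↦ (homFrame hφ e).rep B y w := rfl
    have h5 : fderiv ℝ (fun y ↦ (homFrame hφ e).rep B y w) (φ x) v =
        fderiv ℝ ((homFrame hφ e).rep B) (φ x) v w := by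
      rw [(hBr.hasFDerivAt.clm_apply (hasFDerivAt_const w _)).fderiv]
      simp
    have h6 : fderiv ℝ (t.rep fun z ↦ t.frame z w) (φ x) = 0 := by
      rw [(t.rep_frame_const_eventuallyEq w hx).fderiv_eq]
      simp
    rw [(t.rep_frame_const_eventuallyEq w hx).eq_of_nhds, h6] at h3
    rw [h4, h5] at h2
    change e.coord x (homConnection DM D B x (t.frame x v) (t.frame x w)) = _
    rw [h1, map_sub, h2, _root_.add_apply, homForm_apply,
      add_sub_assoc]
    congr 2
    rw [(homFrame hφ e).rep_chart B hx, coord_homFrame]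
    congr 2
    rw [← (tangentFrame hφ).frame_coord x hx (DM _ x _), h3]
    simp

/-- The induction follows `∇^(m+1) ξ = ∇^m (∇ ξ)` and passes to the bundle `Hom(TM, V)`, so the
bundle is generalised. The one remaining evaluation at the velocity commutes with the spray
operators by `iterate_sprayOp_apply_velocity`. -/
theorem coord_iterCovDeriv_diagonal (hφ : φ ∈ IsManifold.maximalAtlas (𝓡 n) ω M)
    {DM : AffineConnection n M}
    {Γ : EuclideanSpace ℝ (Fin n) → EuclideanSpace ℝ (Fin n) →L[ℝ] EuclideanSpace ℝ (Fin n) →L[ℝ]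
      EuclideanSpace ℝ (Fin n)} (hΓ : IsConnectionForm hφ (tangentFrame hφ) DM Γ) (m : ℕ)
    {F : Type} [NormedAddCommGroup F] [NormedSpace ℝ F]
    {V : M → Type v} [TopologicalSpace (TotalSpace F V)]
    [∀ x, AddCommGroup (V x)] [∀ x, Module ℝ (V x)] [∀ x, TopologicalSpace (V x)]
    [∀ x, IsTopologicalAddGroup (V x)] [∀ x, ContinuousSMul ℝ (V x)]
    [FiberBundle F V] [VectorBundle ℝ F V] (e : ChartFrame F V φ)
    {D : CovariantDerivative (𝓡 n) F V}
    {A : EuclideanSpace ℝ (Fin n) → EuclideanSpace ℝ (Fin n) →L[ℝ] F →L[ℝ] F}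
    (hA : IsConnectionForm hφ e D A) {ξ : Π x, V x}
    (hξ : ∀ y ∈ φ.target, ContDiffAt ℝ ω (e.rep ξ) y) {x : M} (hx : x ∈ φ.source)
    (v : EuclideanSpace ℝ (Fin n)) :
    e.coord x (iterCovDeriv DM m D ξ x fun _ ↦ (tangentFrame hφ).frame x v) =
      (sprayOp Γ A)^[m] (fun p ↦ e.rep ξ p.1) (φ x, v) := by
  induction m generalizing F V with
  | zero => exact (e.rep_chart ξ hx).symm
  | succ m ih =>
    obtain ⟨h1, h2⟩ := hA.analytic_rep hξ
    have h3 := ih (homFrame hφ e) (hΓ.hom hA) h2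
    -- As `f` does not depend on the velocity, one spray derivative of it is the representative of
    -- `∇ ξ` applied to the velocity.
    have h4 := iterate_sprayOp_apply_velocity φ.open_target hΓ.analytic hA.analytic
      (B := fun p ↦ (homFrame hφ e).rep (D ξ) p.1) (fun p hp ↦ (h2 p.1 hp).comp p contDiffAt_fst)
      (H := sprayOp Γ A fun p ↦ e.rep ξ p.1) (fun p hp ↦ by
        have := (((hξ p.1 hp).differentiableAt (by simp)).hasFDerivAt.comp p hasFDerivAt_fst).fderiv
        rw [h1 p.1 hp, sprayOp]
        congr 1
        exact DFunLike.congr_fun this _) m (p := (φ x, v)) (φ.map_source hx)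
    rw [Function.iterate_succ_apply, h4, ← h3]
    rfl

end

/-! ### Metrics in a frame over a compact set -/

section
variable {n : ℕ} {M : Type u} [TopologicalSpace M] [ChartedSpace (EuclideanSpace ℝ (Fin n)) M]
  [IsManifold (𝓡 n) ω M]
  {F : Type w} [NormedAddCommGroup F] [NormedSpace ℝ F]
  {V : M → Type v} [TopologicalSpace (TotalSpace F V)]
  [∀ x, AddCommGroup (V x)] [∀ x, Module ℝ (V x)] [∀ x, TopologicalSpace (V x)]
  [∀ x, IsTopologicalAddGroup (V x)] [∀ x, ContinuousSMul ℝ (V x)]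
  [FiberBundle F V] [VectorBundle ℝ F V]
  {φ : OpenPartialHomeomorph M (EuclideanSpace ℝ (Fin n))}

theorem continuousAt_metric_frame (e : ChartFrame F V φ) (g : ContMDiffRiemannianMetric (𝓡 n) ω F V) (u w : F)
    {y : EuclideanSpace ℝ (Fin n)} (hy : y ∈ φ.target) :
    ContinuousAt (fun y ↦ g.inner (φ.symm y) (e.frame (φ.symm y) u) (e.frame (φ.symm y) w)) y := by
  have hx := φ.map_target hy
  have h1 : ContMDiffAt (𝓡 n) ((𝓡 n).prod 𝓘(ℝ)) ω
      (fun x ↦ TotalSpace.mk' ℝ (E := Bundle.Trivial M ℝ) x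
        (g.inner x (e.frame x u) (e.frame x w))) (φ.symm y) :=
    ContMDiffAt.clm_bundle_apply₂ (F₁ := F) (F₂ := F) g.contMDiff.contMDiffAt
      (e.analytic_frame u hx) (e.analytic_frame w hx)
  simp only [contMDiffAt_totalSpace] at h1
  exact (h1.2.continuousAt).comp (φ.continuousAt_symm hy)

/-- In frame coordinates the metric is a continuous positive function on the compact set `K` times
the unit sphere, so it and its inverse are bounded there. Quadratic homogeneity extends the bounds
to all vectors. -/
theorem exists_metric_bounds [FiniteDimensional ℝ F] (e : ChartFrame F V φ) (g : ContMDiffRiemannianMetric (𝓡 n) ω F V)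
    {K : Set (EuclideanSpace ℝ (Fin n))} (hK : IsCompact K) (hKφ : K ⊆ φ.target) :
    ∃ C : ℝ, 0 ≤ C ∧ ∀ y ∈ K, ∀ w : V (φ.symm y),
      g.inner (φ.symm y) w w ≤ C * ‖e.coord (φ.symm y) w‖ ^ 2 ∧
      ‖e.coord (φ.symm y) w‖ ^ 2 ≤ C * g.inner (φ.symm y) w w := by
  let h (p : EuclideanSpace ℝ (Fin n) × F) : ℝ :=
    g.inner (φ.symm p.1) (e.frame (φ.symm p.1) p.2) (e.frame (φ.symm p.1) p.2)
  let b := Module.finBasis ℝ F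
  -- Expansion in a basis reduces joint continuity to the continuity of finitely many metric
  -- coefficients on the base.
  have hsum : ∀ p, h p = ∑ i, ∑ j, b.coord i p.2 * (b.coord j p.2 *
      g.inner (φ.symm p.1) (e.frame (φ.symm p.1) (b i)) (e.frame (φ.symm p.1) (b j))) := fun p ↦ by
    change g.inner (φ.symm p.1) (e.frame (φ.symm p.1) p.2) (e.frame (φ.symm p.1) p.2) = _
    conv_lhs => rw [← b.sum_repr p.2]
    simp only [map_sum, map_smul, _root_.sum_apply, _root_.smul_apply, smul_eq_mul, Finset.mul_sum]
    rw [Finset.sum_comm]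
    refine Finset.sum_congr rfl fun i _ ↦ Finset.sum_congr rfl fun j _ ↦ ?_
    simp only [Module.Basis.coord_apply]
    ring
  have hcoord : ∀ i, Continuous fun u : F ↦ b.coord i u := fun i ↦
    (LinearMap.toContinuousLinearMap (b.coord i)).continuous
  have hc : ContinuousOn h (φ.target ×ˢ univ) := by
    rw [funext hsum]
    intro p hp
    refine ContinuousAt.continuousWithinAt ?_
    refine tendsto_finsetSum _ fun i _ ↦ tendsto_finsetSum _ fun j _ ↦ ?_
    refine (((hcoord i).comp continuous_snd).tendsto p).mul
      ((((hcoord j).comp continuous_snd).tendsto p).mul ?_)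
    exact (continuousAt_metric_frame e g (b i) (b j) hp.1).comp continuousAt_fst
  have hpos : ∀ p : EuclideanSpace ℝ (Fin n) × F, p.1 ∈ φ.target → p.2 ≠ 0 → 0 < h p :=
    fun p hp hne ↦ by
    refine g.pos _ _ fun h0 ↦ hne ?_
    rw [← e.coord_frame _ (φ.map_target hp) p.2, h0, map_zero]
  have hS : IsCompact (K ×ˢ Metric.sphere (0 : F) 1) := hK.prod (isCompact_sphere _ _)
  have hsub : K ×ˢ Metric.sphere (0 : F) 1 ⊆ φ.target ×ˢ univ := prod_mono hKφ (subset_univ _)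
  have hne : ∀ p ∈ K ×ˢ Metric.sphere (0 : F) 1, 0 < h p := fun p hp ↦
    hpos p (hKφ hp.1) (by
      have : ‖p.2‖ = 1 := by simpa using hp.2
      exact norm_pos_iff.1 (by simp [this]))
  obtain ⟨C₁, hC₁⟩ := hS.exists_bound_of_continuousOn (hc.mono hsub)
  obtain ⟨C₂, hC₂⟩ := hS.exists_bound_of_continuousOn
    ((hc.mono hsub).inv₀ fun p hp ↦ (hne p hp).ne')
  refine ⟨max 0 (max C₁ C₂), le_max_left _ _, fun y hy w ↦ ?_⟩
  set u := e.coord (φ.symm y) w with hu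
  have hw : e.frame (φ.symm y) u = w := e.frame_coord _ (φ.map_target (hKφ hy)) w
  by_cases hu0 : u = 0
  · have : w = 0 := by rw [← hw, hu0, map_zero]
    simp [this, hu0]
  have hun : 0 < ‖u‖ := norm_pos_iff.2 hu0
  have hp : (y, ‖u‖⁻¹ • u) ∈ K ×ˢ Metric.sphere (0 : F) 1 := by
    refine ⟨hy, ?_⟩
    simp [norm_smul, hun.ne']
  have hscale : h (y, ‖u‖⁻¹ • u) = ‖u‖⁻¹ ^ 2 * g.inner (φ.symm y) w w := by
    simp only [h, map_smul, _root_.smul_apply, smul_eq_mul, hw]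
    ring
  have h1 := (le_abs_self _).trans (hC₁ _ hp)
  have h2 := (le_abs_self _).trans (hC₂ _ hp)
  have h3 := hne _ hp
  rw [hscale] at h1 h3
  rw [Pi.inv_apply, hscale, mul_inv, inv_pow, inv_inv] at h2
  have h4 : 0 < g.inner (φ.symm y) w w := by
    by_contra hcon
    exact absurd h3 (not_lt.2 (mul_nonpos_of_nonneg_of_nonpos (by positivity) (not_lt.1 hcon)))
  constructor
  · have : g.inner (φ.symm y) w w ≤ C₁ * ‖u‖ ^ 2 := by
      rw [inv_pow, inv_mul_le_iff₀ (by positivity)] at h1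
      linarith
    refine this.trans (mul_le_mul_of_nonneg_right ?_ (by positivity))
    exact (le_max_left _ _).trans (le_max_right _ _)
  · have : ‖u‖ ^ 2 ≤ C₂ * g.inner (φ.symm y) w w := by
      rwa [← div_eq_mul_inv, div_le_iff₀ h4] at h2
    refine this.trans (mul_le_mul_of_nonneg_right ?_ h4.le)
    exact (le_max_right _ _).trans (le_max_right _ _)
end

/-! ### Symmetrisation and tensor norms -/

section
variable {T W : Type*} [AddCommGroup T] [Module ℝ T] [AddCommGroup W] [Module ℝ W] {m : ℕ}

theorem symmetrize_comp_perm (A : MultilinearMap ℝ (fun _ : Fin m ↦ T) W) (σ : Equiv.Perm (Fin m))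
    (v : Fin m → T) : symmetrize A (v ∘ σ) = symmetrize A v := by
  simp only [symmetrize, _root_.smul_apply, _root_.sum_apply,
    MultilinearMap.domDomCongr_apply]
  congr 1
  exact Fintype.sum_equiv (Equiv.mulLeft σ) _ _ fun τ ↦ rfl

theorem symmetrize_diagonal (A : MultilinearMap ℝ (fun _ : Fin m ↦ T) W) (v : T) :
    symmetrize A (fun _ ↦ v) = A fun _ ↦ v := by
  simp only [symmetrize, _root_.smul_apply, _root_.sum_apply,
    MultilinearMap.domDomCongr_apply, Finset.sum_const, Finset.card_univ, Fintype.card_perm,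
    Fintype.card_fin]
  rw [← Nat.cast_smul_eq_nsmul ℝ, smul_smul, inv_mul_cancel₀ (by positivity), one_smul]

end

section
variable {n : ℕ} {M : Type u} [TopologicalSpace M] [ChartedSpace (EuclideanSpace ℝ (Fin n)) M]
  [IsManifold (𝓡 n) ω M]
  {F : Type w} [NormedAddCommGroup F] [NormedSpace ℝ F]
  {V : M → Type v} [TopologicalSpace (TotalSpace F V)]
  [∀ x, AddCommGroup (V x)] [∀ x, Module ℝ (V x)] [∀ x, TopologicalSpace (V x)]
  [∀ x, IsTopologicalAddGroup (V x)] [∀ x, ContinuousSMul ℝ (V x)]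
  [FiberBundle F V] [VectorBundle ℝ F V]
  {φ : OpenPartialHomeomorph M (EuclideanSpace ℝ (Fin n))}

theorem orthonormalBasisAt_inner (g : AnalyticRiemannianMetric n M) (x : M) (i j : Fin n) :
    g.inner x (orthonormalBasisAt g x i) (orthonormalBasisAt g x j) = if i = j then 1 else 0 :=
  (exists_orthonormalBasis g x).choose_spec i j

theorem inner_self_nonneg (g : ContMDiffRiemannianMetric (𝓡 n) ω F V) {x : M} (w : V x) :
    0 ≤ g.inner x w w := by
  by_cases hw : w = 0
  · simp [hw]
  · exact (g.pos x w hw).le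

theorem inner_self_eq_sum_repr (g : AnalyticRiemannianMetric n M) {x : M}
    (w : TangentSpace (𝓡 n) x) :
    g.inner x w w = ∑ i, (orthonormalBasisAt g x).repr w i ^ 2 := by
  conv_lhs => rw [← (orthonormalBasisAt g x).sum_repr w]
  simp only [map_sum, map_smul, _root_.sum_apply, _root_.smul_apply, smul_eq_mul,
    orthonormalBasisAt_inner]
  simp [sq]

theorem tensorNormSq_nonneg (gM : AnalyticRiemannianMetric n M)
    (gV : ContMDiffRiemannianMetric (𝓡 n) ω F V) {m : ℕ} {x : M}
    (T : MultilinearMap ℝ (fun _ : Fin m ↦ TangentSpace (𝓡 n) x) (V x)) :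
    0 ≤ tensorNormSq gM gV T :=
  Finset.sum_nonneg fun _ _ ↦ inner_self_nonneg gV _

theorem tensorNormSq_smul (gM : AnalyticRiemannianMetric n M)
    (gV : ContMDiffRiemannianMetric (𝓡 n) ω F V) {m : ℕ} {x : M} (c : ℝ)
    (T : MultilinearMap ℝ (fun _ : Fin m ↦ TangentSpace (𝓡 n) x) (V x)) :
    tensorNormSq gM gV (c • T) = c ^ 2 * tensorNormSq gM gV T := by
  simp only [tensorNormSq, Finset.mul_sum, _root_.smul_apply, map_smul,
    smul_eq_mul]
  exact Finset.sum_congr rfl fun _ _ ↦ by ring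

/-- Orthonormal vectors have coordinates of norm at most `√C₂`. Polarization bounds each of the
`n^m` components of the tensor by the diagonal. -/
theorem tensorNormSq_le_of_diagonal (gM : AnalyticRiemannianMetric n M)
    (gV : ContMDiffRiemannianMetric (𝓡 n) ω F V)
    (t : ChartFrame (EuclideanSpace ℝ (Fin n)) (TangentSpace (𝓡 n) : M → Type) φ)
    (e : ChartFrame F V φ) {x : M} (hx : x ∈ φ.source) {C₁ C₂ D : ℝ} (hC₁ : 0 ≤ C₁)
    (h1 : ∀ w, gV.inner x w w ≤ C₁ * ‖e.coord x w‖ ^ 2)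
    (h2 : ∀ w, ‖t.coord x w‖ ^ 2 ≤ C₂ * gM.inner x w w) {m : ℕ}
    (T : MultilinearMap ℝ (fun _ : Fin m ↦ TangentSpace (𝓡 n) x) (V x))
    (hT : ∀ (σ : Equiv.Perm (Fin m)) v, T (v ∘ σ) = T v)
    (hD : ∀ v, ‖v‖ ≤ 1 → ‖e.coord x (T fun _ ↦ t.frame x v)‖ ≤ D) :
    tensorNormSq gM gV T ≤ n ^ m * (C₁ * (D * (2 * Real.exp 1 * √C₂) ^ m) ^ 2) := by
  let S : MultilinearMap ℝ (fun _ : Fin m ↦ EuclideanSpace ℝ (Fin n)) F :=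
    (e.coord x).toLinearMap.compMultilinearMap (T.compLinearMap fun _ ↦ (t.frame x).toLinearMap)
  have hS : ∀ (σ : Equiv.Perm (Fin m)) v, S (v ∘ σ) = S v := fun σ v ↦
    congrArg (e.coord x) (hT σ fun i ↦ t.frame x (v i))
  have h3 : ∀ i, ‖t.coord x (orthonormalBasisAt gM x i)‖ ≤ √C₂ := fun i ↦ by
    refine Real.le_sqrt_of_sq_le ((h2 _).trans ?_)
    rw [orthonormalBasisAt_inner]
    simp
  have h4 : ∀ r : Fin m → Fin n, ‖e.coord x (T fun i ↦ orthonormalBasisAt gM x (r i))‖ ≤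
      D * (2 * Real.exp 1 * √C₂) ^ m := fun r ↦ by
    have := norm_apply_le_of_diagonal S hS (Real.sqrt_nonneg C₂) hD
      (w := fun i ↦ t.coord x (orthonormalBasisAt gM x (r i))) fun i ↦ h3 (r i)
    simpa [S, t.frame_coord x hx] using this
  have h5 : tensorNormSq gM gV T ≤
      ∑ _r : Fin m → Fin n, C₁ * (D * (2 * Real.exp 1 * √C₂) ^ m) ^ 2 :=
    Finset.sum_le_sum fun r _ ↦ (h1 _).trans
      (mul_le_mul_of_nonneg_left (pow_le_pow_left₀ (norm_nonneg _) (h4 r) 2) hC₁)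
  refine h5.trans_eq ?_
  simp

/-- The vector is expanded in the orthonormal basis with coefficients at most `√C₂`, giving `n^m`
terms, each a component of the tensor. No symmetry is needed in this direction. -/
theorem norm_diagonal_le_of_tensorNormSq (gM : AnalyticRiemannianMetric n M)
    (gV : ContMDiffRiemannianMetric (𝓡 n) ω F V)
    (t : ChartFrame (EuclideanSpace ℝ (Fin n)) (TangentSpace (𝓡 n) : M → Type) φ)
    (e : ChartFrame F V φ) {x : M} (hx : x ∈ φ.source) {C₁ C₂ : ℝ} (hC₁ : 0 ≤ C₁) (hC₂ : 0 ≤ C₂)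
    (h1 : ∀ w, ‖e.coord x w‖ ^ 2 ≤ C₁ * gV.inner x w w)
    (h2 : ∀ w, gM.inner x w w ≤ C₂ * ‖t.coord x w‖ ^ 2) {m : ℕ}
    (T : MultilinearMap ℝ (fun _ : Fin m ↦ TangentSpace (𝓡 n) x) (V x))
    {v : EuclideanSpace ℝ (Fin n)} (hv : ‖v‖ ≤ 1) :
    ‖e.coord x (T fun _ ↦ t.frame x v)‖ ≤ (n * √C₂) ^ m * (√C₁ * √(tensorNormSq gM gV T)) := by
  set b := orthonormalBasisAt gM x with hb
  set a := b.repr (t.frame x v) with ha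
  have h3 : ∀ i, |a i| ≤ √C₂ := fun i ↦ by
    refine Real.abs_le_sqrt ?_
    have h4 := h2 (t.frame x v)
    rw [inner_self_eq_sum_repr, t.coord_frame x hx] at h4
    calc a i ^ 2 ≤ ∑ j, a j ^ 2 :=
          Finset.single_le_sum (f := fun j ↦ a j ^ 2) (fun j _ ↦ sq_nonneg _) (Finset.mem_univ i)
      _ ≤ C₂ * ‖v‖ ^ 2 := h4
      _ ≤ C₂ := mul_le_of_le_one_right hC₂ (pow_le_one₀ (norm_nonneg _) hv)
  have h4 : ∀ r : Fin m → Fin n, ‖e.coord x (T fun i ↦ b (r i))‖ ≤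
      √C₁ * √(tensorNormSq gM gV T) := fun r ↦ by
    rw [← Real.sqrt_mul hC₁]
    refine Real.le_sqrt_of_sq_le ((h1 _).trans (mul_le_mul_of_nonneg_left ?_ hC₁))
    exact Finset.single_le_sum (f := fun r : Fin m → Fin n ↦ gV.inner x (T fun i ↦ b (r i))
      (T fun i ↦ b (r i))) (fun _ _ ↦ inner_self_nonneg gV _) (Finset.mem_univ r)
  have h5 : (T fun _ ↦ t.frame x v) =
      ∑ r : Fin m → Fin n, (∏ i, a (r i)) • T fun i ↦ b (r i) := by
    have : (fun _ : Fin m ↦ t.frame x v) = fun _ ↦ ∑ j, a j • b j := by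
      funext _
      exact (b.sum_repr _).symm
    rw [this, T.map_sum]
    exact Finset.sum_congr rfl fun r _ ↦ T.map_smul_univ _ _
  rw [h5, map_sum]
  refine (norm_sum_le _ _).trans ?_
  have h6 : ∀ r ∈ (Finset.univ : Finset (Fin m → Fin n)),
      ‖e.coord x ((∏ i, a (r i)) • T fun i ↦ b (r i))‖ ≤
        √C₂ ^ m * (√C₁ * √(tensorNormSq gM gV T)) := fun r _ ↦ by
    rw [map_smul, norm_smul]
    refine mul_le_mul ?_ (h4 r) (norm_nonneg _) (by positivity)
    rw [Real.norm_eq_abs, Finset.abs_prod]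
    refine (Finset.prod_le_prod (fun _ _ ↦ abs_nonneg _) fun i _ ↦ h3 (r i)).trans_eq ?_
    simp
  refine (Finset.sum_le_sum h6).trans_eq ?_
  simp [mul_pow, mul_assoc]

end

/-! ### Jet norms against partial derivatives -/

section
variable {n : ℕ} {M : Type u} [TopologicalSpace M] [ChartedSpace (EuclideanSpace ℝ (Fin n)) M]
  [IsManifold (𝓡 n) ω M]
  {F : Type} [NormedAddCommGroup F] [NormedSpace ℝ F] [FiniteDimensional ℝ F]
  {V : M → Type v} [TopologicalSpace (TotalSpace F V)]
  [∀ x, AddCommGroup (V x)] [∀ x, Module ℝ (V x)] [∀ x, TopologicalSpace (V x)]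
  [∀ x, IsTopologicalAddGroup (V x)] [∀ x, ContinuousSMul ℝ (V x)]
  [FiberBundle F V] [VectorBundle ℝ F V]
  {φ : OpenPartialHomeomorph M (EuclideanSpace ℝ (Fin n))}

theorem coord_symCovDeriv_diagonal (hφ : φ ∈ IsManifold.maximalAtlas (𝓡 n) ω M)
    {DM : AffineConnection n M}
    {Γ : EuclideanSpace ℝ (Fin n) → EuclideanSpace ℝ (Fin n) →L[ℝ] EuclideanSpace ℝ (Fin n) →L[ℝ]
      EuclideanSpace ℝ (Fin n)} (hΓ : IsConnectionForm hφ (tangentFrame hφ) DM Γ)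
    (e : ChartFrame F V φ) {D : CovariantDerivative (𝓡 n) F V}
    {A : EuclideanSpace ℝ (Fin n) → EuclideanSpace ℝ (Fin n) →L[ℝ] F →L[ℝ] F}
    (hA : IsConnectionForm hφ e D A) {ξ : Π x, V x}
    (hξ : ∀ y ∈ φ.target, ContDiffAt ℝ ω (e.rep ξ) y) {y : EuclideanSpace ℝ (Fin n)}
    (hy : y ∈ φ.target) (m : ℕ) (v : EuclideanSpace ℝ (Fin n)) :
    e.coord (φ.symm y) (symCovDeriv DM D m ξ (φ.symm y)
      fun _ ↦ (tangentFrame hφ).frame (φ.symm y) v) =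
      (sprayOp Γ A)^[m] (fun p ↦ e.rep ξ p.1) (y, v) := by
  rw [symCovDeriv, symmetrize_diagonal,
    coord_iterCovDeriv_diagonal hφ hΓ m e hA hξ (φ.map_target hy), φ.right_inv hy]

/-- The number of summands is absorbed in the geometric factor by `m + 1 ≤ 2^m`; the base `1 + τ`
makes the powers increasing. -/
theorem sum_le_of_geometric {m : ℕ} {s : ℕ → ℝ} {a τ : ℝ} (ha : 0 ≤ a) (hτ : 0 ≤ τ)
    (h : ∀ j ≤ m, s j ≤ (a * τ ^ j) ^ 2) :
    ∑ j ∈ Finset.range (m + 1), s j ≤ (a * (2 * (1 + τ)) ^ m) ^ 2 := by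
  have h1 : ∀ j ∈ Finset.range (m + 1), s j ≤ (a * (1 + τ) ^ m) ^ 2 := fun j hj ↦ by
    have hj' : j ≤ m := Nat.lt_succ_iff.1 (Finset.mem_range.1 hj)
    refine (h j hj').trans (pow_le_pow_left₀ (by positivity) ?_ 2)
    refine mul_le_mul_of_nonneg_left ?_ ha
    exact (pow_le_pow_left₀ hτ (by linarith) j).trans (pow_le_pow_right₀ (by linarith) hj')
  refine (Finset.sum_le_sum h1).trans ?_
  have h4 : (a * (2 * (1 + τ)) ^ m) ^ 2 = (2 ^ m) ^ 2 * (a * (1 + τ) ^ m) ^ 2 := by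
    rw [mul_pow 2]
    ring
  rw [Finset.sum_const, Finset.card_range, nsmul_eq_mul, h4]
  refine mul_le_mul_of_nonneg_right ?_ (by positivity)
  have h2 : m + 1 ≤ 2 ^ m := Nat.lt_two_pow_self
  have h3 : ((m + 1 : ℕ) : ℝ) ≤ 2 ^ m := by exact_mod_cast h2
  nlinarith [one_le_pow₀ (M₀ := ℝ) (n := m) one_le_two]

theorem exists_jetNorm_le (G : GeometricData n F V)
    (hφ : φ ∈ IsManifold.maximalAtlas (𝓡 n) ω M) (e : ChartFrame F V φ)
    {K : Set (EuclideanSpace ℝ (Fin n))} (hK : IsCompact K) (hKφ : K ⊆ φ.target) :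
    ∃ C σ : ℝ, 0 ≤ C ∧ 0 ≤ σ ∧ ∀ y ∈ K, ∀ ξ : Π x, V x,
      (∀ y ∈ φ.target, ContDiffAt ℝ ω (e.rep ξ) y) → ∀ (m : ℕ) (B : ℝ),
      (∀ j ≤ m, ‖iteratedFDeriv ℝ j (e.rep ξ) y‖ ≤ B * j.factorial) →
      jetNorm G m ξ (φ.symm y) ≤ C * σ ^ m * B := by
  obtain ⟨Γ, hΓ⟩ := exists_isConnectionForm hφ (tangentFrame hφ) G.analytic_baseConnection
  obtain ⟨A, hA⟩ := exists_isConnectionForm hφ e G.analytic_fibreConnection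
  obtain ⟨C₀, σ₀, hC₀, hσ₀, h0⟩ :=
    exists_norm_iterate_sprayOp_le φ.open_target hK hKφ hΓ.analytic hA.analytic
  obtain ⟨C₁, hC₁, h1⟩ := exists_metric_bounds e G.fibreMetric hK hKφ
  obtain ⟨C₂, hC₂, h2⟩ := exists_metric_bounds (tangentFrame hφ) G.baseMetric hK hKφ
  -- The rate collects the growth `σ₀` of the spray derivatives, `2e` from polarization, `√C₂` from
  -- the metric on the base, and `√n` from the square root of the `n^j` components.
  set τ := √n * (σ₀ * (2 * Real.exp 1 * √C₂)) with hτ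
  refine ⟨√C₁ * C₀, 2 * (1 + τ), by positivity, by positivity, fun y hy ξ hξ m B hB ↦ ?_⟩
  have hB0 : 0 ≤ B := by simpa using (norm_nonneg _).trans (hB 0 (Nat.zero_le m))
  have h3 : ∀ j ≤ m, tensorNormSq G.baseMetric G.fibreMetric (((j.factorial : ℝ)⁻¹) •
      symCovDeriv G.baseConnection G.fibreConnection j ξ (φ.symm y)) ≤
        (√C₁ * C₀ * B * τ ^ j) ^ 2 := fun j hj ↦ by
    have hf : (0 : ℝ) < j.factorial := by positivity
    rw [tensorNormSq_smul]
    have h4 := tensorNormSq_le_of_diagonal G.baseMetric G.fibreMetric (tangentFrame hφ) e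
      (φ.map_target (hKφ hy)) hC₁ (fun w ↦ (h1 y hy w).1) (fun w ↦ (h2 y hy w).2)
      (symCovDeriv G.baseConnection G.fibreConnection j ξ (φ.symm y))
      (symmetrize_comp_perm _) (D := C₀ * σ₀ ^ j * j.factorial * B) fun v hv ↦ by
        rw [coord_symCovDeriv_diagonal hφ hΓ e hA hξ (hKφ hy)]
        exact h0 y hy _ hξ j B (fun i hi ↦ hB i (hi.trans hj)) v hv
    refine (mul_le_mul_of_nonneg_left h4 (by positivity)).trans_eq ?_
    have h5 : (√n : ℝ) ^ 2 = n := Real.sq_sqrt (Nat.cast_nonneg n)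
    have h6 : √C₁ ^ 2 = C₁ := Real.sq_sqrt hC₁
    rw [hτ, mul_pow √n, mul_pow σ₀]
    simp only [mul_pow _ _ 2, h6, ← pow_mul, inv_pow]
    rw [mul_comm j 2, pow_mul √n, h5, pow_mul σ₀, pow_mul (2 * Real.exp 1 * √C₂)]
    field_simp
  rw [jetNorm]
  refine (Real.sqrt_le_sqrt (sum_le_of_geometric (by positivity) (by positivity) h3)).trans_eq ?_
  rw [Real.sqrt_sq (by positivity)]
  ring

theorem jetNorm_nonneg (G : GeometricData n F V) (m : ℕ) (ξ : Π x, V x) (x : M) :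
    0 ≤ jetNorm G m ξ x := Real.sqrt_nonneg _

theorem exists_norm_iteratedFDeriv_le_jetNorm (G : GeometricData n F V)
    (hφ : φ ∈ IsManifold.maximalAtlas (𝓡 n) ω M) (e : ChartFrame F V φ)
    {K : Set (EuclideanSpace ℝ (Fin n))} (hK : IsCompact K) (hKφ : K ⊆ φ.target) :
    ∃ C σ : ℝ, 0 ≤ C ∧ 0 ≤ σ ∧ ∀ y ∈ K, ∀ ξ : Π x, V x,
      (∀ y ∈ φ.target, ContDiffAt ℝ ω (e.rep ξ) y) → ∀ m : ℕ,
      ‖iteratedFDeriv ℝ m (e.rep ξ) y‖ ≤ C * σ ^ m * m.factorial * jetNorm G m ξ (φ.symm y) := by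
  obtain ⟨Γ, hΓ⟩ := exists_isConnectionForm hφ (tangentFrame hφ) G.analytic_baseConnection
  obtain ⟨A, hA⟩ := exists_isConnectionForm hφ e G.analytic_fibreConnection
  obtain ⟨C₀, σ₀, hC₀, hσ₀, h0⟩ :=
    exists_norm_iteratedFDeriv_le_of_sprayOp φ.open_target hK hKφ hΓ.analytic hA.analytic
  obtain ⟨C₁, hC₁, h1⟩ := exists_metric_bounds e G.fibreMetric hK hKφ
  obtain ⟨C₂, hC₂, h2⟩ := exists_metric_bounds (tangentFrame hφ) G.baseMetric hK hKφ
  refine ⟨C₀ * √C₁, σ₀ * (1 + n * √C₂), by positivity, by positivity, fun y hy ξ hξ m ↦ ?_⟩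
  -- The bound on spray derivatives must be the same for all orders `j ≤ m`, so the factor `(n
  -- √C₂)^j` is replaced by `(1 + n √C₂)^m`.
  refine (h0 y hy _ hξ m ((1 + n * √C₂) ^ m * (√C₁ * jetNorm G m ξ (φ.symm y)))
    fun j hj v hv ↦ ?_).trans_eq (by rw [mul_pow σ₀]; ring)
  rw [← coord_symCovDeriv_diagonal hφ hΓ e hA hξ (hKφ hy)]
  refine (norm_diagonal_le_of_tensorNormSq G.baseMetric G.fibreMetric (tangentFrame hφ) e
    (φ.map_target (hKφ hy)) hC₁ hC₂ (fun w ↦ (h1 y hy w).2) (fun w ↦ (h2 y hy w).1) _ hv).trans ?_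
  have hf : (0 : ℝ) < j.factorial := by positivity
  have h3 : √(tensorNormSq G.baseMetric G.fibreMetric
      (symCovDeriv G.baseConnection G.fibreConnection j ξ (φ.symm y))) ≤
      jetNorm G m ξ (φ.symm y) * j.factorial := by
    rw [← div_le_iff₀ hf, ← Real.sqrt_sq hf.le, ← Real.sqrt_div' _ (by positivity), jetNorm]
    refine Real.sqrt_le_sqrt ?_
    have h4 := Finset.single_le_sum (f := fun j ↦ tensorNormSq G.baseMetric G.fibreMetric
      (((j.factorial : ℝ)⁻¹) • symCovDeriv G.baseConnection G.fibreConnection j ξ (φ.symm y)))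
      (fun _ _ ↦ tensorNormSq_nonneg _ _ _) (Finset.mem_range.2 (Nat.lt_succ_iff.2 hj))
    refine le_trans (le_of_eq ?_) h4
    rw [tensorNormSq_smul]
    field_simp
  have h5 : (n * √C₂) ^ j ≤ (1 + n * √C₂) ^ m :=
    (pow_le_pow_left₀ (by positivity) (by linarith) j).trans
      (pow_le_pow_right₀ (by linarith [show 0 ≤ n * √C₂ by positivity]) hj)
  calc (n * √C₂) ^ j * (√C₁ * √(tensorNormSq G.baseMetric G.fibreMetric
        (symCovDeriv G.baseConnection G.fibreConnection j ξ (φ.symm y))))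
      ≤ (1 + n * √C₂) ^ m * (√C₁ * (jetNorm G m ξ (φ.symm y) * j.factorial)) := by gcongr
    _ = _ := by ring

end

/-! ### Multi-indices and iterated Fréchet derivatives -/

section
variable {n : ℕ}

/-- The multi-index `I` as a sorted list of indices. -/
def indexList (I : Fin n → ℕ) : List (Fin n) :=
  (List.finRange n).flatMap fun i ↦ List.replicate (I i) i

theorem multiDeriv_eq_foldr (I : Fin n → ℕ) (f : EuclideanSpace ℝ (Fin n) → ℝ) :
    multiDeriv I f = (indexList I).foldr partialDeriv f := by
  rw [multiDeriv, indexList, List.foldr_flatMap]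
  congr 1
  funext i g
  generalize I i = k
  induction k with
  | zero => rfl
  | succ k ih => rw [Function.iterate_succ_apply', ih, List.replicate_succ, List.foldr_cons]

theorem count_indexList (I : Fin n → ℕ) (i : Fin n) : (indexList I).count i = I i := by
  rw [indexList, List.count_flatMap]
  have : (List.map (List.count i ∘ fun j ↦ List.replicate (I j) j) (List.finRange n)) =
      (List.finRange n).map fun j ↦ if j = i then I j else 0 := by
    refine List.map_congr_left fun j _ ↦ ?_
    simp [List.count_replicate]
  rw [this, ← Fin.sum_univ_def]
  simp

theorem length_indexList (I : Fin n → ℕ) : (indexList I).length = ∑ i, I i := by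
  simp only [indexList, List.length_flatMap, List.length_replicate]
  rw [← Fin.sum_univ_def]

variable {Ω : Set (EuclideanSpace ℝ (Fin n))} {f : EuclideanSpace ℝ (Fin n) → ℝ}

theorem contDiffAt_partialDeriv (i : Fin n) {y : EuclideanSpace ℝ (Fin n)}
    (hf : ContDiffAt ℝ ω f y) : ContDiffAt ℝ ω (partialDeriv i f) y :=
  (hf.fderiv_right (m := ω) le_rfl).clm_apply contDiffAt_const

theorem contDiffAt_foldr_partialDeriv (l : List (Fin n)) {y : EuclideanSpace ℝ (Fin n)}
    (hf : ContDiffAt ℝ ω f y) : ContDiffAt ℝ ω (l.foldr partialDeriv f) y := by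
  induction l with
  | nil => exact hf
  | cons i l ih => exact contDiffAt_partialDeriv i ih

theorem partialDeriv_comm (i j : Fin n) {y : EuclideanSpace ℝ (Fin n)}
    (hf : ContDiffAt ℝ ω f y) :
    partialDeriv i (partialDeriv j f) y = partialDeriv j (partialDeriv i f) y := by
  have h1 : DifferentiableAt ℝ (fderiv ℝ f) y :=
    (hf.fderiv_right (m := ω) le_rfl).differentiableAt (by simp)
  have h2 : ∀ i j : Fin n, partialDeriv i (partialDeriv j f) y =
      fderiv ℝ (fderiv ℝ f) y (EuclideanSpace.single i 1) (EuclideanSpace.single j 1) :=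
    fun i j ↦ by
    change fderiv ℝ (fun z ↦ fderiv ℝ f z (EuclideanSpace.single j 1)) y _ = _
    rw [(h1.hasFDerivAt.clm_apply (hasFDerivAt_const _ y)).fderiv]
    simp
  rw [h2, h2]
  exact hf.isSymmSndFDerivAt (by simp) _ _

theorem partialDeriv_congr (hΩ : IsOpen Ω) (i : Fin n) {g h : EuclideanSpace ℝ (Fin n) → ℝ}
    (hgh : EqOn g h Ω) : EqOn (partialDeriv i g) (partialDeriv i h) Ω := fun y hy ↦ by
  rw [partialDeriv, (hgh.eventuallyEq_of_mem (hΩ.mem_nhds hy)).fderiv_eq]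
  rfl

/-- Adjacent partial derivatives commute at every point of the open set, so the identities can be
differentiated again. -/
theorem foldr_partialDeriv_perm (hΩ : IsOpen Ω) (hf : ∀ y ∈ Ω, ContDiffAt ℝ ω f y)
    {l l' : List (Fin n)} (h : l.Perm l') :
    EqOn (l.foldr partialDeriv f) (l'.foldr partialDeriv f) Ω := by
  induction h with
  | nil => exact fun _ _ ↦ rfl
  | cons i _ ih => exact partialDeriv_congr hΩ i ih
  | swap i j l => exact fun y hy ↦
      partialDeriv_comm j i (contDiffAt_foldr_partialDeriv l (hf y hy))
  | trans _ _ ih1 ih2 => exact ih1.trans ih2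

theorem foldr_partialDeriv_ofFn (hΩ : IsOpen Ω) (hf : ∀ y ∈ Ω, ContDiffAt ℝ ω f y) {j : ℕ}
    (s : Fin j → Fin n) {y : EuclideanSpace ℝ (Fin n)} (hy : y ∈ Ω) :
    (List.ofFn s).foldr partialDeriv f y =
      iteratedFDeriv ℝ j f y fun r ↦ EuclideanSpace.single (s r) 1 := by
  induction j generalizing y with
  | zero => simp
  | succ j ih =>
    rw [List.ofFn_succ, List.foldr_cons, partialDeriv]
    have h1 : (List.ofFn fun r ↦ s r.succ).foldr partialDeriv f =ᶠ[𝓝 y] fun z ↦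
        iteratedFDeriv ℝ j f z fun r ↦ EuclideanSpace.single (s r.succ) 1 := by
      filter_upwards [hΩ.mem_nhds hy] with z hz using ih _ hz
    have h2 : DifferentiableAt ℝ (iteratedFDeriv ℝ j f) y :=
      ((hf y hy).iteratedFDeriv_right (m := ω) (i := j) (by simp)).differentiableAt (by simp)
    rw [h1.fderiv_eq, h2.iteratedFDeriv_succ_apply_left']
    rfl

theorem abs_multiDeriv_le (hΩ : IsOpen Ω) (hf : ∀ y ∈ Ω, ContDiffAt ℝ ω f y) (I : Fin n → ℕ)
    {y : EuclideanSpace ℝ (Fin n)} (hy : y ∈ Ω) :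
    |multiDeriv I f y| ≤ ‖iteratedFDeriv ℝ (∑ i, I i) f y‖ := by
  have h1 := foldr_partialDeriv_ofFn hΩ hf (indexList I).get hy
  rw [List.ofFn_get] at h1
  rw [multiDeriv_eq_foldr, h1, ← length_indexList, ← Real.norm_eq_abs]
  refine (ContinuousMultilinearMap.le_opNorm _ _).trans_eq ?_
  simp

/-- The multinomial coefficient is one term of the expansion of `(1 + ⋯ + 1)^|I| = n^|I|`. -/
theorem factorial_sum_le (I : Fin n → ℕ) :
    ((∑ i, I i).factorial : ℝ) ≤ n ^ (∑ i, I i) * ∏ i, ((I i).factorial : ℝ) := by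
  have h1 := Finset.sum_pow_eq_sum_piAntidiag (Finset.univ : Finset (Fin n)) (fun _ ↦ (1 : ℕ))
    (∑ i, I i)
  have h2 : Nat.multinomial Finset.univ I ≤ n ^ ∑ i, I i := by
    have h3 := Finset.single_le_sum (f := fun k ↦ Nat.multinomial Finset.univ k)
      (fun _ _ ↦ Nat.zero_le _)
      (show I ∈ Finset.piAntidiag Finset.univ (∑ i, I i) by simp)
    simp at h1
    exact h3.trans_eq h1.symm
  have h3 := Nat.multinomial_spec Finset.univ I
  rw [← h3, mul_comm]
  push_cast
  exact mul_le_mul_of_nonneg_right (by exact_mod_cast h2) (by positivity)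

theorem prod_factorial_le (I : Fin n → ℕ) :
    ∏ i, ((I i).factorial : ℝ) ≤ (∑ i, I i).factorial := by
  exact_mod_cast Nat.le_of_dvd (Nat.factorial_pos _)
    (Nat.prod_factorial_dvd_factorial_sum Finset.univ I)

/-- Expanding the arguments in the standard basis gives `n^j` mixed partial derivatives. Each can be
sorted into a multi-index derivative, and `I! ≤ |I|!`. -/
theorem norm_iteratedFDeriv_single_le (hΩ : IsOpen Ω) (hf : ∀ y ∈ Ω, ContDiffAt ℝ ω f y) {j : ℕ}
    {y : EuclideanSpace ℝ (Fin n)} (hy : y ∈ Ω) {B : ℝ} (hB0 : 0 ≤ B)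
    (hB : ∀ I : Fin n → ℕ, ∑ i, I i = j → |multiDeriv I f y| ≤ B * ∏ i, ((I i).factorial : ℝ)) :
    ‖iteratedFDeriv ℝ j f y‖ ≤ n ^ j * (B * j.factorial) := by
  have h1 : ∀ s : Fin j → Fin n,
      ‖iteratedFDeriv ℝ j f y fun r ↦ EuclideanSpace.single (s r) 1‖ ≤ B * j.factorial :=
    fun s ↦ by
    -- The multi-index counts how often each direction occurs in `s`.
    have hp : (indexList fun i ↦ (List.ofFn s).count i).Perm (List.ofFn s) :=
      List.perm_iff_count.2 fun i ↦ count_indexList _ i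
    have hj : ∑ i, (List.ofFn s).count i = j := by
      rw [← length_indexList, hp.length_eq, List.length_ofFn]
    rw [← foldr_partialDeriv_ofFn hΩ hf s hy, ← foldr_partialDeriv_perm hΩ hf hp hy,
      ← multiDeriv_eq_foldr]
    refine (hB _ hj).trans (mul_le_mul_of_nonneg_left ?_ hB0)
    exact (prod_factorial_le _).trans_eq (by rw [hj])
  refine ContinuousMultilinearMap.opNorm_le_bound (by positivity) fun v ↦ ?_
  have h2 : v = fun r ↦ ∑ i, v r i • EuclideanSpace.single i (1 : ℝ) := by
    funext r
    ext k
    simp [Finset.sum_apply, Pi.single_apply]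
  have h3 : iteratedFDeriv ℝ j f y v = ∑ s : Fin j → Fin n, (∏ r, v r (s r)) •
      iteratedFDeriv ℝ j f y fun r ↦ EuclideanSpace.single (s r) 1 := by
    conv_lhs => rw [h2]
    rw [ContinuousMultilinearMap.map_sum]
    exact Finset.sum_congr rfl fun s _ ↦ ContinuousMultilinearMap.map_smul_univ _ _ _
  rw [h3]
  refine (norm_sum_le _ _).trans ?_
  have h4 : ∀ s ∈ (Finset.univ : Finset (Fin j → Fin n)), ‖(∏ r, v r (s r)) •
      iteratedFDeriv ℝ j f y fun r ↦ EuclideanSpace.single (s r) 1‖ ≤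
        (∏ r, ‖v r‖) * (B * j.factorial) := fun s _ ↦ by
    rw [norm_smul, norm_prod]
    refine mul_le_mul ?_ (h1 s) (norm_nonneg _) (by positivity)
    exact Finset.prod_le_prod (fun _ _ ↦ norm_nonneg _) fun r _ ↦ PiLp.norm_apply_le _ _
  refine (Finset.sum_le_sum h4).trans_eq ?_
  simp
  ring

variable {k : ℕ} {Φ : EuclideanSpace ℝ (Fin n) → EuclideanSpace ℝ (Fin k)}

theorem contDiffAt_component {y : EuclideanSpace ℝ (Fin n)} (hΦ : ContDiffAt ℝ ω Φ y)
    (c : Fin k) : ContDiffAt ℝ ω (fun y ↦ Φ y c) y :=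
  (EuclideanSpace.proj (𝕜 := ℝ) c).contDiff.contDiffAt.comp y hΦ

theorem abs_multiDeriv_component_le (hΩ : IsOpen Ω) (hΦ : ∀ y ∈ Ω, ContDiffAt ℝ ω Φ y)
    (I : Fin n → ℕ) (c : Fin k) {y : EuclideanSpace ℝ (Fin n)} (hy : y ∈ Ω) :
    |multiDeriv I (fun y ↦ Φ y c) y| ≤ ‖iteratedFDeriv ℝ (∑ i, I i) Φ y‖ := by
  refine (abs_multiDeriv_le hΩ (fun y hy ↦ contDiffAt_component (hΦ y hy) c) I hy).trans ?_
  have h1 := (EuclideanSpace.proj c :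
    EuclideanSpace ℝ (Fin k) →L[ℝ] ℝ).norm_iteratedFDeriv_comp_left (hΦ y hy) (n := ∑ i, I i) (by simp)
  refine h1.trans (mul_le_of_le_one_left (norm_nonneg _) ?_)
  refine ContinuousLinearMap.opNorm_le_bound _ zero_le_one fun v ↦ ?_
  rw [one_mul]
  exact PiLp.norm_apply_le v c

theorem norm_iteratedFDeriv_le_of_component (hΩ : IsOpen Ω) (hΦ : ∀ y ∈ Ω, ContDiffAt ℝ ω Φ y)
    {j : ℕ} {y : EuclideanSpace ℝ (Fin n)} (hy : y ∈ Ω) {B : ℝ} (hB0 : 0 ≤ B)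
    (hB : ∀ c, ∀ I : Fin n → ℕ, ∑ i, I i = j →
      |multiDeriv I (fun y ↦ Φ y c) y| ≤ B * ∏ i, ((I i).factorial : ℝ)) :
    ‖iteratedFDeriv ℝ j Φ y‖ ≤ k * (n ^ j * (B * j.factorial)) := by
  refine ContinuousMultilinearMap.opNorm_le_bound (by positivity) fun v ↦ ?_
  have h1 : ∀ c, |iteratedFDeriv ℝ j Φ y v c| ≤ n ^ j * (B * j.factorial) * ∏ r, ‖v r‖ :=
    fun c ↦ by
    have h2 := (EuclideanSpace.proj c :
      EuclideanSpace ℝ (Fin k) →L[ℝ] ℝ).iteratedFDeriv_comp_left (hΦ y hy) (i := j) (by simp)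
    have h3 : iteratedFDeriv ℝ j Φ y v c = iteratedFDeriv ℝ j (fun y ↦ Φ y c) y v :=
      (congrArg (fun T ↦ T v) h2).symm
    rw [h3, ← Real.norm_eq_abs]
    refine (ContinuousMultilinearMap.le_opNorm _ _).trans ?_
    exact mul_le_mul_of_nonneg_right (norm_iteratedFDeriv_single_le hΩ
      (fun y hy ↦ contDiffAt_component (hΦ y hy) c) hy hB0 (hB c)) (by positivity)
  rw [EuclideanSpace.norm_eq]
  refine (Real.sqrt_le_sqrt (Finset.sum_le_sum fun c _ ↦ pow_le_pow_left₀ (norm_nonneg _)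
    (h1 c) 2)).trans ?_
  rw [Finset.sum_const, Finset.card_univ, Fintype.card_fin, nsmul_eq_mul,
    Real.sqrt_mul (Nat.cast_nonneg k), Real.sqrt_sq (by positivity), mul_assoc (k : ℝ)]
  refine mul_le_mul_of_nonneg_right ?_ (by positivity)
  rw [Real.sqrt_le_iff]
  refine ⟨Nat.cast_nonneg k, ?_⟩
  exact_mod_cast Nat.le_self_pow two_ne_zero k

end

/-! ### Null sequences and geometric growth -/

/-- The product of a positive number and a null sequence. -/
def PosNullSeq.scale (a : PosNullSeq) {σ : ℝ} (hσ : 0 < σ) : PosNullSeq :=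
  ⟨fun j ↦ σ * a.1 j, fun j ↦ mul_pos hσ (a.2.1 j), by simpa using a.2.2.const_mul σ⟩

theorem PosNullSeq.partialProd_scale (a : PosNullSeq) {σ : ℝ} (hσ : 0 < σ) (m : ℕ) :
    (a.scale hσ).partialProd m = σ ^ (m + 1) * a.partialProd m := by
  simp [partialProd, scale, Finset.prod_mul_distrib]

theorem PosNullSeq.partialProd_pos (a : PosNullSeq) (m : ℕ) : 0 < a.partialProd m :=
  Finset.prod_pos fun j _ ↦ a.2.1 j

/-- From some index on, the factors are at most one and the products no longer increase. -/
theorem PosNullSeq.exists_partialProd_le (a : PosNullSeq) :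
    ∃ B, 0 ≤ B ∧ ∀ m, a.partialProd m ≤ B := by
  obtain ⟨N, hN⟩ := eventually_atTop.1 (a.2.2.eventually_le_const zero_lt_one)
  have h0 : ∀ m ≤ N, a.partialProd m ≤ ∑ i ∈ Finset.range (N + 1), a.partialProd i := fun m hm ↦
    Finset.single_le_sum (f := a.partialProd) (fun i _ ↦ (a.partialProd_pos i).le)
      (Finset.mem_range.2 (Nat.lt_succ_of_le hm))
  refine ⟨∑ i ∈ Finset.range (N + 1), a.partialProd i,
    Finset.sum_nonneg fun i _ ↦ (a.partialProd_pos i).le, fun m ↦ ?_⟩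
  rcases le_total m N with hm | hm
  · exact h0 m hm
  · induction m, hm using Nat.le_induction with
    | base => exact h0 N le_rfl
    | succ m hm ih =>
      rw [partialProd, Finset.prod_range_succ]
      exact (mul_le_of_le_one_right (a.partialProd_pos m).le (hN _ (by omega))).trans ih

theorem PosNullSeq.exists_partialProd_mul_pow_le (a : PosNullSeq) {σ : ℝ} (hσ : 0 < σ) :
    ∃ B, 0 ≤ B ∧ ∀ m, a.partialProd m * σ ^ m ≤ B := by
  obtain ⟨B, hB0, hB⟩ := (a.scale hσ).exists_partialProd_le
  -- The product up to `m` has `m + 1` factors, so scaling contributes `σ^(m+1)`, one power more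
  -- than wanted.
  refine ⟨B / σ, by positivity, fun m ↦ ?_⟩
  rw [le_div_iff₀ hσ]
  refine le_trans (le_of_eq ?_) (hB m)
  rw [partialProd_scale]
  ring

/-! ### Comparison of the seminorms in one chart -/

section
variable {n k : ℕ} {M : Type u} [TopologicalSpace M] [ChartedSpace (EuclideanSpace ℝ (Fin n)) M]
  [IsManifold (𝓡 n) ω M]
  {V : M → Type v} [TopologicalSpace (TotalSpace (EuclideanSpace ℝ (Fin k)) V)]
  [∀ x, AddCommGroup (V x)] [∀ x, Module ℝ (V x)] [∀ x, TopologicalSpace (V x)]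
  [∀ x, IsTopologicalAddGroup (V x)] [∀ x, ContinuousSMul ℝ (V x)]
  [FiberBundle (EuclideanSpace ℝ (Fin k)) V] [VectorBundle ℝ (EuclideanSpace ℝ (Fin k)) V]

theorem localSeminorm_le_ofReal_iff {K : Set (EuclideanSpace ℝ (Fin n))} {a : PosNullSeq}
    {Φ : EuclideanSpace ℝ (Fin n) → EuclideanSpace ℝ (Fin k)} {D : ℝ} (hD : 0 ≤ D) :
    localSeminorm K a Φ ≤ ENNReal.ofReal D ↔ ∀ y ∈ K, ∀ (c : Fin k) (m : ℕ) (I : Fin n → ℕ),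
      ∑ i, I i ≤ m →
      a.partialProd m * |multiDeriv I (fun y ↦ Φ y c) y| ≤ D * ∏ i, ((I i).factorial : ℝ) := by
  simp only [localSeminorm, iSup_le_iff, ENNReal.ofReal_le_ofReal_iff hD]
  refine forall₂_congr fun y _ ↦ forall₄_congr fun c m I _ ↦ ?_
  rw [div_mul_eq_mul_div, div_le_iff₀ (by positivity)]

theorem intrinsicSeminorm_le_ofReal_iff {G : GeometricData n (EuclideanSpace ℝ (Fin k)) V}
    {K : Set M} {a : PosNullSeq} {ξ : AnalyticSection n k V} {D : ℝ} (hD : 0 ≤ D) :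
    intrinsicSeminorm G K a ξ ≤ ENNReal.ofReal D ↔
      ∀ x ∈ K, ∀ m, a.partialProd m * jetNorm G m ξ x ≤ D := by
  simp only [intrinsicSeminorm, iSup_le_iff, ENNReal.ofReal_le_ofReal_iff hD]

theorem jetNorm_mono (G : GeometricData n (EuclideanSpace ℝ (Fin k)) V) {j m : ℕ} (h : j ≤ m)
    (ξ : Π x, V x) (x : M) : jetNorm G j ξ x ≤ jetNorm G m ξ x :=
  Real.sqrt_le_sqrt (Finset.sum_le_sum_of_subset_of_nonneg
    (Finset.range_mono (Nat.succ_le_succ h)) fun _ _ _ ↦ tensorNormSq_nonneg _ _ _)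

namespace VectorBundleChart

theorem contDiffAt_rep (ψ : VectorBundleChart n k V) (ξ : AnalyticSection n k V)
    {y : EuclideanSpace ℝ (Fin n)} (hy : y ∈ ψ.baseChart.target) :
    ContDiffAt ℝ ω (ψ.chartFrame.rep ξ) y := by
  have h := (ψ.chartFrame.analytic_iff _ (ψ.baseChart.map_target hy) ξ).1 (ξ.contMDiff _)
  rwa [ψ.baseChart.right_inv hy] at h

theorem pushforward_eventuallyEq (ψ : VectorBundleChart n k V) (ξ : AnalyticSection n k V)
    {y : EuclideanSpace ℝ (Fin n)} (hy : y ∈ ψ.baseChart.target) :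
    ψ.pushforward ξ =ᶠ[𝓝 y] ψ.chartFrame.rep ξ := by
  filter_upwards [ψ.baseChart.open_target.mem_nhds hy] with z hz using ψ.pushforward_eq_rep ξ hz

theorem contDiffAt_pushforward (ψ : VectorBundleChart n k V) (ξ : AnalyticSection n k V) :
    ∀ y ∈ ψ.baseChart.target, ContDiffAt ℝ ω (ψ.pushforward ξ) y := fun _ hy ↦
  (ψ.contDiffAt_rep ξ hy).congr_of_eventuallyEq (ψ.pushforward_eventuallyEq ξ hy)

theorem iteratedFDeriv_pushforward (ψ : VectorBundleChart n k V) (ξ : AnalyticSection n k V)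
    {y : EuclideanSpace ℝ (Fin n)} (hy : y ∈ ψ.baseChart.target) (j : ℕ) :
    iteratedFDeriv ℝ j (ψ.pushforward ξ) y = iteratedFDeriv ℝ j (ψ.chartFrame.rep ξ) y :=
  ((ψ.pushforward_eventuallyEq ξ hy).iteratedFDeriv ℝ j).eq_of_nhds

/-- The loss `τ^m` in the pointwise estimate is moved into the weight sequence, which stays a null
sequence when scaled by `τ`. -/
theorem exists_intrinsicSeminorm_le (ψ : VectorBundleChart n k V)
    (G : GeometricData n (EuclideanSpace ℝ (Fin k)) V) {K : Set (EuclideanSpace ℝ (Fin n))}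
    (hK : IsCompact K) (hKψ : K ⊆ ψ.baseChart.target) (a : PosNullSeq) :
    ∃ (b : PosNullSeq) (C : ℝ), 0 ≤ C ∧ ∀ (ξ : AnalyticSection n k V) (D : ℝ), 0 ≤ D →
      localSeminorm K b (ψ.pushforward ξ) ≤ ENNReal.ofReal D →
      intrinsicSeminorm G (ψ.baseChart.symm '' K) a ξ ≤ ENNReal.ofReal (C * D) := by
  obtain ⟨C, σ, hC, hσ, h⟩ := exists_jetNorm_le G ψ.baseChart_mem ψ.chartFrame hK hKψ
  -- `σ` comes from the jet estimate and `n` from the multi-indices; adding 1 makes `τ` positive and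
  -- its powers monotone in the exponent.
  set τ := (1 + σ) * (1 + n) with hτ
  have hτ0 : 0 < τ := by positivity
  refine ⟨a.scale hτ0, C * k / τ, by positivity, fun ξ D hD h1 ↦ ?_⟩
  rw [localSeminorm_le_ofReal_iff hD] at h1
  rw [intrinsicSeminorm_le_ofReal_iff (by positivity)]
  rintro _ ⟨y, hy, rfl⟩ m
  have hp := a.partialProd_pos m
  -- At weight level `m` the local seminorm bounds all orders `|I| ≤ m` at once, so one `B` serves
  -- every `j ≤ m`.
  set B := D / (τ ^ (m + 1) * a.partialProd m) with hB
  have hB0 : 0 ≤ B := by positivity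
  have h2 : ∀ j ≤ m, ‖iteratedFDeriv ℝ j (ψ.chartFrame.rep ξ) y‖ ≤
      k * (1 + n) ^ m * B * j.factorial := fun j hj ↦ by
    rw [← ψ.iteratedFDeriv_pushforward ξ (hKψ hy)]
    refine (norm_iteratedFDeriv_le_of_component ψ.baseChart.open_target
      (ψ.contDiffAt_pushforward ξ) (hKψ hy) hB0 fun c I hI ↦ ?_).trans ?_
    · have h3 := h1 y hy c m I (hI.trans_le hj)
      rw [a.partialProd_scale, ← le_div_iff₀' (by positivity)] at h3
      exact h3.trans_eq (by rw [hB]; ring)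
    · have h4 : (n : ℝ) ^ j ≤ (1 + n) ^ m :=
        (pow_le_pow_left₀ (by positivity) (by linarith) j).trans
          (pow_le_pow_right₀ (by linarith [Nat.cast_nonneg (α := ℝ) n]) hj)
      rw [mul_assoc, mul_assoc]
      gcongr
  have h5 : σ ^ m ≤ (1 + σ) ^ m := pow_le_pow_left₀ hσ (by linarith) m
  calc a.partialProd m * jetNorm G m ξ (ψ.baseChart.symm y)
      ≤ a.partialProd m * (C * (1 + σ) ^ m * (k * (1 + n) ^ m * B)) := by
        gcongr
        exact (h y hy ξ (fun z hz ↦ ψ.contDiffAt_rep ξ hz) m _ h2).trans (by gcongr)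
    _ = C * k / τ * D := by
        have : τ ^ (m + 1) = (1 + σ) ^ m * (1 + n) ^ m * τ := by rw [pow_succ, hτ, mul_pow]
        rw [hB, this]
        field_simp

theorem exists_localSeminorm_le (ψ : VectorBundleChart n k V)
    (G : GeometricData n (EuclideanSpace ℝ (Fin k)) V) {K : Set (EuclideanSpace ℝ (Fin n))}
    (hK : IsCompact K) (hKψ : K ⊆ ψ.baseChart.target) (a : PosNullSeq) :
    ∃ (b : PosNullSeq) (C : ℝ), 0 ≤ C ∧ ∀ (ξ : AnalyticSection n k V) (D : ℝ), 0 ≤ D →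
      intrinsicSeminorm G (ψ.baseChart.symm '' K) b ξ ≤ ENNReal.ofReal D →
      localSeminorm K a (ψ.pushforward ξ) ≤ ENNReal.ofReal (C * D) := by
  obtain ⟨C, σ, hC, hσ, h⟩ :=
    exists_norm_iteratedFDeriv_le_jetNorm G ψ.baseChart_mem ψ.chartFrame hK hKψ
  set τ := (1 + σ) * (1 + n) with hτ
  have hτ0 : 0 < τ := by positivity
  refine ⟨a.scale hτ0, C / τ, by positivity, fun ξ D hD h1 ↦ ?_⟩
  rw [intrinsicSeminorm_le_ofReal_iff hD] at h1
  rw [localSeminorm_le_ofReal_iff (by positivity)]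
  intro y hy c m I hI
  have hp := a.partialProd_pos m
  have h2 := h1 _ (mem_image_of_mem _ hy) m
  rw [a.partialProd_scale] at h2
  set J := jetNorm G m ξ (ψ.baseChart.symm y) with hJ
  have hJ0 : 0 ≤ J := jetNorm_nonneg _ _ _ _
  -- The estimate is used at order `|I|`; monotonicity of the jet norm then raises it to the level
  -- `m` of the weight.
  have h3 := h y hy ξ (fun z hz ↦ ψ.contDiffAt_rep ξ hz) (∑ i, I i)
  have h4 : σ ^ (∑ i, I i) * n ^ (∑ i, I i) ≤ τ ^ m := by
    rw [← mul_pow]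
    have h1n : (0 : ℝ) ≤ n := Nat.cast_nonneg n
    refine (pow_le_pow_left₀ (by positivity) (?_ : σ * n ≤ τ) _).trans
      (pow_le_pow_right₀ (by nlinarith [mul_nonneg hσ h1n]) hI)
    nlinarith
  have h5 : |multiDeriv I (fun y ↦ ψ.pushforward ξ y c) y| ≤
      C * τ ^ m * J * ∏ i, ((I i).factorial : ℝ) := by
    refine (abs_multiDeriv_component_le ψ.baseChart.open_target (ψ.contDiffAt_pushforward ξ) I c
      (hKψ hy)).trans ?_
    rw [ψ.iteratedFDeriv_pushforward ξ (hKψ hy)]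
    calc _ ≤ C * σ ^ (∑ i, I i) * (n ^ (∑ i, I i) * ∏ i, ((I i).factorial : ℝ)) * J := by
          refine h3.trans ?_
          gcongr
          · exact jetNorm_nonneg _ _ _ _
          · exact factorial_sum_le I
          · exact jetNorm_mono G hI _ _
      _ = C * (σ ^ (∑ i, I i) * n ^ (∑ i, I i)) * J * ∏ i, ((I i).factorial : ℝ) := by ring
      _ ≤ _ := by gcongr
  calc _ ≤ a.partialProd m * (C * τ ^ m * J * ∏ i, ((I i).factorial : ℝ)) := by gcongr
    _ = C / τ * (τ ^ (m + 1) * a.partialProd m * J) * ∏ i, ((I i).factorial : ℝ) := by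
        rw [pow_succ]
        field_simp
    _ ≤ _ := by gcongr

/-- Cauchy bounds on `K` give derivatives of size `C |I|! / r^|I|`, and `|I|! ≤ n^|I| I!`. The
products `a_0 ⋯ a_m` beat the remaining geometric growth `(1 + n / r)^m`. -/
theorem exists_localSeminorm_le_ofReal (ψ : VectorBundleChart n k V)
    {K : Set (EuclideanSpace ℝ (Fin n))}
    (hK : IsCompact K) (hKψ : K ⊆ ψ.baseChart.target) (a : PosNullSeq)
    (ξ : AnalyticSection n k V) :
    ∃ D, 0 ≤ D ∧ localSeminorm K a (ψ.pushforward ξ) ≤ ENNReal.ofReal D := by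
  have hf := ψ.contDiffAt_pushforward ξ
  obtain ⟨C, r, hr, h⟩ := exists_jetSum_le_of_isCompact hK fun y hy ↦
    (hf y (hKψ hy)).analyticAt
  obtain ⟨B, hB0, hB⟩ := a.exists_partialProd_mul_pow_le (show 0 < 1 + n / r by positivity)
  refine ⟨B * max C 0, by positivity, (localSeminorm_le_ofReal_iff (by positivity)).2
    fun y hy c m I hI ↦ ?_⟩
  have hp := a.partialProd_pos m
  have h1 := (norm_iteratedFDeriv_le_jetSum hr le_rfl (ψ.pushforward ξ) y).trans
    (mul_le_mul_of_nonneg_left ((h y hy (∑ i, I i)).trans (le_max_left C 0)) (by positivity))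
  have h2 : (n / r) ^ (∑ i, I i) ≤ (1 + n / r) ^ m :=
    (pow_le_pow_left₀ (by positivity) (by linarith) _).trans
      (pow_le_pow_right₀ (le_add_of_nonneg_right (by positivity)) hI)
  have h3 : |multiDeriv I (fun y ↦ ψ.pushforward ξ y c) y| ≤
      (1 + n / r) ^ m * (∏ i, ((I i).factorial : ℝ)) * max C 0 :=
    calc _ ≤ n ^ (∑ i, I i) * (∏ i, ((I i).factorial : ℝ)) / r ^ (∑ i, I i) * max C 0 := by
          refine (abs_multiDeriv_component_le ψ.baseChart.open_target hf I c (hKψ hy)).trans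
            (h1.trans ?_)
          gcongr
          exact factorial_sum_le I
      _ = (n / r) ^ (∑ i, I i) * (∏ i, ((I i).factorial : ℝ)) * max C 0 := by
          rw [div_pow]
          ring
      _ ≤ _ := by gcongr
  calc _ ≤ a.partialProd m * ((1 + n / r) ^ m * (∏ i, ((I i).factorial : ℝ)) * max C 0) := by
        gcongr
    _ = a.partialProd m * (1 + n / r) ^ m * max C 0 * ∏ i, ((I i).factorial : ℝ) := by ring
    _ ≤ _ := by gcongr; exact hB m

end VectorBundleChart
end

/-! ### The seminorm property -/

/-- A finite sublinear and absolutely homogeneous function is a seminorm. -/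
theorem exists_seminorm_of_ennreal {Γ : Type*} [AddCommGroup Γ] [Module ℝ Γ] (P : Γ → ℝ≥0∞)
    (hfin : ∀ ξ, ∃ D, 0 ≤ D ∧ P ξ ≤ ENNReal.ofReal D)
    (hadd : ∀ ξ η D D', 0 ≤ D → 0 ≤ D' → P ξ ≤ ENNReal.ofReal D → P η ≤ ENNReal.ofReal D' →
      P (ξ + η) ≤ ENNReal.ofReal (D + D'))
    (hsmul : ∀ (c : ℝ) ξ D, 0 ≤ D → P ξ ≤ ENNReal.ofReal D →
      P (c • ξ) ≤ ENNReal.ofReal (|c| * D)) :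
    ∃ q : Seminorm ℝ Γ, ∀ ξ, ENNReal.ofReal (q ξ) = P ξ := by
  have hP : ∀ ξ, ENNReal.ofReal (P ξ).toReal = P ξ := fun ξ ↦ by
    obtain ⟨D, -, h⟩ := hfin ξ
    exact ENNReal.ofReal_toReal (ne_top_of_le_ne_top ENNReal.ofReal_ne_top h)
  refine ⟨Seminorm.ofSMulLE (fun ξ ↦ (P ξ).toReal) ?_ (fun ξ η ↦ ?_) fun c ξ ↦ ?_, hP⟩
  · have h := hsmul 0 0 (P 0).toReal ENNReal.toReal_nonneg (hP 0).ge
    rw [zero_smul, abs_zero, zero_mul, ENNReal.ofReal_zero, nonpos_iff_eq_zero] at h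
    rw [h, ENNReal.toReal_zero]
  · exact ENNReal.toReal_le_of_le_ofReal
      (add_nonneg ENNReal.toReal_nonneg ENNReal.toReal_nonneg)
      (hadd ξ η _ _ ENNReal.toReal_nonneg ENNReal.toReal_nonneg (hP ξ).ge (hP η).ge)
  · exact ENNReal.toReal_le_of_le_ofReal (mul_nonneg (norm_nonneg _) ENNReal.toReal_nonneg)
      (hsmul c ξ _ ENNReal.toReal_nonneg (hP ξ).ge)

section
variable {n : ℕ} {Ω : Set (EuclideanSpace ℝ (Fin n))}

theorem multiDeriv_congr (hΩ : IsOpen Ω) (I : Fin n → ℕ) {f g : EuclideanSpace ℝ (Fin n) → ℝ}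
    (hfg : EqOn f g Ω) : EqOn (multiDeriv I f) (multiDeriv I g) Ω := by
  rw [multiDeriv_eq_foldr, multiDeriv_eq_foldr]
  induction indexList I with
  | nil => exact hfg
  | cons i l ih => exact partialDeriv_congr hΩ i ih

theorem multiDeriv_add (hΩ : IsOpen Ω) (I : Fin n → ℕ) {f g : EuclideanSpace ℝ (Fin n) → ℝ}
    (hf : ∀ y ∈ Ω, ContDiffAt ℝ ω f y) (hg : ∀ y ∈ Ω, ContDiffAt ℝ ω g y) :
    EqOn (multiDeriv I fun y ↦ f y + g y) (fun y ↦ multiDeriv I f y + multiDeriv I g y) Ω := by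
  simp only [multiDeriv_eq_foldr]
  induction indexList I with
  | nil => exact fun _ _ ↦ rfl
  | cons i l ih =>
    refine (partialDeriv_congr hΩ i ih).trans fun y hy ↦ ?_
    have h1 := (contDiffAt_foldr_partialDeriv l (hf y hy)).differentiableAt (by simp)
    have h2 := (contDiffAt_foldr_partialDeriv l (hg y hy)).differentiableAt (by simp)
    rw [partialDeriv, fderiv_fun_add h1 h2]
    rfl

theorem multiDeriv_const_mul (hΩ : IsOpen Ω) (I : Fin n → ℕ) (c : ℝ)
    {f : EuclideanSpace ℝ (Fin n) → ℝ} (hf : ∀ y ∈ Ω, ContDiffAt ℝ ω f y) :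
    EqOn (multiDeriv I fun y ↦ c * f y) (fun y ↦ c * multiDeriv I f y) Ω := by
  simp only [multiDeriv_eq_foldr]
  induction indexList I with
  | nil => exact fun _ _ ↦ rfl
  | cons i l ih =>
    refine (partialDeriv_congr hΩ i ih).trans fun y hy ↦ ?_
    have h1 := (contDiffAt_foldr_partialDeriv l (hf y hy)).differentiableAt (by simp)
    rw [partialDeriv, fderiv_const_mul h1]
    rfl
end

section
variable {E F : Type*} [AddCommGroup E] [Module ℝ E] [AddCommGroup F] [Module ℝ F] {m : ℕ}

theorem multilinearMap_eq_of_diagonal {S T : MultilinearMap ℝ (fun _ : Fin m ↦ E) F}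
    (hS : ∀ (σ : Equiv.Perm (Fin m)) v, S (v ∘ σ) = S v)
    (hT : ∀ (σ : Equiv.Perm (Fin m)) v, T (v ∘ σ) = T v)
    (h : ∀ v, (S fun _ ↦ v) = T fun _ ↦ v) : S = T := by
  ext w
  have h1 := factorial_smul_eq_sum_diagonal S hS w
  simp only [h] at h1
  rw [← factorial_smul_eq_sum_diagonal T hT w] at h1
  exact smul_right_injective F (by positivity : (m.factorial : ℝ) ≠ 0) h1
end

section
variable {E F : Type u} [NormedAddCommGroup E] [NormedSpace ℝ E] [NormedAddCommGroup F]
  [NormedSpace ℝ F] {Γ : E → E →L[ℝ] E →L[ℝ] E} {A : E → E →L[ℝ] F →L[ℝ] F} {Ω : Set E}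

theorem iterate_sprayOp_linearCombination (hΩ : IsOpen Ω) (hΓ : ∀ y ∈ Ω, ContDiffAt ℝ ω Γ y)
    (hA : ∀ y ∈ Ω, ContDiffAt ℝ ω A y) (a b : ℝ) {f g h : E × E → F}
    (hf : ∀ p, p.1 ∈ Ω → ContDiffAt ℝ ω f p) (hg : ∀ p, p.1 ∈ Ω → ContDiffAt ℝ ω g p)
    (hh : ∀ p, p.1 ∈ Ω → h p = a • f p + b • g p) (m : ℕ) : ∀ p : E × E, p.1 ∈ Ω →
    (sprayOp Γ A)^[m] h p =
      a • ((sprayOp Γ A)^[m] f p) + b • ((sprayOp Γ A)^[m] g p) := by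
  induction m with
  | zero => exact fun p hp ↦ hh _ hp
  | succ m ih =>
    intro p hp
    simp only [Function.iterate_succ_apply']
    have h1 : (sprayOp Γ A)^[m] h =ᶠ[𝓝 p] fun p ↦
        a • ((sprayOp Γ A)^[m] f p) + b • ((sprayOp Γ A)^[m] g p) := by
      filter_upwards [(hΩ.preimage continuous_fst).mem_nhds hp] with q hq using ih q hq
    have hd : ∀ {f : E × E → F}, (∀ p, p.1 ∈ Ω → ContDiffAt ℝ ω f p) →
        DifferentiableAt ℝ ((sprayOp Γ A)^[m] f) p := fun hf ↦
      (contDiffAt_iterate_sprayOp (hΓ _ hp) (hA _ hp) (hf _ hp) m).differentiableAt (by simp)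
    have h2 := ((hd hf).hasFDerivAt.const_smul a).add ((hd hg).hasFDerivAt.const_smul b)
    rw [sprayOp, (h2.congr_of_eventuallyEq h1).fderiv, h1.eq_of_nhds, sprayOp, sprayOp]
    simp only [_root_.add_apply, _root_.smul_apply, map_add, map_smul, smul_add]
    abel
end

section
variable {n : ℕ} {M : Type u} [TopologicalSpace M] [ChartedSpace (EuclideanSpace ℝ (Fin n)) M]
  [IsManifold (𝓡 n) ω M]
  {F : Type} [NormedAddCommGroup F] [NormedSpace ℝ F] [FiniteDimensional ℝ F]
  {V : M → Type v} [TopologicalSpace (TotalSpace F V)]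
  [∀ x, AddCommGroup (V x)] [∀ x, Module ℝ (V x)] [∀ x, TopologicalSpace (V x)]
  [∀ x, IsTopologicalAddGroup (V x)] [∀ x, ContinuousSMul ℝ (V x)]
  [FiberBundle F V] [VectorBundle ℝ F V]
  {φ : OpenPartialHomeomorph M (EuclideanSpace ℝ (Fin n))}

/-- A covariant derivative is additive only on differentiable sections. Rather than following the
regularity of every iterate, the diagonals are compared through the linear spray operators, and
polarization recovers the tensors. -/
theorem symCovDeriv_linearCombination (hφ : φ ∈ IsManifold.maximalAtlas (𝓡 n) ω M)
    (e : ChartFrame F V φ) (G : GeometricData n F V) {ξ η ζ : Π x, V x}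
    (hξ : ∀ y ∈ φ.target, ContDiffAt ℝ ω (e.rep ξ) y)
    (hη : ∀ y ∈ φ.target, ContDiffAt ℝ ω (e.rep η) y) {a b : ℝ}
    (hζ : ∀ x, ζ x = a • ξ x + b • η x) {x : M} (hx : x ∈ φ.source) (m : ℕ) :
    symCovDeriv G.baseConnection G.fibreConnection m ζ x =
      a • symCovDeriv G.baseConnection G.fibreConnection m ξ x +
      b • symCovDeriv G.baseConnection G.fibreConnection m η x := by
  obtain ⟨Γ, hΓ⟩ := exists_isConnectionForm hφ (tangentFrame hφ) G.analytic_baseConnection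
  obtain ⟨A, hA⟩ := exists_isConnectionForm hφ e G.analytic_fibreConnection
  have hy := φ.map_source hx
  have hrep : ∀ y, e.rep ζ y = a • e.rep ξ y + b • e.rep η y := fun y ↦ by
    simp only [ChartFrame.rep, hζ, map_add, map_smul]
  have hζ' : ∀ y ∈ φ.target, ContDiffAt ℝ ω (e.rep ζ) y := fun y hy ↦ by
    rw [funext hrep]
    exact ((hξ y hy).const_smul a).add ((hη y hy).const_smul b)
  refine multilinearMap_eq_of_diagonal (fun σ v ↦ symmetrize_comp_perm _ σ v) (fun σ v ↦ ?_)
    fun v ↦ ?_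
  · simp only [_root_.add_apply, _root_.smul_apply, symCovDeriv, symmetrize_comp_perm]
  · have key := iterate_sprayOp_linearCombination φ.open_target hΓ.analytic hA.analytic a b
      (fun p hp ↦ (hξ _ hp).comp p contDiffAt_fst) (fun p hp ↦ (hη _ hp).comp p contDiffAt_fst)
      (fun p _ ↦ hrep p.1) m (φ x, (tangentFrame hφ).coord x v) hy
    change (sprayOp Γ A)^[m] (fun p ↦ e.rep ζ p.1) _ = a • ((sprayOp Γ A)^[m]
      (fun p ↦ e.rep ξ p.1) _) + b • ((sprayOp Γ A)^[m] (fun p ↦ e.rep η p.1) _) at key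
    rw [← coord_symCovDeriv_diagonal hφ hΓ e hA hζ' hy, ← coord_symCovDeriv_diagonal hφ hΓ e hA hξ hy,
      ← coord_symCovDeriv_diagonal hφ hΓ e hA hη hy, φ.left_inv hx,
      (tangentFrame hφ).frame_coord x hx] at key
    have := congrArg (e.frame x) key
    rwa [map_add, map_smul, map_smul, e.frame_coord x hx, e.frame_coord x hx,
      e.frame_coord x hx] at this

/-- Minkowski's inequality with exponent 2. -/
theorem sqrt_sum_add_le {ι : Type*} (s : Finset ι) {p q r : ι → ℝ} (hp : ∀ i ∈ s, 0 ≤ p i)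
    (hq : ∀ i ∈ s, 0 ≤ q i) (h : ∀ i ∈ s, √(r i) ≤ √(p i) + √(q i)) :
    √(∑ i ∈ s, r i) ≤ √(∑ i ∈ s, p i) + √(∑ i ∈ s, q i) := by
  have h1 : ∑ i ∈ s, r i ≤ ∑ i ∈ s, (√(p i) + √(q i)) ^ 2 :=
    Finset.sum_le_sum fun i hi ↦ (Real.sqrt_le_left
      (add_nonneg (Real.sqrt_nonneg _) (Real.sqrt_nonneg _))).1 (h i hi)
  refine (Real.sqrt_le_sqrt h1).trans ?_
  have h2 := Real.Lp_add_le_of_nonneg (p := 2) s one_le_two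
    (fun i _ ↦ Real.sqrt_nonneg (p i)) (fun i _ ↦ Real.sqrt_nonneg (q i))
  simp only [Real.rpow_ofNat, ← Real.sqrt_eq_rpow] at h2
  rw [Finset.sum_congr rfl fun i hi ↦ Real.sq_sqrt (hp i hi),
    Finset.sum_congr rfl fun i hi ↦ Real.sq_sqrt (hq i hi)] at h2
  exact h2

omit [FiniteDimensional ℝ F] in
theorem sqrt_inner_add_le (g : ContMDiffRiemannianMetric (𝓡 n) ω F V) {x : M} (w w' : V x) :
    √(g.inner x (w + w') (w + w')) ≤ √(g.inner x w w) + √(g.inner x w' w') := by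
  let B : LinearMap.BilinForm ℝ (V x) :=
    (ContinuousLinearMap.coeLM ℝ).comp (g.inner x).toLinearMap
  have h1 : (g.inner x w w') ^ 2 ≤ g.inner x w w * g.inner x w' w' :=
    LinearMap.BilinForm.apply_sq_le_of_symm B (fun z ↦ inner_self_nonneg g z)
      ⟨fun z z' ↦ g.symm x z z'⟩ w w'
  have h2 := Real.abs_le_sqrt h1
  rw [Real.sqrt_mul (inner_self_nonneg g w)] at h2
  rw [Real.sqrt_le_left (by positivity), add_sq, Real.sq_sqrt (inner_self_nonneg g w),
    Real.sq_sqrt (inner_self_nonneg g w')]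
  simp only [map_add, _root_.add_apply]
  rw [g.symm x w' w]
  linarith [le_abs_self (g.inner x w w')]

omit [FiniteDimensional ℝ F] in
theorem sqrt_tensorNormSq_add_le (gM : AnalyticRiemannianMetric n M)
    (gV : ContMDiffRiemannianMetric (𝓡 n) ω F V) {m : ℕ} {x : M}
    (S T : MultilinearMap ℝ (fun _ : Fin m ↦ TangentSpace (𝓡 n) x) (V x)) :
    √(tensorNormSq gM gV (S + T)) ≤ √(tensorNormSq gM gV S) + √(tensorNormSq gM gV T) :=
  sqrt_sum_add_le _ (fun _ _ ↦ inner_self_nonneg gV _) (fun _ _ ↦ inner_self_nonneg gV _)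
    fun _ _ ↦ sqrt_inner_add_le gV _ _

end

/-! ### Globalisation and equality of the topologies -/

section
variable {n k : ℕ} {M : Type u} [TopologicalSpace M] [ChartedSpace (EuclideanSpace ℝ (Fin n)) M]
  [IsManifold (𝓡 n) ω M]
  {V : M → Type v} [TopologicalSpace (TotalSpace (EuclideanSpace ℝ (Fin k)) V)]
  [∀ x, AddCommGroup (V x)] [∀ x, Module ℝ (V x)] [∀ x, TopologicalSpace (V x)]
  [∀ x, IsTopologicalAddGroup (V x)] [∀ x, ContinuousSMul ℝ (V x)]
  [FiberBundle (EuclideanSpace ℝ (Fin k)) V] [VectorBundle ℝ (EuclideanSpace ℝ (Fin k)) V]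

variable (n k V) in
theorem exists_vectorBundleChart [ContMDiffVectorBundle ω (EuclideanSpace ℝ (Fin k)) V (𝓡 n)]
    (x : M) : ∃ ψ : VectorBundleChart n k V, x ∈ ψ.baseChart.source := by
  let e := trivializationAt (EuclideanSpace ℝ (Fin k)) V x
  let φ := chartAt (EuclideanSpace ℝ (Fin n)) x
  refine ⟨{ baseChart := φ.restr e.baseSet
            baseChart_mem := restr_mem_maximalAtlas _
              (IsManifold.chart_mem_maximalAtlas x) e.open_baseSet
            triv := e.restrOpen φ.source φ.open_source
            baseSet_eq := ?_
            isLinear := ⟨fun b hb ↦ e.linear ℝ hb.1⟩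
            analyticOn := (e.contMDiffOn (n := ω) (IB := 𝓡 n)).mono ?_
            analyticOn_symm := (e.contMDiffOn_symm (n := ω) (IB := 𝓡 n)).mono ?_ }, ?_⟩
  · rw [φ.restr_source, e.open_baseSet.interior_eq, inter_comm]
    rfl
  · rw [Trivialization.source_eq, e.source_eq]
    exact preimage_mono inter_subset_left
  · rw [Trivialization.target_eq, e.target_eq]
    exact prod_mono inter_subset_left le_rfl
  · rw [φ.restr_source, e.open_baseSet.interior_eq]
    exact ⟨mem_chart_source _ x, FiberBundle.mem_baseSet_trivializationAt' x⟩

/-- Domination by finitely many local seminorms passes to subsets and finite unions. By compactness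
it is enough to find, around each point, a neighbourhood that is the image of a compact set in a
chart. -/
theorem exists_intrinsicSeminorm_le [ContMDiffVectorBundle ω (EuclideanSpace ℝ (Fin k)) V (𝓡 n)]
    (G : GeometricData n (EuclideanSpace ℝ (Fin k)) V) {K : Set M} (hK : IsCompact K)
    (a : PosNullSeq) :
    ∃ (T : Finset (ChartWithCompact n k V × PosNullSeq)) (C : ℝ), 0 ≤ C ∧
      ∀ (ξ : AnalyticSection n k V) (D : ℝ), 0 ≤ D →
      (∀ i ∈ T, localSeminorm i.1.2.1 i.2 (i.1.1.pushforward ξ) ≤ ENNReal.ofReal D) →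
      intrinsicSeminorm G K a ξ ≤ ENNReal.ofReal (C * D) := by
  classical
  have hmono : ∀ (s t : Set M) (ξ : AnalyticSection n k V), s ⊆ t →
      intrinsicSeminorm G s a ξ ≤ intrinsicSeminorm G t a ξ := fun s t ξ h ↦
    biSup_mono fun x hx ↦ h hx
  refine hK.induction_on (p := fun s ↦
    ∃ (T : Finset (ChartWithCompact n k V × PosNullSeq)) (C : ℝ), 0 ≤ C ∧
      ∀ (ξ : AnalyticSection n k V) (D : ℝ), 0 ≤ D →
      (∀ i ∈ T, localSeminorm i.1.2.1 i.2 (i.1.1.pushforward ξ) ≤ ENNReal.ofReal D) →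
      intrinsicSeminorm G s a ξ ≤ ENNReal.ofReal (C * D)) ?_ ?_ ?_ ?_
  · exact ⟨∅, 0, le_rfl, fun ξ D _ _ ↦ by simp [intrinsicSeminorm]⟩
  · rintro s t hst ⟨T, C, hC, h⟩
    exact ⟨T, C, hC, fun ξ D hD hT ↦ (hmono s t ξ hst).trans (h ξ D hD hT)⟩
  · rintro s t ⟨T, C, hC, h⟩ ⟨T', C', hC', h'⟩
    refine ⟨T ∪ T', max C C', le_max_of_le_left hC, fun ξ D hD hT ↦ ?_⟩
    rw [intrinsicSeminorm, iSup_union]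
    refine sup_le ((h ξ D hD fun i hi ↦ hT i (Finset.mem_union_left _ hi)).trans ?_)
      ((h' ξ D hD fun i hi ↦ hT i (Finset.mem_union_right _ hi)).trans ?_)
    · exact ENNReal.ofReal_le_ofReal (mul_le_mul_of_nonneg_right (le_max_left _ _) hD)
    · exact ENNReal.ofReal_le_ofReal (mul_le_mul_of_nonneg_right (le_max_right _ _) hD)
  · intro x _
    obtain ⟨ψ, hx⟩ := exists_vectorBundleChart n k V x
    obtain ⟨L, hL, hxL, hLψ⟩ := exists_compact_subset ψ.baseChart.open_target
      (ψ.baseChart.map_source hx)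
    obtain ⟨b, C, hC, h⟩ := ψ.exists_intrinsicSeminorm_le G hL hLψ a
    refine ⟨ψ.baseChart.symm '' L, mem_nhdsWithin_of_mem_nhds ?_, {(⟨ψ, L, hL, hLψ⟩, b)}, C, hC,
      fun ξ D hD hT ↦ h ξ D hD (hT _ (Finset.mem_singleton_self _))⟩
    filter_upwards [ψ.baseChart.open_source.mem_nhds hx,
      (ψ.baseChart.continuousAt hx).preimage_mem_nhds (mem_interior_iff_mem_nhds.1 hxL)] with z hz hzL
    exact ⟨_, hzL, ψ.baseChart.left_inv hz⟩

theorem exists_seminorm_localSeminorm (ψ : VectorBundleChart n k V)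
    {K : Set (EuclideanSpace ℝ (Fin n))} (hK : IsCompact K) (hKψ : K ⊆ ψ.baseChart.target)
    (a : PosNullSeq) :
    ∃ q : Seminorm ℝ (AnalyticSection n k V),
      ∀ ξ, ENNReal.ofReal (q ξ) = localSeminorm K a (ψ.pushforward ξ) := by
  have hΩ := ψ.baseChart.open_target
  have hf : ∀ ξ, ∀ c, ∀ y ∈ ψ.baseChart.target,
      ContDiffAt ℝ ω (fun y ↦ ψ.pushforward ξ y c) y := fun ξ c y hy ↦
    contDiffAt_component (ψ.contDiffAt_pushforward ξ y hy) c
  refine exists_seminorm_of_ennreal _ (ψ.exists_localSeminorm_le_ofReal hK hKψ a)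
    (fun ξ η D D' hD hD' h h' ↦ ?_) fun r ξ D hD h ↦ ?_
  · rw [localSeminorm_le_ofReal_iff hD] at h
    rw [localSeminorm_le_ofReal_iff hD'] at h'
    rw [localSeminorm_le_ofReal_iff (add_nonneg hD hD')]
    intro y hy c m I hI
    -- Additivity is available over the chart target, where the trivialization is linear; the target
    -- is open, so the identity may be differentiated.
    have h1 : EqOn (fun y ↦ ψ.pushforward (ξ + η) y c)
        (fun y ↦ ψ.pushforward ξ y c + ψ.pushforward η y c) ψ.baseChart.target := fun z hz ↦ by
      simp only [ψ.pushforward_eq_rep _ hz, ChartFrame.rep, ContMDiffSection.coe_add, Pi.add_apply,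
        map_add, PiLp.add_apply]
    rw [multiDeriv_congr hΩ I h1 (hKψ hy), multiDeriv_add hΩ I (hf ξ c) (hf η c) (hKψ hy), add_mul]
    refine (mul_le_mul_of_nonneg_left (abs_add_le _ _) (a.partialProd_pos m).le).trans ?_
    rw [mul_add]
    exact add_le_add (h y hy c m I hI) (h' y hy c m I hI)
  · rw [localSeminorm_le_ofReal_iff hD] at h
    rw [localSeminorm_le_ofReal_iff (by positivity)]
    intro y hy c m I hI
    have h1 : EqOn (fun y ↦ ψ.pushforward (r • ξ) y c)
        (fun y ↦ r * ψ.pushforward ξ y c) ψ.baseChart.target := fun z hz ↦ by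
      simp only [ψ.pushforward_eq_rep _ hz, ChartFrame.rep, ContMDiffSection.coe_smul,
        Pi.smul_apply, map_smul, PiLp.smul_apply, smul_eq_mul]
    rw [multiDeriv_congr hΩ I h1 (hKψ hy), multiDeriv_const_mul hΩ I r (hf ξ c) (hKψ hy), abs_mul,
      mul_left_comm, mul_assoc]
    exact mul_le_mul_of_nonneg_left (h y hy c m I hI) (abs_nonneg r)

variable [ContMDiffVectorBundle ω (EuclideanSpace ℝ (Fin k)) V (𝓡 n)]

theorem jetNorm_add_le (G : GeometricData n (EuclideanSpace ℝ (Fin k)) V) (m : ℕ)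
    (ξ η : AnalyticSection n k V) (x : M) :
    jetNorm G m (ξ + η : AnalyticSection n k V) x ≤ jetNorm G m ξ x + jetNorm G m η x := by
  obtain ⟨ψ, hx⟩ := exists_vectorBundleChart n k V x
  refine sqrt_sum_add_le _ (fun _ _ ↦ tensorNormSq_nonneg _ _ _)
    (fun _ _ ↦ tensorNormSq_nonneg _ _ _) fun j _ ↦ ?_
  have h := symCovDeriv_linearCombination ψ.baseChart_mem ψ.chartFrame G
    (fun _ ↦ ψ.contDiffAt_rep ξ) (fun _ ↦ ψ.contDiffAt_rep η) (ζ := (ξ + η : AnalyticSection n k V))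
    (a := 1) (b := 1) (fun z ↦ by simp) hx j
  rw [h, one_smul, one_smul, smul_add]
  exact sqrt_tensorNormSq_add_le _ _ _ _

theorem jetNorm_smul (G : GeometricData n (EuclideanSpace ℝ (Fin k)) V) (m : ℕ) (c : ℝ)
    (ξ : AnalyticSection n k V) (x : M) :
    jetNorm G m (c • ξ : AnalyticSection n k V) x = |c| * jetNorm G m ξ x := by
  obtain ⟨ψ, hx⟩ := exists_vectorBundleChart n k V x
  rw [jetNorm, jetNorm, ← Real.sqrt_sq_eq_abs, ← Real.sqrt_mul (sq_nonneg c), Finset.mul_sum]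
  congr 1
  refine Finset.sum_congr rfl fun j _ ↦ ?_
  have h := symCovDeriv_linearCombination ψ.baseChart_mem ψ.chartFrame G
    (fun _ ↦ ψ.contDiffAt_rep ξ) (fun _ ↦ ψ.contDiffAt_rep ξ) (ζ := (c • ξ : AnalyticSection n k V))
    (a := c) (b := 0) (fun z ↦ by simp) hx j
  rw [h, zero_smul, add_zero, smul_comm, tensorNormSq_smul]

theorem exists_seminorm_intrinsicSeminorm (G : GeometricData n (EuclideanSpace ℝ (Fin k)) V)
    {K : Set M} (hK : IsCompact K) (a : PosNullSeq) :
    ∃ p : Seminorm ℝ (AnalyticSection n k V),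
      ∀ ξ, ENNReal.ofReal (p ξ) = intrinsicSeminorm G K a ξ := by
  refine exists_seminorm_of_ennreal _ (fun ξ ↦ ?_) (fun ξ η D D' hD hD' h h' ↦ ?_)
    fun c ξ D hD h ↦ ?_
  · obtain ⟨T, C, hC, h⟩ := exists_intrinsicSeminorm_le G hK a
    choose B hB0 hB using fun i : ChartWithCompact n k V × PosNullSeq ↦
      i.1.1.exists_localSeminorm_le_ofReal i.1.2.2.1 i.1.2.2.2 i.2 ξ
    have hS : 0 ≤ ∑ i ∈ T, B i := Finset.sum_nonneg fun i _ ↦ hB0 i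
    refine ⟨C * ∑ i ∈ T, B i, by positivity, h ξ _ hS fun i hi ↦ (hB i).trans ?_⟩
    exact ENNReal.ofReal_le_ofReal (Finset.single_le_sum (fun i _ ↦ hB0 i) hi)
  · rw [intrinsicSeminorm_le_ofReal_iff hD] at h
    rw [intrinsicSeminorm_le_ofReal_iff hD'] at h'
    rw [intrinsicSeminorm_le_ofReal_iff (add_nonneg hD hD')]
    intro x hx m
    refine (mul_le_mul_of_nonneg_left (jetNorm_add_le G m ξ η x) (a.partialProd_pos m).le).trans ?_
    rw [mul_add]
    exact add_le_add (h x hx m) (h' x hx m)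
  · rw [intrinsicSeminorm_le_ofReal_iff hD] at h
    rw [intrinsicSeminorm_le_ofReal_iff (by positivity)]
    intro x hx m
    rw [jetNorm_smul, mul_left_comm]
    exact mul_le_mul_of_nonneg_left (h x hx m) (abs_nonneg c)

/-- Two families of seminorms define the same topology when each member of one is bounded by a
multiple of a finite supremum from the other. A local seminorm needs one intrinsic seminorm, over
the image of `K` in the manifold; an intrinsic one needs finitely many local ones. -/
theorem intrinsicTopology_eq_localTopology (G : GeometricData n (EuclideanSpace ℝ (Fin k)) V) :
    intrinsicTopology G = localTopology n k V := by
  choose P hP using fun i : {K : Set M // IsCompact K} × PosNullSeq ↦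
    exists_seminorm_intrinsicSeminorm G i.1.2 i.2
  choose Q hQ using fun i : ChartWithCompact n k V × PosNullSeq ↦
    exists_seminorm_localSeminorm i.1.1 i.1.2.2.1 i.1.2.2.2 i.2
  have hPtop : intrinsicTopology G = seminormTopology fun i ξ ↦ ENNReal.ofReal (P i ξ) := by
    simp only [hP]
    rfl
  have hQtop : localTopology n k V = seminormTopology fun i ξ ↦ ENNReal.ofReal (Q i ξ) := by
    simp only [hQ]
    rfl
  have hPQ : Seminorm.IsBounded P Q LinearMap.id := Seminorm.IsBounded.of_real fun i ↦ by
    obtain ⟨b, C, hC, h⟩ := i.1.1.exists_localSeminorm_le G i.1.2.2.1 i.1.2.2.2 i.2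
    refine ⟨{(⟨_, i.1.2.2.1.image_of_continuousOn
      (i.1.1.baseChart.continuousOn_symm.mono i.1.2.2.2)⟩, b)}, C, fun ξ ↦ ?_⟩
    rw [Finset.sup_singleton, ← ENNReal.ofReal_le_ofReal_iff (mul_nonneg hC (apply_nonneg _ _))]
    exact (hQ i ξ).trans_le (h ξ _ (apply_nonneg _ _) (hP _ ξ).ge)
  have hQP : Seminorm.IsBounded Q P LinearMap.id := Seminorm.IsBounded.of_real fun i ↦ by
    obtain ⟨T, C, hC, h⟩ := exists_intrinsicSeminorm_le G i.1.2 i.2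
    refine ⟨T, C, fun ξ ↦ ?_⟩
    rw [← ENNReal.ofReal_le_ofReal_iff (mul_nonneg hC (apply_nonneg _ _))]
    refine (hP i ξ).trans_le (h ξ _ (apply_nonneg _ _) fun j hj ↦ (hQ j ξ).symm.trans_le ?_)
    exact ENNReal.ofReal_le_ofReal (Seminorm.le_finset_sup_apply hj)
  have h1 := withSeminorms_seminormTopology P
  have h2 := withSeminorms_seminormTopology Q
  rw [← hPtop] at h1
  rw [← hQtop] at h2
  have h3 := @WithSeminorms.congr _ _ _ _ _ _ _ _ _ (intrinsicTopology G) h1 hPQ hQP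
  exact (@WithSeminorms.withSeminorms_eq _ _ _ _ _ _ _ (intrinsicTopology G) h3).trans
    (@WithSeminorms.withSeminorms_eq _ _ _ _ _ _ _ (localTopology n k V) h2).symm
end
end JetTopology

theorem mainTheorem1 {n k : ℕ} {M : Type*} [TopologicalSpace M] [T2Space M]
    [SecondCountableTopology M] [ChartedSpace (EuclideanSpace ℝ (Fin n)) M]
    [IsManifold (𝓡 n) ω M]
    {V : M → Type*} [TopologicalSpace (TotalSpace (EuclideanSpace ℝ (Fin k)) V)]
    [∀ x, AddCommGroup (V x)] [∀ x, Module ℝ (V x)] [∀ x, TopologicalSpace (V x)]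
    [∀ x, IsTopologicalAddGroup (V x)] [∀ x, ContinuousSMul ℝ (V x)]
    [FiberBundle (EuclideanSpace ℝ (Fin k)) V] [VectorBundle ℝ (EuclideanSpace ℝ (Fin k)) V]
    [ContMDiffVectorBundle ω (EuclideanSpace ℝ (Fin k)) V (𝓡 n)] :
    -- the local expressions are (finite) seminorms on the space of real analytic sections
    (∀ (ψ : JetTopology.VectorBundleChart n k V) (K : Set (EuclideanSpace ℝ (Fin n))),
      IsCompact K → K ⊆ ψ.baseChart.target → ∀ a : JetTopology.PosNullSeq,
      ∃ q : Seminorm ℝ (JetTopology.AnalyticSection n k V),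
        ∀ ξ, ENNReal.ofReal (q ξ) = JetTopology.localSeminorm K a (ψ.pushforward ξ)) ∧
    -- the intrinsic expressions are (finite) seminorms
    (∀ (G : JetTopology.GeometricData n (EuclideanSpace ℝ (Fin k)) V) (K : Set M),
      IsCompact K → ∀ a : JetTopology.PosNullSeq,
      ∃ p : Seminorm ℝ (JetTopology.AnalyticSection n k V),
        ∀ ξ, ENNReal.ofReal (p ξ) = JetTopology.intrinsicSeminorm G K a ξ) ∧
    -- both families of seminorms define the same topology
    (∀ G : JetTopology.GeometricData n (EuclideanSpace ℝ (Fin k)) V,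
      JetTopology.intrinsicTopology G = JetTopology.localTopology n k V) ∧
    -- the topology does not depend on the metrics and connections
    (∀ G G' : JetTopology.GeometricData n (EuclideanSpace ℝ (Fin k)) V,
      JetTopology.intrinsicTopology G = JetTopology.intrinsicTopology G') := by
  have h := JetTopology.intrinsicTopology_eq_localTopology (n := n) (k := k) (M := M) (V := V)
  exact ⟨fun ψ K hK hKψ a ↦ JetTopology.exists_seminorm_localSeminorm ψ hK hKψ a,
    fun G K hK a ↦ JetTopology.exists_seminorm_intrinsicSeminorm G hK a, h,
    fun G G' ↦ (h G).trans (h G').symm⟩
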